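/- **Weiss-type monotonicity for $L_a$.** Let $n\ge 1$, $a\in(-1,1)$, $R_0>0$. Write points of $\mathbb R^{n+1}$ as $(x,y)$ with $x\in\mathbb R^n$, $y\in\mathbb R$, let $B_r=\{|(x,y)|<r\}$ and $S_r=\partial B_r$, and let $L_a v=\operatorname{div}(|y|^a\nabla v)$. Let $\tilde u$ be a solution in $B_{R_0}$ of the thin obstacle problem for $L_a$ with zero obstacle, that is: * $\tilde u$ is continuous in $B_{R_0}$ and of class $C^2$ in $B_{R_0}\cap\{y\neq 0\}$; for every $0<r<R_0$ the function $|\nabla\tilde u|^2|y|^a$ is integrable on $B_r$, and $y^aD_y\tilde u$ is bounded on $B_r\cap\{y>0\}$; * $L_a\tilde u=0$ in $B_{R_0}\cap\{y\ne0\}$; * $\tilde u(x,0)\ge 0$ for $(x,0)\in B_{R_0}$; * $\tilde u(x,-y)=\tilde u(x,y)$ in $B_{R_0}$; * for every $(x,0)\in B_{R_0}$ the limit $\lim_{y\to0^+}y^aD_y\tilde u(x,y)$ exists and $-\lim_{y\to0^+}y^aD_y\tilde u(x,y)\ge0$; * $\lim_{y\to0^+}y^aD_y\tilde u(x,y)=0$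 at every $(x,0)\in B_{R_0}$ where $\tilde u(x,0)>0$. Put $\tilde Q=n+1+a$, let $\tilde Z\tilde u=\langle x,\nabla_x\tilde u\rangle+yD_y\tilde u$, let $dH_n$ denote $n$-dimensional surface measure, and for $0<r<R_0$ set $$\tilde D(r)=\int_{B_r}|\nabla\tilde u|^2|y|^a\,dx\,dy,\qquad \tilde H(r)=\int_{S_r}\tilde u^2|y|^a\,dH_n .$$ For $\tilde\kappa>0$ define $$\tilde{\mathcal W}_{\tilde\kappa}(r)=\frac{1}{r^{\tilde Q-2+2\tilde\kappa}}\tilde D(r)-\frac{\tilde\kappa}{r^{\tilde Q-1+2\tilde\kappa}}\tilde H(r),\qquad 0<r<R_0.$$ Then for every $r\in(0,R_0)$ the functions $\tilde u^2|y|^a$ and $(\tilde Z\tilde u-\tilde\kappa\tilde u)^2|y|^a$ are integrable on $S_r$, the function $\tilde{\mathcal W}_{\tilde\kappa}$ is differentiable at $r$, and $$\frac{d}{dr}\tilde{\mathcal W}_{\tilde\kappa}(r)=\frac{2}{r^{\tilde Q+2\tilde\kappa}}\int_{S_r}(\tilde Z\tilde u-\tilde\kappa\tilde u)^2|y|^a\,dH_n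 .$$ Consequently $\tilde{\mathcal W}_{\tilde\kappa}$ is nondecreasing on $(0,R_0)$, and it is constant on $(0,R_0)$ if and only if $\tilde u$ is homogeneous of degree $\tilde\kappa$ in $B_{R_0}$, i.e. $\tilde u(tp)=t^{\tilde\kappa}\tilde u(p)$ whenever $t>0$ and $p,tp\in B_{R_0}$. -/

import Mathlib

open Set Filter Topology MeasureTheory

noncomputable section

namespace ThinObstacle

/-- The space `ℝⁿ⁺¹` with points `(x, y)`, `x ∈ ℝⁿ`, `y ∈ ℝ`; the last coordinate is `y`. -/
abbrev Pt (n : ℕ) : Type := EuclideanSpace ℝ (Fin (n + 1))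

/-- The coordinate `y` of the point `p = (x, y)`. -/
def yc {n : ℕ} (p : Pt n) : ℝ := p (Fin.last n)

/-- The `i`-th vector of the standard basis of `ℝⁿ⁺¹`. -/
def basisVec (n : ℕ) (i : Fin (n + 1)) : Pt n := EuclideanSpace.single i (1 : ℝ)

/-- The unit vector in the direction `y`. -/
def ey (n : ℕ) : Pt n := basisVec n (Fin.last n)

/-- The reflection `(x, y) ↦ (x, -y)`. -/
def reflectY {n : ℕ} (p : Pt n) : Pt n := p - (2 * yc p) • ey n

/-- The partial derivative of `u` in the `i`-th coordinate. -/
def partialD {n : ℕ} (i : Fin (n + 1)) (u : Pt n → ℝ) (p : Pt n) : ℝ :=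
  fderiv ℝ u p (basisVec n i)

/-- The partial derivative `D_y u`. -/
def Dy {n : ℕ} (u : Pt n → ℝ) (p : Pt n) : ℝ := partialD (Fin.last n) u p

/-- The operator `L_a u = div (|y|^a ∇u)`, evaluated pointwise. -/
def La {n : ℕ} (a : ℝ) (u : Pt n → ℝ) (p : Pt n) : ℝ :=
  ∑ i, partialD i (fun q => |yc q| ^ a * partialD i u q) p

/-- `u` is a solution in the ball `{|p| < R}` of the thin obstacle problem for `L_a` with zero
obstacle. Regularity: `u` is continuous in the ball, of class `C²` away from `y = 0`, has locally
finite weighted energy, and its weighted normal derivative `y^a D_y u` stays bounded up to `y = 0`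
in smaller balls; no regularity of `∇_x u` at `y = 0` and no continuity of the limit
of `y^a D_y u` are required. -/
structure IsSolution {n : ℕ} (a R : ℝ) (u : Pt n → ℝ) : Prop where
  continuousOn : ContinuousOn u (Metric.ball 0 R)
  contDiffOn : ContDiffOn ℝ 2 u (Metric.ball 0 R ∩ {p | yc p ≠ 0})
  finite_energy : ∀ r : ℝ, 0 < r → r < R →
    IntegrableOn (fun p => ‖gradient u p‖ ^ 2 * |yc p| ^ a) (Metric.ball 0 r)
  flux_bounded : ∀ r : ℝ, 0 < r → r < R →
    ∃ M : ℝ, ∀ p ∈ Metric.ball (0 : Pt n) r, 0 < yc p → |yc p ^ a * Dy u p| ≤ M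
  equation : ∀ p ∈ Metric.ball (0 : Pt n) R, yc p ≠ 0 → La a u p = 0
  obstacle : ∀ p ∈ Metric.ball (0 : Pt n) R, yc p = 0 → 0 ≤ u p
  even : ∀ p ∈ Metric.ball (0 : Pt n) R, u (reflectY p) = u p
  /-- At `p = (x, 0)` the limit `l` of `y^a D_y u (x, y)` as `y → 0⁺` exists, `-l ≥ 0`,
  and `l = 0` if `u (x, 0) > 0`. -/
  flux : ∀ p ∈ Metric.ball (0 : Pt n) R, yc p = 0 →
    ∃ l : ℝ, Tendsto (fun y : ℝ => y ^ a * Dy u (p + y • ey n)) (𝓝[>] 0) (𝓝 l) ∧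
      0 ≤ -l ∧ (0 < u p → l = 0)

/-- Integrability on the sphere `{|p| = r}` with respect to surface measure. -/
def SphereIntegrable {n : ℕ} (r : ℝ) (f : Pt n → ℝ) : Prop :=
  Integrable (fun ω : Metric.sphere (0 : Pt n) 1 => f (r • (ω : Pt n)))
    (volume : Measure (Pt n)).toSphere

/-- The integral over the sphere `{|p| = r}` in `ℝⁿ⁺¹`, `r > 0`, with respect to the
`n`-dimensional surface measure, i.e. the image of the surface measure of the unit sphere under
`ω ↦ r ω`, multiplied by `rⁿ`. -/
def sphereIntegral {n : ℕ} (r : ℝ) (f : Pt n → ℝ) : ℝ :=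
  r ^ n * ∫ ω : Metric.sphere (0 : Pt n) 1, f (r • (ω : Pt n)) ∂(volume : Measure (Pt n)).toSphere

/-- The weighted Dirichlet integral `D(u, r) = ∫_{B_r} |∇u|² |y|^a`. -/
def dirichlet {n : ℕ} (a : ℝ) (u : Pt n → ℝ) (r : ℝ) : ℝ :=
  ∫ p in Metric.ball (0 : Pt n) r, ‖gradient u p‖ ^ 2 * |yc p| ^ a

/-- The weighted height `H(u, r) = ∫_{∂B_r} u² |y|^a`. -/
def height {n : ℕ} (a : ℝ) (u : Pt n → ℝ) (r : ℝ) : ℝ :=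
  sphereIntegral r (fun p => u p ^ 2 * |yc p| ^ a)

/-- The generator of the dilations, `Z u (x, y) = ⟨x, ∇_x u⟩ + y D_y u`. -/
def Z {n : ℕ} (u : Pt n → ℝ) (p : Pt n) : ℝ := fderiv ℝ u p p

/-- The number `Q = n + 1 + a`. -/
def Q (n : ℕ) (a : ℝ) : ℝ := n + 1 + a

/-- The Weiss functional
`W_κ(u, r) = r^{-(Q - 2 + 2κ)} D(u, r) - κ r^{-(Q - 1 + 2κ)} H(u, r)`. -/
def weiss {n : ℕ} (a κ : ℝ) (u : Pt n → ℝ) (r : ℝ) : ℝ :=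
  1 / r ^ (Q n a - 2 + 2 * κ) * dirichlet a u r
    - κ / r ^ (Q n a - 1 + 2 * κ) * height a u r

/-- `u` is homogeneous of degree `κ` in the ball `{|p| < R}`. -/
def IsHomogeneousInBall {n : ℕ} (κ R : ℝ) (u : Pt n → ℝ) : Prop :=
  ∀ p ∈ Metric.ball (0 : Pt n) R, ∀ t : ℝ, 0 < t → t • p ∈ Metric.ball (0 : Pt n) R →
    u (t • p) = t ^ κ * u p

end ThinObstacle

end

/-! The Weiss functional is a combination of `D` and `H`. Its derivative becomes a perfect square
once two identities hold at every radius: `r D(r) = ∫_{S_r} u Zu |y|^a`, and the Rellich identity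
`r² D'(r) = 2 ∫_{S_r} (Zu)² |y|^a - (2 - Q) r D(r)`. Together with `H`, everything is then a
spherical integral of `(Zu)²`, `u Zu` or `u²`.

Neither identity can be obtained by applying the divergence theorem to `∇u` up to `y = 0`, because
tangential derivatives are not controlled there. Both come from one variational inequality,
`IsSolution.integral_cutoff_le`. The equation off the thin space is tested with `v` times a radial
cutoff times a cutoff of height `ε` in `y`. As `ε → 0` the layer term converges to a pairing of `v`
with the flux, whose sign follows from the obstacle conditions. Taking `v = ±u` yields equality and
the first identity. Taking `v` to be another solution yields a one-sided inequality and, for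
differences of solutions, a Caccioppoli estimate.

The Rellich identity comes from the dilates `u_s(p) = u(e^s p)`, which solve the same problem.
Testing with `u_s`, and bounding `∇u · ∇u_s` by half the sum of the squares, gives a function of `s`
that is nonnegative and vanishes at `0`. Its derivative at `0` must vanish, and this is
`IsSolution.integral_cutoff_rellich`. Differentiating needs `Z(Zu)` in weighted `L²`: apply the
Caccioppoli estimate to `u_s - u`, divide by `s`, and use Fatou.

The identities with arbitrary radial cutoffs hold on almost every sphere. Since `u`, `Zu`, `Z(Zu)`
are locally in weighted `L²`, the spherical means of `u²`, `u Zu`, `(Zu)²` exist and are continuous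
at every radius, which removes the "almost".

If the functional is constant, the square vanishes, so `Zu = κu` off the thin space. Integrating
along rays gives homogeneity, and continuity carries it to `y = 0`. The converse is Euler's
relation. -/

namespace ThinObstacle

variable {n : ℕ}

/-! ### The weight, the gradient product and the generator of dilations -/

/-- The weight `|y|^a`. -/
noncomputable def wt (a : ℝ) (p : Pt n) : ℝ := |yc p| ^ a

/-- The ball of radius `R` without the thin space `{y = 0}`. -/
def offThin (n : ℕ) (R : ℝ) : Set (Pt n) := Metric.ball 0 R ∩ {p | yc p ≠ 0}

/-- The scalar product `∇u · ∇v`. -/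
noncomputable def gr (u v : Pt n → ℝ) (p : Pt n) : ℝ := ∑ i, partialD i u p * partialD i v p

theorem continuous_yc : Continuous (yc : Pt n → ℝ) := by
  unfold yc; fun_prop

theorem yc_smul (t : ℝ) (p : Pt n) : yc (t • p) = t * yc p := by simp [yc]

theorem yc_add (p q : Pt n) : yc (p + q) = yc p + yc q := by simp [yc]

theorem yc_ey : yc (ey n) = 1 := by simp [yc, ey, basisVec]

theorem contDiff_yc {k : WithTop ℕ∞} : ContDiff ℝ k (yc : Pt n → ℝ) := by
  unfold yc; fun_prop

theorem abs_yc_le (p : Pt n) : |yc p| ≤ ‖p‖ := by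
  simpa [yc] using PiLp.norm_apply_le p (Fin.last n)

theorem isOpen_offThin (R : ℝ) : IsOpen (offThin n R) :=
  Metric.isOpen_ball.inter (isOpen_ne_fun continuous_yc continuous_const)

theorem offThin_mono {R R' : ℝ} (h : R ≤ R') : offThin n R ⊆ offThin n R' :=
  inter_subset_inter_left _ (Metric.ball_subset_ball h)

theorem ae_yc_ne_zero : ∀ᵐ p : Pt n, yc p ≠ 0 := by
  let s : Submodule ℝ (Pt n) := LinearMap.ker (EuclideanSpace.proj (𝕜 := ℝ) (Fin.last n)).toLinearMap
  have hs : s ≠ ⊤ := by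
    intro h
    have : ey n ∈ s := h ▸ Submodule.mem_top
    have h1 : yc (ey n) = 0 := this
    rw [yc_ey] at h1
    exact one_ne_zero h1
  have := Measure.addHaar_submodule (volume : Measure (Pt n)) s hs
  rw [ae_iff]
  refine measure_mono_null ?_ this
  intro p hp
  simpa [s, yc] using hp

theorem ae_offThin {R : ℝ} : ∀ᵐ p : Pt n ∂(volume.restrict (Metric.ball 0 R)), p ∈ offThin n R := by
  filter_upwards [ae_restrict_mem measurableSet_ball, ae_restrict_of_ae ae_yc_ne_zero] with p h1 h2
  exact ⟨h1, h2⟩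

theorem restrict_offThin (R : ℝ) :
    (volume : Measure (Pt n)).restrict (offThin n R) = volume.restrict (Metric.ball 0 R) := by
  refine Measure.restrict_congr_set ?_
  filter_upwards [ae_yc_ne_zero (n := n)] with p hp
  exact propext ⟨fun h => h.1, fun h => ⟨h, hp⟩⟩

theorem wt_nonneg (a : ℝ) (p : Pt n) : 0 ≤ wt a p := Real.rpow_nonneg (abs_nonneg _) _

theorem wt_smul (a : ℝ) {t : ℝ} (ht : 0 < t) (p : Pt n) : wt a (t • p) = t ^ a * wt a p := by
  unfold wt
  rw [yc_smul, abs_mul, abs_of_pos ht, Real.mul_rpow ht.le (abs_nonneg _)]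

theorem measurable_wt (a : ℝ) : Measurable (wt a : Pt n → ℝ) :=
  (continuous_yc.abs.measurable).pow_const a

theorem contDiffAt_wt (a : ℝ) {p : Pt n} (hp : yc p ≠ 0) {k : ℕ} :
    ContDiffAt ℝ k (wt a) p := by
  unfold wt
  exact ((contDiffAt_abs hp).comp p contDiff_yc.contDiffAt).rpow_const_of_ne (abs_ne_zero.2 hp)

/-- The ball lies in the cube `(-r, r)^(n+1)`, on which the weight is a product of functions of one
coordinate. All factors are constant except `|y|^a`, which is integrable because `a > -1`. -/
theorem integrableOn_wt_ball {a : ℝ} (ha : -1 < a) (r : ℝ) :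
    IntegrableOn (wt a : Pt n → ℝ) (Metric.ball 0 r) := by
  have h1 : Integrable (fun x : Fin (n + 1) → ℝ => ∏ i, (Ioo (-r) r).indicator
      (fun y : ℝ => if i = Fin.last n then |y| ^ a else 1) (x i)) := by
    refine Integrable.fintype_prod (f := fun i => (Ioo (-r) r).indicator
      (fun y : ℝ => if i = Fin.last n then |y| ^ a else 1)) fun i => ?_
    rw [integrable_indicator_iff measurableSet_Ioo]
    by_cases hi : i = Fin.last n
    · simp only [hi, if_true]
      rcases le_or_gt r 0 with hr | hr
      · rw [Ioo_eq_empty (by linarith)]; exact integrableOn_empty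
      have : IntegrableOn (fun y : ℝ => y ^ a) (Ioo 0 r) :=
        (intervalIntegral.integrableOn_Ioo_rpow_iff hr).2 ha
      have h2 : IntegrableOn (fun y : ℝ => |y| ^ a) (Ioo 0 r) :=
        this.congr_fun (fun y hy => by simp [abs_of_pos hy.1]) measurableSet_Ioo
      have h3 : IntegrableOn (fun y : ℝ => |y| ^ a) (Ioo (-r) 0) := by
        have := h2.comp_neg
        simpa using this
      have h4 : IntegrableOn (fun y : ℝ => |y| ^ a) {0} := by
        simp
      refine ((h3.union h4).union h2).mono_set ?_
      intro y hy
      rcases lt_trichotomy y 0 with h | h | h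
      · exact Or.inl (Or.inl ⟨hy.1, h⟩)
      · exact Or.inl (Or.inr h)
      · exact Or.inr ⟨h, hy.2⟩
    · simp only [hi, if_false]
      exact integrableOn_const (by simp)
  have h2 := (EuclideanSpace.volume_preserving_symm_measurableEquiv_toLp (Fin (n+1))).integrable_comp_of_integrable h1
  have h3 := h2.integrableOn (s := Metric.ball (0 : Pt n) r)
  refine h3.congr_fun (fun p hp => ?_) measurableSet_ball
  have hp' : ∀ i, p i ∈ Ioo (-r) r := by
    intro i
    rw [mem_Ioo, ← abs_lt]
    have h := PiLp.norm_apply_le p i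
    rw [Real.norm_eq_abs] at h
    exact h.trans_lt (by simpa using hp)
  simp only [Function.comp]
  have : ∀ i, (Ioo (-r) r).indicator
      (fun y : ℝ => if i = Fin.last n then |y| ^ a else 1) (p i) =
      if i = Fin.last n then |p i| ^ a else 1 := fun i => indicator_of_mem (hp' i) _
  change ∏ i, (Ioo (-r) r).indicator
      (fun y : ℝ => if i = Fin.last n then |y| ^ a else 1) (p i) = _
  simp only [this, Finset.prod_ite_eq', Finset.mem_univ, if_true, wt, yc]

theorem norm_gradient (u : Pt n → ℝ) (p : Pt n) : ‖gradient u p‖ = ‖fderiv ℝ u p‖ := by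
  simp [gradient]

theorem gradient_apply (u : Pt n → ℝ) (p : Pt n) (i : Fin (n + 1)) :
    gradient u p i = partialD i u p := by
  have h : inner ℝ (gradient u p) (basisVec n i) = fderiv ℝ u p (basisVec n i) := by
    simp [gradient]
  rw [partialD, ← h, basisVec, EuclideanSpace.inner_single_right]
  simp

theorem norm_gradient_sq (u : Pt n → ℝ) (p : Pt n) : ‖gradient u p‖ ^ 2 = gr u u p := by
  rw [EuclideanSpace.real_norm_sq_eq]
  simp [gradient_apply, gr, sq]

theorem gr_nonneg (u : Pt n → ℝ) (p : Pt n) : 0 ≤ gr u u p :=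
  Finset.sum_nonneg fun _ _ => mul_self_nonneg _

theorem gr_comm (u v : Pt n → ℝ) (p : Pt n) : gr u v p = gr v u p := by
  simp [gr, mul_comm]

/-- The sign `ε = ±1` treats both bounds by one expanded square. Equality at `v = u` is what makes
the comparison function in the Rellich argument vanish at its minimum. -/
theorem abs_gr_le (u v : Pt n → ℝ) (p : Pt n) : |gr u v p| ≤ (gr u u p + gr v v p) / 2 := by
  have h1 : ∀ ε : ℝ, ε ^ 2 = 1 → ε * gr u v p ≤ (gr u u p + gr v v p) / 2 := by
    intro ε hε
    unfold gr
    rw [Finset.mul_sum, ← Finset.sum_add_distrib, Finset.sum_div]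
    refine Finset.sum_le_sum fun i _ => ?_
    nlinarith [sq_nonneg (partialD i u p - ε * partialD i v p)]
  rw [abs_le]
  constructor
  · linarith [h1 (-1) (by norm_num)]
  · linarith [h1 1 (by norm_num)]

theorem Z_eq_sum (u : Pt n → ℝ) (p : Pt n) : Z u p = ∑ i, p i * partialD i u p := by
  have h : inner ℝ (gradient u p) p = fderiv ℝ u p p := by simp [gradient]
  rw [Z, ← h, PiLp.inner_apply]
  simp [gradient_apply]

theorem sq_Z_le (u : Pt n → ℝ) (p : Pt n) : Z u p ^ 2 ≤ ‖p‖ ^ 2 * gr u u p := by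
  rw [← norm_gradient_sq, norm_gradient, Z, ← mul_pow, ← sq_abs]
  have := (fderiv ℝ u p).le_opNorm p
  rw [Real.norm_eq_abs] at this
  gcongr
  linarith

theorem measurable_partialD (i : Fin (n + 1)) (u : Pt n → ℝ) : Measurable (partialD i u) :=
  measurable_fderiv_apply_const ℝ u _

theorem measurable_Z (u : Pt n → ℝ) : Measurable (Z u) := by
  have : Z u = fun p => ∑ i, p i * partialD i u p := funext (Z_eq_sum u)
  rw [this]
  refine Finset.measurable_sum _ fun i _ => Measurable.mul (by fun_prop) (measurable_partialD i u)

theorem measurable_gr (u v : Pt n → ℝ) : Measurable (gr u v) :=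
  Finset.measurable_sum _ fun i _ => (measurable_partialD i u).mul (measurable_partialD i v)

theorem partialD_comp_smul (i : Fin (n + 1)) (u : Pt n → ℝ) (t : ℝ) (p : Pt n) :
    partialD i (fun q => u (t • q)) p = t * partialD i u (t • p) := by
  have := fderiv_comp_smul (𝕜 := ℝ) (f := u) (x := p) t
  simp only [partialD]
  rw [this]; simp

theorem Z_comp_smul (u : Pt n → ℝ) (t : ℝ) (p : Pt n) :
    Z (fun q => u (t • q)) p = Z u (t • p) := by
  rw [Z_eq_sum, Z_eq_sum]
  refine Finset.sum_congr rfl fun i _ => ?_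
  rw [partialD_comp_smul]; simp; ring

theorem gr_comp_smul (u : Pt n → ℝ) (t : ℝ) (p : Pt n) :
    gr (fun q => u (t • q)) (fun q => u (t • q)) p = t ^ 2 * gr u u (t • p) := by
  simp only [gr, partialD_comp_smul, Finset.mul_sum]
  exact Finset.sum_congr rfl fun i _ => by ring

theorem contDiffOn_partialD {u : Pt n → ℝ} {s : Set (Pt n)} (hs : IsOpen s)
    {k m : WithTop ℕ∞} (hu : ContDiffOn ℝ k u s) (hm : m + 1 ≤ k) (i : Fin (n + 1)) :
    ContDiffOn ℝ m (partialD i u) s :=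
  (hu.fderiv_of_isOpen hs hm).clm_apply contDiffOn_const

theorem contDiffOn_Z {u : Pt n → ℝ} {s : Set (Pt n)} (hs : IsOpen s)
    {k m : WithTop ℕ∞} (hu : ContDiffOn ℝ k u s) (hm : m + 1 ≤ k) :
    ContDiffOn ℝ m (Z u) s :=
  (hu.fderiv_of_isOpen hs hm).clm_apply contDiffOn_id

theorem contDiffOn_offThin_aestronglyMeasurable {F : Pt n → ℝ} {R : ℝ}
    (h : ContinuousOn F (offThin n R)) :
    AEStronglyMeasurable F (volume.restrict (Metric.ball 0 R)) := by
  rw [← restrict_offThin]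
  exact h.aestronglyMeasurable (isOpen_offThin R).measurableSet

end ThinObstacle

/-! ### Weighted integrability and the weak equation off the thin space -/

namespace ThinObstacle

variable {n : ℕ}

theorem integrable_continuous_mul {r : ℝ} {g F : Pt n → ℝ} (hg : Continuous g)
    (hz : ∀ p, r ≤ ‖p‖ → g p = 0) (hF : IntegrableOn F (Metric.ball 0 r)) :
    Integrable (fun p => g p * F p) := by
  have hc : HasCompactSupport g := HasCompactSupport.intro (isCompact_closedBall (0 : Pt n) r)
    fun p hp => hz p (by simpa using (not_le.1 (by simpa using hp)).le)
  obtain ⟨C, hC⟩ := hc.exists_bound_of_continuous hg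
  have h1 : IntegrableOn (fun p => g p * F p) (Metric.ball 0 r) :=
    hF.bdd_mul hg.aestronglyMeasurable (ae_of_all _ hC)
  refine (integrableOn_iff_integrable_of_support_subset ?_).1 h1
  intro p hp
  by_contra h
  exact hp (by simp [hz p (by simpa using h)])

theorem integrableOn_mul_mul_wt {a : ℝ} {r : ℝ} {f g : Pt n → ℝ}
    (hf : AEStronglyMeasurable f (volume.restrict (Metric.ball 0 r)))
    (hg : AEStronglyMeasurable g (volume.restrict (Metric.ball 0 r)))
    (hf2 : IntegrableOn (fun p => f p ^ 2 * wt a p) (Metric.ball 0 r))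
    (hg2 : IntegrableOn (fun p => g p ^ 2 * wt a p) (Metric.ball 0 r)) :
    IntegrableOn (fun p => f p * g p * wt a p) (Metric.ball 0 r) := by
  refine Integrable.mono' (hf2.add hg2)
    ((hf.mul hg).mul (measurable_wt a).aestronglyMeasurable) (ae_of_all _ fun p => ?_)
  simp only [Pi.add_apply, ← add_mul]
  rw [Real.norm_eq_abs, abs_mul, abs_of_nonneg (wt_nonneg a p)]
  refine mul_le_mul_of_nonneg_right ?_ (wt_nonneg a p)
  rw [abs_mul, ← sq_abs (f p), ← sq_abs (g p)]
  nlinarith [sq_nonneg (|f p| - |g p|), abs_nonneg (f p), abs_nonneg (g p)]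

theorem integrableOn_sq_wt {a : ℝ} (ha : -1 < a) {R r : ℝ} {v : Pt n → ℝ} (hr : r < R)
    (hv : ContinuousOn v (Metric.ball 0 R)) :
    IntegrableOn (fun p => v p ^ 2 * wt a p) (Metric.ball 0 r) := by
  obtain ⟨C, hC⟩ := (isCompact_closedBall (0 : Pt n) r).exists_bound_of_continuousOn
    (hv.mono (Metric.closedBall_subset_ball hr))
  have hm : AEStronglyMeasurable v (volume.restrict (Metric.ball 0 r)) :=
    (hv.mono (Metric.ball_subset_ball hr.le)).aestronglyMeasurable measurableSet_ball
  refine (integrableOn_wt_ball ha r).bdd_mul (c := C ^ 2) (hm.pow 2) ?_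
  filter_upwards [ae_restrict_mem measurableSet_ball] with p hp
  rw [norm_pow]
  exact pow_le_pow_left₀ (norm_nonneg _) (hC p (Metric.ball_subset_closedBall hp)) 2

theorem integrableOn_sq_Z {a r : ℝ} {v : Pt n → ℝ}
    (hv : IntegrableOn (fun p => gr v v p * wt a p) (Metric.ball 0 r)) :
    IntegrableOn (fun p => Z v p ^ 2 * wt a p) (Metric.ball 0 r) := by
  refine Integrable.mono' (hv.const_mul (r ^ 2))
    (((measurable_Z v).pow_const 2).mul (measurable_wt a)).aestronglyMeasurable ?_
  filter_upwards [ae_restrict_mem measurableSet_ball] with p hp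
  have hp' : ‖p‖ < r := by simpa using hp
  rw [Real.norm_of_nonneg (mul_nonneg (sq_nonneg _) (wt_nonneg a p)), ← mul_assoc]
  refine mul_le_mul_of_nonneg_right ((sq_Z_le v p).trans ?_) (wt_nonneg a p)
  exact mul_le_mul_of_nonneg_right (pow_le_pow_left₀ (norm_nonneg _) hp'.le 2) (gr_nonneg v p)

theorem integrableOn_gr {a r : ℝ} {u v : Pt n → ℝ}
    (hu : IntegrableOn (fun p => gr u u p * wt a p) (Metric.ball 0 r))
    (hv : IntegrableOn (fun p => gr v v p * wt a p) (Metric.ball 0 r)) :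
    IntegrableOn (fun p => gr u v p * wt a p) (Metric.ball 0 r) := by
  refine Integrable.mono' ((hu.add hv).div_const 2)
    ((measurable_gr u v).mul (measurable_wt a)).aestronglyMeasurable (ae_of_all _ fun p => ?_)
  rw [Real.norm_eq_abs, abs_mul, abs_of_nonneg (wt_nonneg a p), Pi.add_apply, ← add_mul,
    mul_div_right_comm]
  exact mul_le_mul_of_nonneg_right (abs_gr_le u v p) (wt_nonneg a p)

theorem IsSolution.integrableOn_gr {a R r : ℝ} {u : Pt n → ℝ} (hu : IsSolution a R u)
    (h0 : 0 < r) (hr : r < R) :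
    IntegrableOn (fun p => gr u u p * wt a p) (Metric.ball 0 r) := by
  refine (hu.finite_energy r h0 hr).congr_fun (fun p _ => ?_) measurableSet_ball
  simp only [norm_gradient_sq, wt]

/-- A nonnegative radial cutoff `χ`, supported in the ball of radius `r`,
with `∇χ (p) = -ψ (p) p`. -/
structure RadialCutoff (r : ℝ) (χ ψ : Pt n → ℝ) : Prop where
  contDiff : ContDiff ℝ 1 χ
  continuous_deriv : Continuous ψ
  eq_zero : ∀ p, r ≤ ‖p‖ → χ p = 0
  deriv_eq_zero : ∀ p, r ≤ ‖p‖ → ψ p = 0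
  fderiv_eq : ∀ p h, fderiv ℝ χ p h = -(ψ p * inner ℝ p h)
  nonneg : ∀ p, 0 ≤ χ p

theorem integral_partialD_eq_zero {F : Pt n → ℝ} (hF : ContDiff ℝ 1 F) (hc : HasCompactSupport F)
    (i : Fin (n + 1)) : Integrable (partialD i F) ∧ ∫ p, partialD i F p = 0 := by
  have hcont : Continuous (partialD i F) :=
    (hF.continuous_fderiv one_ne_zero).clm_apply continuous_const
  have hc' : HasCompactSupport (partialD i F) := hc.fderiv_apply (𝕜 := ℝ) _
  have hint := hcont.integrable_of_hasCompactSupport (μ := volume) hc'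
  have hint' : Integrable (fun x => fderiv ℝ F x (basisVec n i)) volume := hint
  refine ⟨hint, ?_⟩
  -- Integration by parts against the constant function `1`.
  have := integral_mul_fderiv_eq_neg_fderiv_mul_of_integrable (μ := (volume : Measure (Pt n)))
    (f := fun _ : Pt n => (1 : ℝ)) (g := F) (v := basisVec n i)
    (by simp)
    (by simpa using hint')
    (by simpa using hF.continuous.integrable_of_hasCompactSupport hc)
    (fun _ _ => by fun_prop) (fun p _ => (hF.differentiable one_ne_zero) p)
  simpa [partialD] using this

/-- Divergence theorem for the field `φ |y|^a ∇u`. Since the support of `φ` stays away from the thin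
space and `u` is `C²` there, the field is `C¹` with compact support, and the equation removes the
term `φ L_a u`. -/
theorem IsSolution.integral_gr_eq_zero {a R : ℝ} {u φ : Pt n → ℝ} (hu : IsSolution a R u)
    (hφ : ContDiffOn ℝ 1 φ (offThin n R)) (hc : HasCompactSupport φ)
    (hs : tsupport φ ⊆ offThin n R) : ∫ p, gr φ u p * wt a p = 0 := by
  have hφ' : ∀ p ∈ offThin n R, ContDiffAt ℝ 1 φ p :=
    fun p hp => hφ.contDiffAt ((isOpen_offThin R).mem_nhds hp)
  have hu1 : ∀ i, ∀ p ∈ offThin n R, ContDiffAt ℝ 1 (fun q => |yc q| ^ a * partialD i u q) p := by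
    intro i p hp
    refine (contDiffAt_wt a hp.2 (k := 1)).mul ?_
    exact (contDiffOn_partialD (isOpen_offThin R) hu.contDiffOn (m := 1)
      (by norm_num) i).contDiffAt ((isOpen_offThin R).mem_nhds hp)
  let F : Fin (n + 1) → Pt n → ℝ := fun i p => φ p * (|yc p| ^ a * partialD i u p)
  have hF : ∀ i, ContDiff ℝ 1 (F i) := by
    intro i
    rw [contDiff_iff_contDiffAt]
    intro p
    by_cases hp : p ∈ offThin n R
    · exact (hφ' p hp).mul (hu1 i p hp)
    · have : F i =ᶠ[𝓝 p] fun _ => 0 := by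
        filter_upwards [notMem_tsupport_iff_eventuallyEq.1 fun h => hp (hs h)] with q hq
        simp [F, hq]
      exact contDiffAt_const.congr_of_eventuallyEq this
  have hFc : ∀ i, HasCompactSupport (F i) := fun i => hc.mul_right
  have hsum : ∫ p, ∑ i, partialD i (F i) p = 0 := by
    rw [integral_finsetSum _ fun i _ => (integral_partialD_eq_zero (hF i) (hFc i) i).1]
    exact Finset.sum_eq_zero fun i _ => (integral_partialD_eq_zero (hF i) (hFc i) i).2
  rw [← hsum]
  refine integral_congr_ae (ae_of_all _ fun p => ?_)
  simp only
  by_cases hp : p ∈ offThin n R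
  · have h1 : ∀ i, partialD i (F i) p = φ p * partialD i (fun q => |yc q| ^ a * partialD i u q) p
        + partialD i φ p * partialD i u p * wt a p := by
      intro i
      simp only [partialD, F]
      have e := fderiv_fun_mul ((hφ' p hp).differentiableAt one_ne_zero)
        ((hu1 i p hp).differentiableAt one_ne_zero)
      simp only [partialD] at e
      rw [e]
      simp [wt]; ring
    have h2 := hu.equation p hp.1 hp.2
    unfold La at h2
    simp only [h1, Finset.sum_add_distrib, ← Finset.mul_sum, h2, ← Finset.sum_mul, gr]
    ring
  · have hp' : p ∉ tsupport φ := fun h => hp (hs h)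
    have h1 : ∀ i, partialD i φ p = 0 := fun i => by
      simp [partialD, fderiv_of_notMem_tsupport ℝ hp']
    have h2 : ∀ i, partialD i (F i) p = 0 := fun i => by
      have : p ∉ tsupport (F i) := fun h => hp' (tsupport_mul_subset_left h)
      simp [partialD, fderiv_of_notMem_tsupport ℝ this]
    simp [gr, h1, h2]

end ThinObstacle

/-! ### Squeezing towards the thin space and even reflection -/

namespace ThinObstacle

variable {n : ℕ}

/-- The linear map `(x, y) ↦ (x, ε y)`. -/
noncomputable def squeeze (n : ℕ) (ε : ℝ) : Pt n →ₗ[ℝ] Pt n :=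
  LinearMap.transvection (EuclideanSpace.proj (𝕜 := ℝ) (Fin.last n)).toLinearMap ((ε - 1) • ey n)

theorem squeeze_apply (ε : ℝ) (p : Pt n) : squeeze n ε p = p + (yc p * (ε - 1)) • ey n := by
  simp [squeeze, LinearMap.transvection.apply, yc, smul_smul]

theorem yc_squeeze (ε : ℝ) (p : Pt n) : yc (squeeze n ε p) = ε * yc p := by
  rw [squeeze_apply, yc_add, yc_smul, yc_ey]; ring

/-- The map is a transvection of determinant `ε`. It brings the layer `|y| ~ ε`, where the thin
cutoff varies, to fixed thickness. -/
theorem integral_comp_squeeze {ε : ℝ} (hε : 0 < ε) (f : Pt n → ℝ) :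
    ∫ p, f (squeeze n ε p) = ε⁻¹ * ∫ p, f p := by
  have hdet : LinearMap.det (squeeze n ε) = ε := by
    have h1 : (EuclideanSpace.proj (𝕜 := ℝ) (Fin.last n)) (ey n) = 1 := yc_ey
    rw [squeeze, LinearMap.transvection.det]
    simp [h1]
  have hmap := Measure.map_linearMap_addHaar_eq_smul_addHaar (volume : Measure (Pt n))
    (f := squeeze n ε) (by rw [hdet]; exact hε.ne')
  have hker : LinearMap.ker (squeeze n ε) = ⊥ := by
    rw [LinearMap.ker_eq_bot']
    intro p hp
    have h1 : yc p = 0 := by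
      have := yc_squeeze ε p
      rw [hp] at this
      simpa [yc, hε.ne'] using this
    rw [squeeze_apply, h1] at hp
    simpa using hp
  have hemb := (LinearMap.isClosedEmbedding_of_injective hker).measurableEmbedding
  rw [← hemb.integral_map, hmap, integral_smul_measure, hdet, abs_of_pos (inv_pos.2 hε),
    ENNReal.toReal_ofReal (inv_pos.2 hε).le, smul_eq_mul]

/-- As `u` is even in `y`, `D_y u` is odd and `y D_y u` is even. This transfers the flux hypotheses,
given only for `y > 0`, to `y < 0`. -/
theorem IsSolution.Dy_reflect {a R : ℝ} {u : Pt n → ℝ} (hu : IsSolution a R u) {q : Pt n}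
    (hq : yc q = 0) {y : ℝ} (hy : y ≠ 0) (hb : q + y • ey n ∈ Metric.ball (0 : Pt n) R)
    (hb' : q + |y| • ey n ∈ Metric.ball (0 : Pt n) R) :
    y * Dy u (q + y • ey n) = |y| * Dy u (q + |y| • ey n) := by
  rcases lt_or_gt_of_ne hy with h | h
  swap
  · rw [abs_of_pos h]
  rw [abs_of_neg h] at hb' ⊢
  have hr : ∀ z : ℝ, reflectY (q + z • ey n) = q + (-z) • ey n := by
    intro z
    rw [reflectY, yc_add, yc_smul, yc_ey, hq]
    module
  have hd : DifferentiableAt ℝ u (q + (-y) • ey n) :=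
    (hu.contDiffOn.contDiffAt ((isOpen_offThin R).mem_nhds
      ⟨hb', by rw [mem_ofPred_eq, yc_add, yc_smul, yc_ey, hq]; simpa using hy⟩)).differentiableAt (by norm_num)
  let ρ : Pt n →L[ℝ] Pt n := ContinuousLinearMap.id ℝ _ -
    (2 : ℝ) • (EuclideanSpace.proj (𝕜 := ℝ) (Fin.last n)).smulRight (ey n)
  have hρ : ∀ p, ρ p = reflectY p := by
    intro p
    simp [ρ, reflectY, yc, smul_smul]
  have h1 : u ∘ ρ =ᶠ[𝓝 (q + y • ey n)] u := by
    filter_upwards [Metric.isOpen_ball.mem_nhds hb] with p hp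
    simp only [Function.comp, hρ]
    exact hu.even p hp
  have h2 : fderiv ℝ (u ∘ ρ) (q + y • ey n) = (fderiv ℝ u (q + (-y) • ey n)).comp ρ := by
    rw [fderiv_comp, hρ, hr, ρ.fderiv]
    · rw [hρ, hr]; exact hd
    · exact ρ.differentiableAt
  have h3 : ρ (ey n) = - ey n := by
    rw [hρ, reflectY, yc_ey]; module
  have h4 : Dy u (q + y • ey n) = - Dy u (q + (-y) • ey n) := by
    unfold Dy partialD
    rw [← h1.fderiv_eq, h2, ContinuousLinearMap.comp_apply]
    change (fderiv ℝ u _) (ρ (ey n)) = _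
    rw [h3, map_neg]; rfl
  rw [h4]; ring

theorem exists_bound_deriv_smoothTransition :
    ∃ C, 0 ≤ C ∧ ∀ x, |deriv Real.smoothTransition x| ≤ C := by
  have hc : Continuous (deriv Real.smoothTransition) :=
    (Real.smoothTransition.contDiff (n := 1)).continuous_deriv le_rfl
  have hs : HasCompactSupport (deriv Real.smoothTransition) := by
    refine HasCompactSupport.intro (isCompact_Icc (a := (0 : ℝ)) (b := 1)) fun x hx => ?_
    rcases lt_or_ge x 0 with h | h
    · have : Real.smoothTransition =ᶠ[𝓝 x] fun _ => 0 := by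
        filter_upwards [Iio_mem_nhds h] with z hz
        exact Real.smoothTransition.zero_of_nonpos (le_of_lt hz)
      rw [this.deriv_eq]; simp
    · have h' : 1 < x := by
        by_contra h2; exact hx ⟨h, not_lt.1 h2⟩
      have : Real.smoothTransition =ᶠ[𝓝 x] fun _ => 1 := by
        filter_upwards [Ioi_mem_nhds h'] with z hz
        exact Real.smoothTransition.one_of_one_le (le_of_lt hz)
      rw [this.deriv_eq]; simp
  obtain ⟨C, hC⟩ := hs.exists_bound_of_continuous hc
  exact ⟨C, (norm_nonneg _).trans (hC 0), hC⟩

theorem deriv_smoothTransition_of_one_lt {x : ℝ} (h : 1 < x) :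
    deriv Real.smoothTransition x = 0 := by
  have : Real.smoothTransition =ᶠ[𝓝 x] fun _ => 1 := by
    filter_upwards [Ioi_mem_nhds h] with z hz
    exact Real.smoothTransition.one_of_one_le (le_of_lt hz)
  rw [this.deriv_eq]; simp

theorem deriv_smoothTransition_nonneg (x : ℝ) : 0 ≤ deriv Real.smoothTransition x :=
  Real.smoothTransition.monotone.deriv_nonneg

theorem continuous_mul_of_eq_zero {R r : ℝ} (hr : r < R) {χ v : Pt n → ℝ} (hχ : Continuous χ)
    (hz : ∀ p, r ≤ ‖p‖ → χ p = 0) (hv : ContinuousOn v (Metric.ball 0 R)) :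
    Continuous fun p => χ p * v p := by
  rw [continuous_iff_continuousAt]
  intro p
  rcases lt_or_ge ‖p‖ R with h | h
  · exact hχ.continuousAt.mul (hv.continuousAt (Metric.isOpen_ball.mem_nhds (by simpa using h)))
  · have : (fun p => χ p * v p) =ᶠ[𝓝 p] fun _ => 0 := by
      filter_upwards [(isOpen_lt continuous_const continuous_norm).mem_nhds (hr.trans_le h)]
        with q hq
      simp [hz q (le_of_lt hq)]
    exact continuousAt_const.congr this.symm

end ThinObstacle

/-! ### The flux term in the thin layer and the sign of its limit -/

namespace ThinObstacle

variable {n : ℕ}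

theorem norm_sq_add_smul_ey {q : Pt n} (hq : yc q = 0) (z : ℝ) :
    ‖q + z • ey n‖ ^ 2 = ‖q‖ ^ 2 + z ^ 2 := by
  have h1 : inner ℝ q (z • ey n) = 0 := by
    rw [inner_smul_right, ey, basisVec, EuclideanSpace.inner_single_right]
    have : q (Fin.last n) = 0 := hq
    simp [this]
  have h2 : ‖z • ey n‖ ^ 2 = z ^ 2 := by
    rw [norm_smul, mul_pow]; simp [ey, basisVec]
  rw [norm_add_sq_real, h1, h2]; ring

/-- The flux term created by cutting off near the thin space at height `ε`, in the rescaled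
variable `(x, y / ε)`. -/
noncomputable def thinTerm (a : ℝ) (u f : Pt n → ℝ) (ε : ℝ) (p : Pt n) : ℝ :=
  deriv Real.smoothTransition (yc p ^ 2 - 1) * (2 * yc p) *
    (f (squeeze n ε p) * (wt a (squeeze n ε p) * Dy u (squeeze n ε p)))

theorem squeeze_eq (ε : ℝ) (p : Pt n) :
    squeeze n ε p = (p - yc p • ey n) + (ε * yc p) • ey n := by
  rw [squeeze_apply]; module

theorem yc_sub_smul_ey (p : Pt n) : yc (p - yc p • ey n) = 0 := by
  rw [sub_eq_add_neg, ← neg_smul, yc_add, yc_smul, yc_ey]; ring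

/-- The factor `y` coming from the derivative of the cutoff makes the flux even, so it may be
evaluated at the reflected point with positive last coordinate, which has the same norm. -/
theorem IsSolution.yc_mul_flux {a R : ℝ} {u : Pt n → ℝ} (hu : IsSolution a R u) {ε : ℝ}
    (hε : 0 < ε) {p : Pt n} (hp : yc p ≠ 0) (hb : squeeze n ε p ∈ Metric.ball (0 : Pt n) R) :
    (p - yc p • ey n) + |ε * yc p| • ey n ∈ Metric.ball (0 : Pt n) R ∧
    yc p * (wt a (squeeze n ε p) * Dy u (squeeze n ε p)) =
      |yc p| * (|ε * yc p| ^ a * Dy u ((p - yc p • ey n) + |ε * yc p| • ey n)) := by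
  have hq := yc_sub_smul_ey p
  have hb' : (p - yc p • ey n) + |ε * yc p| • ey n ∈ Metric.ball (0 : Pt n) R := by
    rw [mem_ball_zero_iff] at hb ⊢
    refine lt_of_le_of_lt (le_of_eq ?_) hb
    rw [← sq_eq_sq₀ (norm_nonneg _) (norm_nonneg _), squeeze_eq, norm_sq_add_smul_ey hq,
      norm_sq_add_smul_ey hq, sq_abs]
  refine ⟨hb', ?_⟩
  have h := hu.Dy_reflect hq (mul_ne_zero hε.ne' hp) (by rwa [← squeeze_eq]) hb'
  rw [← squeeze_eq, abs_mul, abs_of_pos hε, mul_assoc, mul_assoc, ← abs_of_pos hε, ← abs_mul,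
    abs_of_pos hε] at h
  have h2 := mul_left_cancel₀ hε.ne' h
  rw [wt, yc_squeeze]
  linear_combination |ε * yc p| ^ a * h2

/-- As `ε → 0` the squeezed point tends to the projection `q` of `p` on the thin space. If `q` lies
in the ball, the flux converges to its limit `l` at `q` and `f q * l ≤ 0` fixes the sign. Otherwise
`f` vanishes near `q`, because it is supported in a smaller ball. -/
theorem IsSolution.tendsto_thinTerm {a R : ℝ} {u f : Pt n → ℝ} (hu : IsSolution a R u)
    (hf : Continuous f) {r : ℝ} (hr : r < R) (hz : ∀ p, r ≤ ‖p‖ → f p = 0)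
    (hs : ∀ q ∈ Metric.ball (0 : Pt n) R, yc q = 0 → ∀ l : ℝ,
      Tendsto (fun y : ℝ => y ^ a * Dy u (q + y • ey n)) (𝓝[>] 0) (𝓝 l) → f q * l ≤ 0)
    (p : Pt n) : ∃ L ≤ 0, yc p ≠ 0 →
      Tendsto (fun ε => thinTerm a u f ε p) (𝓝[>] 0) (𝓝 L) := by
  set q := p - yc p • ey n with hqdef
  have hq : yc q = 0 := yc_sub_smul_ey p
  have hlim : Tendsto (fun ε => squeeze n ε p) (𝓝[>] 0) (𝓝 q) := by
    have : Continuous fun ε : ℝ => squeeze n ε p := by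
      simp only [squeeze_apply]; fun_prop
    have h := this.tendsto 0
    simp only [squeeze_eq, zero_mul, zero_smul, add_zero] at h
    exact (h.mono_left nhdsWithin_le_nhds).congr fun ε => (squeeze_eq ε p).symm
  have hflim : Tendsto (fun ε => f (squeeze n ε p)) (𝓝[>] 0) (𝓝 (f q)) :=
    (hf.tendsto q).comp hlim
  rcases lt_or_ge ‖q‖ R with h | h
  · have hqb : q ∈ Metric.ball (0 : Pt n) R := by simpa using h
    obtain ⟨l, hl, -, -⟩ := hu.flux q hqb hq
    refine ⟨deriv Real.smoothTransition (yc p ^ 2 - 1) * 2 * |yc p| * (f q * l), ?_, fun hp => ?_⟩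
    · exact mul_nonpos_of_nonneg_of_nonpos (mul_nonneg (mul_nonneg
        (deriv_smoothTransition_nonneg _) zero_le_two) (abs_nonneg _)) (hs q hqb hq l hl)
    have h0 : Tendsto (fun ε : ℝ => |ε * yc p|) (𝓝[>] 0) (𝓝[>] 0) := by
      refine tendsto_nhdsWithin_iff.2 ⟨?_, ?_⟩
      · have : Continuous fun ε : ℝ => |ε * yc p| := by fun_prop
        have h := this.tendsto 0
        simp only [zero_mul, abs_zero] at h
        exact h.mono_left nhdsWithin_le_nhds
      · filter_upwards [self_mem_nhdsWithin] with ε hε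
        exact abs_pos.2 (mul_ne_zero (ne_of_gt hε) hp)
    have h1 := hl.comp h0
    have h2 := ((hflim.mul h1).const_mul
      (deriv Real.smoothTransition (yc p ^ 2 - 1) * 2 * |yc p|))
    refine h2.congr' ?_
    filter_upwards [self_mem_nhdsWithin, hlim.eventually_mem (Metric.isOpen_ball.mem_nhds hqb)]
      with ε hε hb
    have h3 := (hu.yc_mul_flux hε hp hb).2
    simp only [Function.comp, thinTerm]
    rw [← hqdef] at h3
    linear_combination (-(deriv Real.smoothTransition (yc p ^ 2 - 1) * 2 *
      f (squeeze n ε p))) * h3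
  · refine ⟨0, le_rfl, fun _ => ?_⟩
    refine tendsto_const_nhds.congr' ?_
    have h4 : ∀ᶠ ε in 𝓝[>] 0, r < ‖squeeze n ε p‖ :=
      (hlim.norm).eventually_const_lt (hr.trans_le h)
    filter_upwards [h4] with ε hε
    simp [thinTerm, hz _ hε.le]

/-- Where the term is nonzero, `y² ≤ 2` and the squeezed point lies in `B_r`. Hence `p` lies in
`B_{r+2}`, and the flux bound on `B_r` applies uniformly in `ε`. -/
theorem IsSolution.exists_bound_thinTerm {a R : ℝ} {u f : Pt n → ℝ} (hu : IsSolution a R u)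
    (hf : Continuous f) {r : ℝ} (h0 : 0 < r) (hr : r < R) (hz : ∀ p, r ≤ ‖p‖ → f p = 0) :
    ∃ C : ℝ, ∀ ε, 0 < ε → ∀ p, ‖thinTerm a u f ε p‖ ≤
      (Metric.ball (0 : Pt n) (r + 2)).indicator (fun _ => C) p := by
  obtain ⟨M, hM⟩ := hu.flux_bounded r h0 hr
  obtain ⟨C, hC0, hC⟩ := exists_bound_deriv_smoothTransition
  have hc : HasCompactSupport f := HasCompactSupport.intro (isCompact_closedBall (0 : Pt n) r)
    fun p hp => hz p (by simpa using (not_le.1 (by simpa using hp)).le)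
  obtain ⟨K, hK⟩ := hc.exists_bound_of_continuous hf
  have hK0 : 0 ≤ K := (norm_nonneg _).trans (hK 0)
  refine ⟨C * 2 * K * (2 * |M|), fun ε hε p => ?_⟩
  have hCK : 0 ≤ C * 2 * K * (2 * |M|) := by positivity
  have hind : 0 ≤ (Metric.ball (0 : Pt n) (r + 2)).indicator
      (fun _ => C * 2 * K * (2 * |M|)) p := indicator_nonneg (fun _ _ => hCK) p
  rcases le_or_gt r ‖squeeze n ε p‖ with h | h
  · simpa [thinTerm, hz _ h] using hind
  rcases lt_or_ge 1 (yc p ^ 2 - 1) with h1 | h1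
  · simpa [thinTerm, deriv_smoothTransition_of_one_lt h1] using hind
  by_cases hp : yc p = 0
  · simpa [thinTerm, hp] using hind
  have hq := yc_sub_smul_ey p
  have hy : |yc p| ≤ 2 := abs_le.2 ⟨by nlinarith, by nlinarith⟩
  have hpb : p ∈ Metric.ball (0 : Pt n) (r + 2) := by
    rw [mem_ball_zero_iff]
    have e1 : ‖p‖ ^ 2 = ‖p - yc p • ey n‖ ^ 2 + yc p ^ 2 := by
      rw [← norm_sq_add_smul_ey hq]; simp
    have e2 : ‖squeeze n ε p‖ ^ 2 = ‖p - yc p • ey n‖ ^ 2 + (ε * yc p) ^ 2 := by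
      rw [squeeze_eq, norm_sq_add_smul_ey hq]
    have e3 := norm_nonneg (squeeze n ε p)
    refine lt_of_pow_lt_pow_left₀ 2 (by linarith) ?_
    nlinarith [sq_nonneg (ε * yc p)]
  rw [indicator_of_mem hpb]
  obtain ⟨hb, he⟩ := (hu.yc_mul_flux hε hp (by rw [mem_ball_zero_iff]; linarith))
  have hb2 : (p - yc p • ey n) + |ε * yc p| • ey n ∈ Metric.ball (0 : Pt n) r := by
    rw [mem_ball_zero_iff]
    refine lt_of_le_of_lt (le_of_eq ?_) h
    rw [← sq_eq_sq₀ (norm_nonneg _) (norm_nonneg _), squeeze_eq, norm_sq_add_smul_ey hq,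
      norm_sq_add_smul_ey hq, sq_abs]
  have hyc : yc ((p - yc p • ey n) + |ε * yc p| • ey n) = |ε * yc p| := by
    rw [yc_add, hq, yc_smul, yc_ey]; ring
  have hM' := hM _ hb2 (by rw [hyc]; exact abs_pos.2 (mul_ne_zero hε.ne' hp))
  rw [hyc] at hM'
  have e : thinTerm a u f ε p = deriv Real.smoothTransition (yc p ^ 2 - 1) * 2 *
      f (squeeze n ε p) * (|yc p| * (|ε * yc p| ^ a *
        Dy u ((p - yc p • ey n) + |ε * yc p| • ey n))) := by
    rw [← he, thinTerm]; ring
  have hKp : |f (squeeze n ε p)| ≤ K := hK _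
  rw [e, Real.norm_eq_abs, abs_mul, abs_mul, abs_mul, abs_mul, abs_abs, abs_two]
  have := hC (yc p ^ 2 - 1)
  have hM2 := hM'.trans (le_abs_self M)
  gcongr

/-- Dominated convergence. Only the sign of the limit is recorded, so no regularity of the limiting
flux along the thin space enters. -/
theorem IsSolution.exists_tendsto_integral_thinTerm {a R : ℝ} {u f : Pt n → ℝ}
    (hu : IsSolution a R u)
    (hf : Continuous f) {r : ℝ} (h0 : 0 < r) (hr : r < R) (hz : ∀ p, r ≤ ‖p‖ → f p = 0)
    (hs : ∀ q ∈ Metric.ball (0 : Pt n) R, yc q = 0 → ∀ l : ℝ,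
      Tendsto (fun y : ℝ => y ^ a * Dy u (q + y • ey n)) (𝓝[>] 0) (𝓝 l) → f q * l ≤ 0) :
    ∃ L ≤ 0, Tendsto (fun ε => ∫ p, thinTerm a u f ε p) (𝓝[>] 0) (𝓝 L) := by
  choose L hL0 hL using hu.tendsto_thinTerm hf hr hz hs
  obtain ⟨C, hC⟩ := hu.exists_bound_thinTerm hf h0 hr hz
  refine ⟨∫ p, L p, integral_nonpos hL0, ?_⟩
  refine tendsto_integral_filter_of_dominated_convergence
    ((Metric.ball (0 : Pt n) (r + 2)).indicator (fun _ => C)) ?_ ?_ ?_ ?_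
  · refine Eventually.of_forall fun ε => Measurable.aestronglyMeasurable ?_
    have hsq : Measurable (squeeze n ε) :=
      (LinearMap.continuous_of_finiteDimensional _).measurable
    have hy : Measurable (yc : Pt n → ℝ) := continuous_yc.measurable
    unfold thinTerm
    refine Measurable.mul (Measurable.mul ((measurable_deriv _).comp ((hy.pow_const 2).sub_const 1))
      (hy.const_mul 2)) ?_
    exact (hf.measurable.comp hsq).mul
      (((measurable_wt a).comp hsq).mul ((measurable_partialD _ u).comp hsq))
  · filter_upwards [self_mem_nhdsWithin] with ε hε
    exact ae_of_all _ (hC ε hε)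
  · exact (integrable_indicator_iff measurableSet_ball).2 (integrableOn_const (by
      exact measure_ball_lt_top.ne))
  · filter_upwards [ae_yc_ne_zero] with p hp using hL p hp

end ThinObstacle

/-! ### The variational inequality with radial cutoff -/

namespace ThinObstacle

variable {n : ℕ}

/-- A smooth cutoff which vanishes for `|y| ≤ ε` and equals one for `|y| ≥ 2 ε`. -/
noncomputable def thinCutoff (ε : ℝ) (p : Pt n) : ℝ :=
  Real.smoothTransition ((yc p / ε) ^ 2 - 1)

theorem contDiff_thinCutoff (ε : ℝ) : ContDiff ℝ 1 (thinCutoff ε : Pt n → ℝ) :=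
  (Real.smoothTransition.contDiff (n := 1)).comp
    (((contDiff_yc.div_const ε).pow 2).sub contDiff_const)

theorem partialD_thinCutoff (ε : ℝ) (p : Pt n) (i : Fin (n + 1)) :
    partialD i (thinCutoff ε) p = if i = Fin.last n then
      ε⁻¹ * (deriv Real.smoothTransition ((yc p / ε) ^ 2 - 1) * (2 * (yc p / ε))) else 0 := by
  have hy : HasFDerivAt (yc : Pt n → ℝ) (EuclideanSpace.proj (𝕜 := ℝ) (Fin.last n)) p :=
    (EuclideanSpace.proj (𝕜 := ℝ) (Fin.last n)).hasFDerivAt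
  have h1 : HasDerivAt (fun z : ℝ => (z / ε) ^ 2 - 1) (2 * (yc p / ε) * ε⁻¹) (yc p) := by
    have := (((hasDerivAt_id (yc p)).div_const ε).pow 2).sub_const 1
    refine this.congr_deriv ?_
    simp
  have h2 : HasDerivAt Real.smoothTransition
      (deriv Real.smoothTransition ((yc p / ε) ^ 2 - 1)) ((yc p / ε) ^ 2 - 1) :=
    ((Real.smoothTransition.contDiff (n := 1)).differentiable one_ne_zero _).hasDerivAt
  have h3 := (HasDerivAt.comp (yc p) h2 h1).comp_hasFDerivAt p hy
  have h4 : partialD i (thinCutoff ε) p = _ := congrArg (fun A => A (basisVec n i)) h3.fderiv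
  rw [h4]
  simp only [basisVec, smul_apply, PiLp.proj_apply]
  by_cases h : i = Fin.last n
  · subst h; simp; ring
  · simp [h, Ne.symm h]

theorem thinCutoff_nonneg (ε : ℝ) (p : Pt n) : 0 ≤ thinCutoff ε p :=
  Real.smoothTransition.nonneg _

theorem thinCutoff_le_one (ε : ℝ) (p : Pt n) : thinCutoff ε p ≤ 1 :=
  Real.smoothTransition.le_one _

theorem tendsto_thinCutoff {p : Pt n} (hp : yc p ≠ 0) :
    Tendsto (fun ε => thinCutoff ε p) (𝓝[>] 0) (𝓝 1) := by
  refine tendsto_const_nhds.congr' ?_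
  have h : Tendsto (fun ε : ℝ => 2 * ε ^ 2) (𝓝[>] 0) (𝓝 0) := by
    have : Continuous fun ε : ℝ => 2 * ε ^ 2 := by fun_prop
    have h := this.tendsto 0
    simp only [ne_eq, OfNat.ofNat_ne_zero, not_false_eq_true, zero_pow, mul_zero] at h
    exact h.mono_left nhdsWithin_le_nhds
  filter_upwards [self_mem_nhdsWithin, h.eventually_lt_const (by positivity : 0 < yc p ^ 2)]
    with ε (hε : 0 < ε) h1
  rw [thinCutoff, Real.smoothTransition.one_of_one_le]
  rw [div_pow, le_sub_iff_add_le, le_div_iff₀ (by positivity)]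
  linarith

theorem tsupport_thinCutoff_subset {ε : ℝ} (hε : 0 < ε) :
    tsupport (thinCutoff ε : Pt n → ℝ) ⊆ {p | ε ≤ |yc p|} := by
  refine closure_minimal ?_ (isClosed_le continuous_const continuous_yc.abs)
  intro p hp
  by_contra h
  rw [mem_ofPred_eq, not_le] at h
  refine hp ?_
  rw [thinCutoff, Real.smoothTransition.zero_of_nonpos]
  rw [sub_nonpos, sq_le_one_iff_abs_le_one, abs_div, abs_of_pos hε, div_le_one hε]
  exact h.le

variable {r : ℝ} {χ ψ : Pt n → ℝ}

theorem RadialCutoff.tsupport_subset (hχ : RadialCutoff r χ ψ) :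
    tsupport χ ⊆ Metric.closedBall 0 r := by
  refine closure_minimal (fun p hp => ?_) Metric.isClosed_closedBall
  by_contra h
  exact hp (hχ.eq_zero p (not_le.1 (by simpa using h)).le)

theorem RadialCutoff.sum_partialD (hχ : RadialCutoff r χ ψ) (u : Pt n → ℝ) (p : Pt n) :
    ∑ i, partialD i χ p * partialD i u p = -(ψ p * Z u p) := by
  rw [Z_eq_sum, Finset.mul_sum, ← Finset.sum_neg_distrib]
  refine Finset.sum_congr rfl fun i _ => ?_
  rw [partialD, hχ.fderiv_eq, basisVec, EuclideanSpace.inner_single_right]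
  simp; ring

/-- The product rule splits the test function into three effects: the bulk term, the radial cutoff,
whose gradient along `p` produces `Zu`, and the thin cutoff, which produces `D_y u` with a factor
`1/ε`. -/
theorem RadialCutoff.gr_mul (hχ : RadialCutoff r χ ψ) (ε : ℝ) (u : Pt n → ℝ)
    {v : Pt n → ℝ} {p : Pt n} (hv : DifferentiableAt ℝ v p) :
    gr (fun q => thinCutoff ε q * (χ q * v q)) u p =
      thinCutoff ε p * (χ p * gr u v p - ψ p * (v p * Z u p)) +
      ε⁻¹ * (deriv Real.smoothTransition ((yc p / ε) ^ 2 - 1) * (2 * (yc p / ε))) *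
        (χ p * v p) * Dy u p := by
  have hd1 : DifferentiableAt ℝ χ p := hχ.contDiff.differentiable one_ne_zero p
  have hd2 : DifferentiableAt ℝ (thinCutoff ε : Pt n → ℝ) p :=
    (contDiff_thinCutoff ε).differentiable one_ne_zero p
  have h1 : ∀ i, partialD i (fun q => thinCutoff ε q * (χ q * v q)) p =
      partialD i (thinCutoff ε) p * (χ p * v p) +
      thinCutoff ε p * (χ p * partialD i v p + v p * partialD i χ p) := by
    intro i
    simp only [partialD]
    have hd3 : DifferentiableAt ℝ (fun q => χ q * v q) p := hd1.mul hv
    rw [fderiv_fun_mul hd2 hd3, fderiv_fun_mul hd1 hv]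
    simp; ring
  have h2 : ∀ i, (partialD i (thinCutoff ε) p * (χ p * v p) +
      thinCutoff ε p * (χ p * partialD i v p + v p * partialD i χ p)) * partialD i u p =
      (partialD i (thinCutoff ε) p * partialD i u p) * (χ p * v p) +
      thinCutoff ε p * χ p * (partialD i u p * partialD i v p) +
      thinCutoff ε p * v p * (partialD i χ p * partialD i u p) := fun i => by ring
  simp only [gr, h1, h2, Finset.sum_add_distrib, ← Finset.mul_sum, ← Finset.sum_mul]
  rw [hχ.sum_partialD]
  simp only [partialD_thinCutoff, ite_mul, zero_mul, Finset.sum_ite_eq', Finset.mem_univ, if_true]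
  unfold Dy
  ring

/-- The test function `thinCutoff ε * χ * v` is supported off the thin space, so the equation gives
zero. Letting `ε → 0`, the layer term has a nonpositive limit and the remaining bulk integral is
therefore nonnegative. -/
theorem IsSolution.integral_cutoff_le {a R : ℝ} (ha : -1 < a) {u v : Pt n → ℝ}
    (hu : IsSolution a R u)
    (hvc : ContinuousOn v (Metric.ball 0 R)) (hvd : ContDiffOn ℝ 1 v (offThin n R))
    (h0 : 0 < r) (hr : r < R)
    (hve : IntegrableOn (fun p => gr v v p * wt a p) (Metric.ball 0 r))
    (hχ : RadialCutoff r χ ψ)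
    (hs : ∀ q ∈ Metric.ball (0 : Pt n) R, yc q = 0 → ∀ l : ℝ,
      Tendsto (fun y : ℝ => y ^ a * Dy u (q + y • ey n)) (𝓝[>] 0) (𝓝 l) → v q * l ≤ 0) :
    ∫ p, ψ p * (v p * Z u p * wt a p) ≤ ∫ p, χ p * (gr u v p * wt a p) := by
  have hue := hu.integrableOn_gr h0 hr
  have hvm : AEStronglyMeasurable v (volume.restrict (Metric.ball 0 r)) :=
    (hvc.mono (Metric.ball_subset_ball hr.le)).aestronglyMeasurable measurableSet_ball
  have i1 : Integrable fun p => χ p * (gr u v p * wt a p) :=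
    integrable_continuous_mul hχ.contDiff.continuous hχ.eq_zero (ThinObstacle.integrableOn_gr hue hve)
  have i2 : Integrable fun p => ψ p * (v p * Z u p * wt a p) :=
    integrable_continuous_mul hχ.continuous_deriv hχ.deriv_eq_zero
      (integrableOn_mul_mul_wt hvm (measurable_Z u).aestronglyMeasurable
        (integrableOn_sq_wt ha hr hvc) (integrableOn_sq_Z hue))
  set f : Pt n → ℝ := fun p => χ p * v p with hf
  have hfc : Continuous f := continuous_mul_of_eq_zero hr hχ.contDiff.continuous hχ.eq_zero hvc
  have hfz : ∀ p, r ≤ ‖p‖ → f p = 0 := fun p hp => by simp [hf, hχ.eq_zero p hp]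
  obtain ⟨L, hL0, hL⟩ := hu.exists_tendsto_integral_thinTerm hfc h0 hr hfz
    (fun q hq hq0 l hl => by
      rw [hf, mul_assoc]
      exact mul_nonpos_of_nonneg_of_nonpos (hχ.nonneg q) (hs q hq hq0 l hl))
  set G : Pt n → ℝ := fun p => χ p * (gr u v p * wt a p) - ψ p * (v p * Z u p * wt a p) with hG
  have hGi : Integrable G := i1.sub i2
  -- The layer integral `ε⁻¹ ∫ T` equals the integral of `thinTerm`: the factor `ε⁻¹` from
  -- differentiating the cutoff is the Jacobian factor of the squeezing.
  have hid : ∀ ε, 0 < ε → ∫ p, thinTerm a u f ε p = -∫ p, thinCutoff ε p * G p := by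
    intro ε hε
    set φ : Pt n → ℝ := fun q => thinCutoff ε q * (χ q * v q) with hφ
    have hsup : tsupport φ ⊆ Metric.closedBall 0 r ∩ {p | ε ≤ |yc p|} := by
      refine subset_inter ?_ ((tsupport_mul_subset_left).trans (tsupport_thinCutoff_subset hε))
      exact (tsupport_mul_subset_right).trans ((tsupport_mul_subset_left).trans hχ.tsupport_subset)
    have hsup2 : tsupport φ ⊆ offThin n R := fun p hp =>
      ⟨Metric.closedBall_subset_ball hr (hsup hp).1, fun h => by
        have := (hsup hp).2
        rw [mem_ofPred_eq, h, abs_zero] at this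
        linarith⟩
    have hφc : HasCompactSupport φ :=
      (isCompact_closedBall (0 : Pt n) r).of_isClosed_subset (isClosed_tsupport _)
        fun p hp => (hsup hp).1
    have hφd : ContDiffOn ℝ 1 φ (offThin n R) :=
      (contDiff_thinCutoff ε).contDiffOn.mul (hχ.contDiff.contDiffOn.mul hvd)
    have hzero := hu.integral_gr_eq_zero hφd hφc hsup2
    set T : Pt n → ℝ := fun p => (deriv Real.smoothTransition ((yc p / ε) ^ 2 - 1) *
      (2 * (yc p / ε))) * (f p * (wt a p * Dy u p)) with hT
    have hae : (fun p => gr φ u p * wt a p) =ᵐ[volume]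
        fun p => thinCutoff ε p * G p + ε⁻¹ * T p := by
      filter_upwards [ae_yc_ne_zero] with p hp
      rcases lt_or_ge ‖p‖ R with h | h
      · have hpo : p ∈ offThin n R := ⟨by simpa using h, hp⟩
        have hvp : DifferentiableAt ℝ v p :=
          (hvd.contDiffAt ((isOpen_offThin R).mem_nhds hpo)).differentiableAt one_ne_zero
        rw [hφ, hχ.gr_mul ε u hvp]
        simp only [hG, hT, hf]
        ring
      · have h1 : p ∉ tsupport φ := fun h2 => by
          have := (hsup h2).1
          rw [mem_closedBall_zero_iff] at this
          linarith
        have h2 : gr φ u p = 0 := by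
          simp [gr, partialD, fderiv_of_notMem_tsupport ℝ h1]
        simp [h2, hG, hT, hf, hχ.eq_zero p (hr.le.trans h), hχ.deriv_eq_zero p (hr.le.trans h)]
    have hθi : Integrable fun p => thinCutoff ε p * G p :=
      hGi.bdd_mul (c := 1) (contDiff_thinCutoff ε).continuous.aestronglyMeasurable
        (ae_of_all _ fun p => by
          rw [Real.norm_of_nonneg (thinCutoff_nonneg _ _)]
          exact thinCutoff_le_one _ _)
    have hsq : ∫ p, thinTerm a u f ε p = ε⁻¹ * ∫ p, T p := by
      rw [← integral_comp_squeeze hε]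
      refine integral_congr_ae (ae_of_all _ fun p => ?_)
      simp only [thinTerm, hT, yc_squeeze, mul_div_cancel_left₀ _ hε.ne']
    -- This function is continuous with compact support. Subtracting the integrable bulk part then
    -- shows that the layer part is integrable, so the integral may be split.
    have hφi : Integrable fun p => gr φ u p * wt a p := by
      have : ∀ p, gr φ u p * wt a p =
        ∑ i, partialD i φ p * (wt a p * partialD i u p) := fun p => by
          rw [gr, Finset.sum_mul]; exact Finset.sum_congr rfl fun i _ => by ring
      simp only [this]
      refine integrable_finsetSum _ fun i _ => ?_
      have hcont : Continuous fun p => partialD i φ p * (wt a p * partialD i u p) := by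
        rw [continuous_iff_continuousAt]
        intro p
        by_cases hp : p ∈ offThin n R
        · have hnh := (isOpen_offThin R).mem_nhds hp
          refine ((contDiffOn_partialD (m := 0) (isOpen_offThin R) hφd
            (by norm_num) i).continuousOn.continuousAt hnh).mul (ContinuousAt.mul ?_ ?_)
          · exact (contDiffAt_wt a hp.2 (k := 0)).continuousAt
          · exact (contDiffOn_partialD (m := 1) (isOpen_offThin R) hu.contDiffOn
              (by norm_num) i).continuousOn.continuousAt hnh
        · have h1 : p ∉ tsupport φ := fun h => hp (hsup2 h)
          have : (fun p => partialD i φ p * (wt a p * partialD i u p)) =ᶠ[𝓝 p] fun _ => 0 := by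
            filter_upwards [(isClosed_tsupport φ).isOpen_compl.mem_nhds h1] with q hq
            simp [partialD, fderiv_of_notMem_tsupport ℝ hq]
          exact continuousAt_const.congr this.symm
      exact hcont.integrable_of_hasCompactSupport (hφc.fderiv_apply (𝕜 := ℝ) _).mul_right
    have hTi : Integrable fun p => ε⁻¹ * T p := by
      refine (hφi.sub hθi).congr ?_
      filter_upwards [hae] with p hp
      simp only [Pi.sub_apply, hp]; ring
    rw [integral_congr_ae hae, integral_add hθi hTi, integral_const_mul, ← hsq] at hzero
    linarith
  have hlim : Tendsto (fun ε => ∫ p, thinCutoff ε p * G p) (𝓝[>] 0) (𝓝 (∫ p, G p)) := by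
    refine tendsto_integral_filter_of_dominated_convergence (fun p => ‖G p‖) ?_ ?_ hGi.norm ?_
    · exact Eventually.of_forall fun ε =>
        (contDiff_thinCutoff ε).continuous.aestronglyMeasurable.mul hGi.aestronglyMeasurable
    · refine Eventually.of_forall fun ε => ae_of_all _ fun p => ?_
      rw [norm_mul, Real.norm_of_nonneg (thinCutoff_nonneg _ _)]
      exact mul_le_of_le_one_left (norm_nonneg _) (thinCutoff_le_one _ _)
    · filter_upwards [ae_yc_ne_zero] with p hp
      simpa using (tendsto_thinCutoff hp).mul_const (G p)
  have hlim2 : Tendsto (fun ε => ∫ p, thinTerm a u f ε p) (𝓝[>] 0) (𝓝 (-∫ p, G p)) := by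
    refine hlim.neg.congr' ?_
    filter_upwards [self_mem_nhdsWithin] with ε hε using (hid ε hε).symm
  have := tendsto_nhds_unique hL hlim2
  have hfin : ∫ p, G p = (∫ p, χ p * (gr u v p * wt a p)) - ∫ p, ψ p * (v p * Z u p * wt a p) :=
    integral_sub i1 i2
  linarith

end ThinObstacle

/-! ### Testing with solutions, and dilation invariance -/

namespace ThinObstacle

variable {n : ℕ} {a R r : ℝ} {u v χ ψ : Pt n → ℝ}

/-- Uniqueness of limits lets any limit of the flux inherit the sign and the complementarity
condition. -/
theorem IsSolution.flux_of_tendsto (hu : IsSolution a R u) {q : Pt n}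
    (hq : q ∈ Metric.ball (0 : Pt n) R) (hq0 : yc q = 0) {l : ℝ}
    (hl : Tendsto (fun y : ℝ => y ^ a * Dy u (q + y • ey n)) (𝓝[>] 0) (𝓝 l)) :
    l ≤ 0 ∧ u q * l = 0 := by
  obtain ⟨l', hl', h1, h2⟩ := hu.flux q hq hq0
  obtain rfl := tendsto_nhds_unique hl hl'
  refine ⟨by linarith, ?_⟩
  rcases (hu.obstacle q hq hq0).eq_or_lt with h | h
  · rw [← h, zero_mul]
  · rw [h2 h, mul_zero]

/-- The variational inequality, tested with another solution. -/
theorem IsSolution.integral_cutoff_le_of_isSolution (ha : -1 < a) (hu : IsSolution a R u)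
    (hv : IsSolution a R v) (h0 : 0 < r) (hr : r < R) (hχ : RadialCutoff r χ ψ) :
    ∫ p, ψ p * (v p * Z u p * wt a p) ≤ ∫ p, χ p * (gr u v p * wt a p) :=
  hu.integral_cutoff_le ha hv.continuousOn (hv.contDiffOn.of_le (by norm_num)) h0 hr
    (hv.integrableOn_gr h0 hr) hχ fun q hq hq0 _ hl =>
      mul_nonpos_of_nonneg_of_nonpos (hv.obstacle q hq hq0) (hu.flux_of_tendsto hq hq0 hl).1

theorem partialD_neg (i : Fin (n + 1)) (u : Pt n → ℝ) (p : Pt n) :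
    partialD i (fun q => - u q) p = - partialD i u p := by
  simp [partialD]

/-- Complementarity `u * l = 0` makes both `u` and `-u` admissible in the variational inequality. -/
theorem IsSolution.integral_cutoff_eq (ha : -1 < a) (hu : IsSolution a R u)
    (h0 : 0 < r) (hr : r < R) (hχ : RadialCutoff r χ ψ) :
    ∫ p, ψ p * (u p * Z u p * wt a p) = ∫ p, χ p * (gr u u p * wt a p) := by
  refine le_antisymm (hu.integral_cutoff_le_of_isSolution ha hu h0 hr hχ) ?_
  have h1 : ∀ p, gr (fun q => - u q) (fun q => - u q) p = gr u u p := by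
    simp [gr, partialD_neg]
  have h2 : ∀ p, gr u (fun q => - u q) p = - gr u u p := by
    simp [gr, partialD_neg]
  have := hu.integral_cutoff_le ha (v := fun q => - u q) hu.continuousOn.neg
    (hu.contDiffOn.of_le (by norm_num)).neg h0 hr
    (by simpa only [h1] using hu.integrableOn_gr h0 hr) hχ fun q hq hq0 l hl => by
      rw [neg_mul, (hu.flux_of_tendsto hq hq0 hl).2, neg_zero]
  simp only [h2, neg_mul, mul_neg, integral_neg] at this
  linarith

theorem smul_mem_ball {t R' : ℝ} (ht : 0 < t) (hR : t * R' ≤ R) {p : Pt n}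
    (hp : p ∈ Metric.ball (0 : Pt n) R') : t • p ∈ Metric.ball (0 : Pt n) R := by
  rw [mem_ball_zero_iff] at hp ⊢
  rw [norm_smul, Real.norm_of_nonneg ht.le]
  exact (mul_lt_mul_of_pos_left hp ht).trans_le hR

theorem smul_mem_offThin {t R' : ℝ} (ht : 0 < t) (hR : t * R' ≤ R) {p : Pt n}
    (hp : p ∈ offThin n R') : t • p ∈ offThin n R :=
  ⟨smul_mem_ball ht hR hp.1, by
    change yc (t • p) ≠ 0
    rw [yc_smul]; exact mul_ne_zero ht.ne' hp.2⟩

theorem integrableOn_comp_smul {t R' : ℝ} (ht : 0 < t) (hR : t * R' ≤ R) {f : Pt n → ℝ}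
    (hf : IntegrableOn f (Metric.ball 0 R)) :
    IntegrableOn (fun p => f (t • p)) (Metric.ball 0 R') := by
  have h1 := ((integrable_indicator_iff measurableSet_ball).2 hf).comp_smul ht.ne'
  refine (h1.integrableOn (s := Metric.ball 0 R')).congr_fun (fun p hp => ?_) measurableSet_ball
  exact indicator_of_mem (smul_mem_ball ht hR hp) f

/-- Dilations preserve solutions. -/
theorem IsSolution.comp_smul (hu : IsSolution a R u) {t R' : ℝ} (ht : 0 < t) (hR : t * R' ≤ R) :
    IsSolution a R' (fun p => u (t • p)) := by
  have hd : ContDiff ℝ 2 fun p : Pt n => t • p := contDiff_id.const_smul t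
  have hm : MapsTo (fun p : Pt n => t • p) (Metric.ball 0 R') (Metric.ball 0 R) :=
    fun p hp => smul_mem_ball ht hR hp
  have hlt : ∀ r : ℝ, r < R' → t * r < R := fun r hr =>
    (mul_lt_mul_of_pos_left hr ht).trans_le hR
  refine ⟨hu.continuousOn.comp hd.continuous.continuousOn hm,
    hu.contDiffOn.comp hd.contDiffOn fun p hp => smul_mem_offThin ht hR hp,
    fun r h0 hr => ?_, fun r h0 hr => ?_, fun p hp hp0 => ?_, fun p hp hp0 => ?_,
    fun p hp => ?_, fun p hp hp0 => ?_⟩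
  · have h1 := integrableOn_comp_smul ht le_rfl
      (hu.finite_energy (t * r) (mul_pos ht h0) (hlt r hr))
    -- The factor `t²` comes from the two gradients, and `t^(-a)` turns the dilated weight back into
    -- `|y|^a`.
    refine IntegrableOn.congr_fun (h1.const_mul (t ^ 2 * t ^ (-a))) (fun p _ => ?_)
      measurableSet_ball
    have h2 := wt_smul a ht p
    have h3 : t ^ (-a) * t ^ a = 1 := by rw [← Real.rpow_add ht]; simp
    unfold wt at h2
    simp only [norm_gradient_sq, gr_comp_smul, h2]
    linear_combination t ^ 2 * gr u u (t • p) * |yc p| ^ a * h3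
  · obtain ⟨M, hM⟩ := hu.flux_bounded (t * r) (mul_pos ht h0) (hlt r hr)
    refine ⟨t * t ^ (-a) * M, fun p hp hp0 => ?_⟩
    have h1 := hM (t • p) (smul_mem_ball ht le_rfl hp) (by rw [yc_smul]; exact mul_pos ht hp0)
    have h3 : t ^ (-a) * t ^ a = 1 := by rw [← Real.rpow_add ht]; simp
    have h4 : yc p ^ a * Dy (fun p => u (t • p)) p =
        t * t ^ (-a) * (yc (t • p) ^ a * Dy u (t • p)) := by
      rw [Dy, partialD_comp_smul, yc_smul, Real.mul_rpow ht.le hp0.le, Dy]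
      linear_combination -(t * yc p ^ a * partialD (Fin.last n) u (t • p)) * h3
    rw [h4, abs_mul, abs_of_pos (by positivity)]
    gcongr
  · have h1 := hu.equation (t • p) (smul_mem_ball ht hR hp)
      (by rw [yc_smul]; exact mul_ne_zero ht.ne' hp0)
    have h2 : ∀ i, (fun q => |yc q| ^ a * partialD i (fun p => u (t • p)) q) =
        fun q => (t * t ^ (-a)) • (fun q => |yc q| ^ a * partialD i u q) (t • q) := by
      intro i
      funext q
      have h3 : t ^ (-a) * t ^ a = 1 := by rw [← Real.rpow_add ht]; simp
      have h4 := wt_smul a ht q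
      unfold wt at h4
      simp only [partialD_comp_smul, smul_eq_mul, h4]
      linear_combination -(t * |yc q| ^ a * partialD i u (t • q)) * h3
    unfold La at h1 ⊢
    have h5 : ∀ i, partialD i (fun q => |yc q| ^ a * partialD i (fun p => u (t • p)) q) p =
        (t * t ^ (-a) * t) * partialD i (fun q => |yc q| ^ a * partialD i u q) (t • p) := by
      intro i
      rw [h2 i, mul_assoc, ← partialD_comp_smul]
      simp only [partialD]
      exact congrArg (fun A : Pt n → Pt n →L[ℝ] ℝ => A p (basisVec n i))
        (fderiv_const_smul_field (𝕜 := ℝ) (f := fun q : Pt n => |yc (t • q)| ^ a * fderiv ℝ u (t • q) (basisVec n i))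
          (t * t ^ (-a)))
    simp only [h5, ← Finset.mul_sum, h1, mul_zero]
  · exact hu.obstacle _ (smul_mem_ball ht hR hp) (by rw [yc_smul, hp0, mul_zero])
  · have h1 := hu.even _ (smul_mem_ball ht hR hp)
    rw [← h1, reflectY, reflectY, yc_smul]
    congr 1
    module
  · obtain ⟨l, hl, h1, h2⟩ := hu.flux (t • p) (smul_mem_ball ht hR hp)
      (by rw [yc_smul, hp0, mul_zero])
    have h0 : Tendsto (fun y : ℝ => t * y) (𝓝[>] 0) (𝓝[>] 0) := by
      refine tendsto_nhdsWithin_iff.2 ⟨?_, ?_⟩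
      · have : Continuous fun y : ℝ => t * y := by fun_prop
        have h := this.tendsto 0
        simp only [mul_zero] at h
        exact h.mono_left nhdsWithin_le_nhds
      · filter_upwards [self_mem_nhdsWithin] with y hy using mul_pos ht hy
    refine ⟨t * t ^ (-a) * l, ((hl.comp h0).const_mul (t * t ^ (-a))).congr' ?_, ?_, ?_⟩
    · filter_upwards [self_mem_nhdsWithin] with y (hy : 0 < y)
      have h3 : t ^ (-a) * t ^ a = 1 := by rw [← Real.rpow_add ht]; simp
      have h4 : t • (p + y • ey n) = t • p + (t * y) • ey n := by module
      simp only [Function.comp]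
      rw [Dy, Dy, partialD_comp_smul, h4, Real.mul_rpow ht.le hy.le]
      linear_combination (t * y ^ a * partialD (Fin.last n) u (t • p + (t * y) • ey n)) * h3
    · have : 0 ≤ t * t ^ (-a) := by positivity
      nlinarith
    · intro h; rw [h2 h, mul_zero]

end ThinObstacle

/-! ### Estimates along dilation orbits -/

namespace ThinObstacle

variable {n : ℕ} {a R r : ℝ}

/-- In the logarithmic parameter the dilations form a one-parameter group generated by `Z`, so no
factor of the radius appears. The orbit of a point off the thin space never meets it. -/
theorem hasDerivAt_comp_exp_smul {F : Pt n → ℝ} (hF : ContDiffOn ℝ 1 F (offThin n R)) {p : Pt n}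
    {τ : ℝ} (h : Real.exp τ • p ∈ offThin n R) :
    HasDerivAt (fun τ => F (Real.exp τ • p)) (Z F (Real.exp τ • p)) τ := by
  have h1 : HasFDerivAt F (fderiv ℝ F (Real.exp τ • p)) (Real.exp τ • p) :=
    ((hF.contDiffAt ((isOpen_offThin R).mem_nhds h)).differentiableAt one_ne_zero).hasFDerivAt
  exact h1.comp_hasDerivAt τ ((Real.hasDerivAt_exp τ).smul_const p)

/-- Cauchy-Schwarz, read off from the nonnegative integral of `((β - α) f - m)²` with `m` the
integral of `f`. -/
theorem sq_integral_le {f : ℝ → ℝ} {α β : ℝ} (h : α ≤ β) (hf : ContinuousOn f (Icc α β)) :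
    (∫ x in α..β, f x) ^ 2 ≤ (β - α) * ∫ x in α..β, f x ^ 2 := by
  rcases h.eq_or_lt with rfl | h'
  · simp
  have hi : IntervalIntegrable f volume α β := by
    apply ContinuousOn.intervalIntegrable; rwa [uIcc_of_le h]
  have hi2 : IntervalIntegrable (fun x => f x ^ 2) volume α β := by
    apply ContinuousOn.intervalIntegrable; rw [uIcc_of_le h]; exact hf.pow 2
  set m := ∫ x in α..β, f x with hm
  have h1 : 0 ≤ ∫ x in α..β, ((β - α) * f x - m) ^ 2 :=
    intervalIntegral.integral_nonneg h fun x _ => sq_nonneg _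
  have h2 : ∀ x, ((β - α) * f x - m) ^ 2 =
      (β - α) ^ 2 * f x ^ 2 - 2 * (β - α) * m * f x + m ^ 2 := fun x => by ring
  simp only [h2] at h1
  rw [intervalIntegral.integral_add ((hi2.const_mul _).sub (hi.const_mul _)) (by simp),
    intervalIntegral.integral_sub (hi2.const_mul _) (hi.const_mul _),
    intervalIntegral.integral_const_mul, intervalIntegral.integral_const_mul, ← hm,
    intervalIntegral.integral_const, smul_eq_mul] at h1
  have h3 : 0 < β - α := sub_pos.2 h'
  have h4 : 0 ≤ (β - α) * ((β - α) * (∫ x in α..β, f x ^ 2) - m ^ 2) := by nlinarith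
  have := nonneg_of_mul_nonneg_right h4 h3
  linarith

theorem exp_smul_mem_offThin {R' s₀ τ : ℝ} (hR : Real.exp s₀ * R' ≤ R) (h : τ ≤ s₀)
    {p : Pt n} (hp : p ∈ offThin n R') : Real.exp τ • p ∈ offThin n R := by
  refine smul_mem_offThin (Real.exp_pos τ) (le_trans ?_ hR) hp
  have : 0 ≤ R' := (norm_nonneg p).trans (mem_ball_zero_iff.1 hp.1).le
  exact mul_le_mul_of_nonneg_right (Real.exp_le_exp.2 h) this

/-- The integral of `g` along the dilation orbit of `p`. -/
noncomputable def orbitIntegral (g : Pt n → ℝ) (s : ℝ) (p : Pt n) : ℝ :=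
  ∫ τ in (-s)..s, g (Real.exp τ • p)

/-- Fundamental theorem of calculus along the orbit and Cauchy-Schwarz. Integrating over all of
`[-s₀, s₀]` on the right gives one majorant for every `|s| ≤ s₀`, as dominated differentiation
requires. -/
theorem sq_sub_le_orbitIntegral {F : Pt n → ℝ} (hF : ContDiffOn ℝ 1 F (offThin n R))
    {R' s₀ s : ℝ} (hR : Real.exp s₀ * R' ≤ R) (hs : |s| ≤ s₀) {p : Pt n}
    (hp : p ∈ offThin n R') :
    (F (Real.exp s • p) - F p) ^ 2 ≤ |s| * orbitIntegral (fun q => Z F q ^ 2) s₀ p := by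
  have hs' := abs_le.1 hs
  have hmem : ∀ τ ∈ Icc (-s₀) s₀, Real.exp τ • p ∈ offThin n R :=
    fun τ hτ => exp_smul_mem_offThin hR hτ.2 hp
  have hZc : ContinuousOn (fun τ => Z F (Real.exp τ • p)) (Icc (-s₀) s₀) := by
    refine ContinuousOn.comp (t := offThin n R)
      (contDiffOn_Z (m := 0) (isOpen_offThin R) hF (by norm_num)).continuousOn ?_ hmem
    fun_prop
  have hs0 : 0 ≤ s₀ := (abs_nonneg s).trans hs
  have key : ∀ α β, α ≤ β → -s₀ ≤ α → β ≤ s₀ →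
      (F (Real.exp β • p) - F (Real.exp α • p)) ^ 2 ≤
        (β - α) * orbitIntegral (fun q => Z F q ^ 2) s₀ p := by
    intro α β hαβ hα hβ
    have hsub : Icc α β ⊆ Icc (-s₀) s₀ := Icc_subset_Icc hα hβ
    have h1 : ∫ τ in α..β, Z F (Real.exp τ • p) =
        F (Real.exp β • p) - F (Real.exp α • p) := by
      refine intervalIntegral.integral_eq_sub_of_hasDerivAt (f := fun τ => F (Real.exp τ • p))
        (fun τ hτ => ?_) ?_
      · rw [uIcc_of_le hαβ] at hτ
        exact hasDerivAt_comp_exp_smul hF (hmem τ (hsub hτ))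
      · apply ContinuousOn.intervalIntegrable
        rw [uIcc_of_le hαβ]; exact hZc.mono hsub
    rw [← h1]
    refine (sq_integral_le hαβ (hZc.mono hsub)).trans ?_
    refine mul_le_mul_of_nonneg_left ?_ (sub_nonneg.2 hαβ)
    refine intervalIntegral.integral_mono_interval hα hαβ hβ
      (ae_of_all _ fun τ => sq_nonneg _) ?_
    apply ContinuousOn.intervalIntegrable
    rw [uIcc_of_le (by linarith)]
    exact hZc.pow 2
  rcases le_total 0 s with h | h
  · have := key 0 s h (by linarith) hs'.2
    simpa [abs_of_nonneg h] using this
  · have := key s 0 h hs'.1 hs0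
    rw [sub_sq_comm] at this
    simpa [abs_of_nonpos h] using this

/-- The Jacobian gives `t^(-(n+1))` and the weight `t^(-a)`, so `Q` plays the role of the dimension.
-/
theorem setIntegral_ball_comp_smul {t : ℝ} (ht : 0 < t) (R' : ℝ) (g : Pt n → ℝ) :
    ∫ p in Metric.ball (0 : Pt n) R', g (t • p) * wt a p =
      t ^ (-Q n a) * ∫ p in Metric.ball (0 : Pt n) (t * R'), g p * wt a p := by
  have h1 := Measure.setIntegral_comp_smul_of_pos (volume : Measure (Pt n))
    (fun p => g p * wt a p) (Metric.ball 0 R') ht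
  rw [smul_ball ht.ne', smul_zero, Real.norm_of_nonneg ht.le] at h1
  simp only [wt_smul a ht] at h1
  have h2 : ∀ p : Pt n, g (t • p) * wt a p = t ^ (-a) * (g (t • p) * (t ^ a * wt a p)) := by
    intro p
    have h3 : t ^ (-a) * t ^ a = 1 := by rw [← Real.rpow_add ht]; simp
    linear_combination -(g (t • p) * wt a p) * h3
  simp only [h2, integral_const_mul, h1, smul_eq_mul]
  rw [← mul_assoc]
  congr 1
  rw [← Real.rpow_natCast, ← Real.rpow_neg ht.le, ← Real.rpow_add ht, finrank_euclideanSpace,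
    Fintype.card_fin, Q]
  congr 1
  push_cast; ring

/-- Fubini. For `τ ≥ -s₀` the dilate of `g` has weighted integral at most `e^(s₀ Q)` times that of
`g`, as `Q ≥ 0`, and `τ` runs over an interval of length `2 s₀`. -/
theorem integrableOn_orbitIntegral {g : Pt n → ℝ} (hg : Measurable g) (hg0 : ∀ p, 0 ≤ g p)
    (ha : -1 < a)
    (hgi : IntegrableOn (fun p => g p * wt a p) (Metric.ball 0 R)) {R' s₀ : ℝ}
    (hR : Real.exp s₀ * R' ≤ R) (hs : 0 ≤ s₀) (hR' : 0 ≤ R') :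
    IntegrableOn (fun p => orbitIntegral g s₀ p * wt a p) (Metric.ball 0 R') ∧
    ∫ p in Metric.ball (0 : Pt n) R', orbitIntegral g s₀ p * wt a p ≤
      2 * s₀ * Real.exp (s₀ * Q n a) * ∫ p in Metric.ball (0 : Pt n) R, g p * wt a p := by
  set I := ∫ p in Metric.ball (0 : Pt n) R, g p * wt a p with hI
  have hQ : 0 ≤ Q n a := by unfold Q; have : (0 : ℝ) ≤ n := n.cast_nonneg; linarith
  let Φ : ℝ × Pt n → ℝ := fun z => g (Real.exp z.1 • z.2) * wt a z.2
  have hΦ : Measurable Φ := by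
    refine Measurable.mul (hg.comp ?_) ((measurable_wt a).comp measurable_snd)
    exact (by fun_prop : Continuous fun z : ℝ × Pt n => Real.exp z.1 • z.2).measurable
  have hle : ∀ τ ≤ s₀, Real.exp τ * R' ≤ R := fun τ hτ =>
    (mul_le_mul_of_nonneg_right (Real.exp_le_exp.2 hτ) hR').trans hR
  have h1 : ∀ τ ∈ Ioc (-s₀) s₀, IntegrableOn (fun p => Φ (τ, p)) (Metric.ball 0 R') := by
    intro τ hτ
    have h2 := integrableOn_comp_smul (Real.exp_pos τ) (hle τ hτ.2) hgi
    refine (h2.const_mul (Real.exp τ ^ (-a))).congr (ae_of_all _ fun p => ?_)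
    have h3 : Real.exp τ ^ (-a) * Real.exp τ ^ a = 1 := by
      rw [← Real.rpow_add (Real.exp_pos τ)]; simp
    simp only [Φ, wt_smul a (Real.exp_pos τ)]
    linear_combination g (Real.exp τ • p) * wt a p * h3
  have h2 : ∀ τ ∈ Ioc (-s₀) s₀, ∫ p in Metric.ball 0 R', Φ (τ, p) ≤
      Real.exp (s₀ * Q n a) * I := by
    intro τ hτ
    simp only [Φ]
    rw [setIntegral_ball_comp_smul (Real.exp_pos τ)]
    refine mul_le_mul ?_ ?_ (integral_nonneg fun p => mul_nonneg (hg0 p) (wt_nonneg a p))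
      (Real.exp_pos _).le
    · rw [← Real.exp_mul, Real.exp_le_exp]
      nlinarith [hτ.1]
    · exact setIntegral_mono_set hgi (ae_of_all _ fun p => mul_nonneg (hg0 p) (wt_nonneg a p))
        (Metric.ball_subset_ball (hle τ hτ.2)).eventuallyLE
  have h0 : ∀ z, 0 ≤ Φ z := fun z => mul_nonneg (hg0 _) (wt_nonneg a _)
  have h3 : Integrable Φ ((volume.restrict (Ioc (-s₀) s₀)).prod
      (volume.restrict (Metric.ball 0 R'))) := by
    rw [integrable_prod_iff hΦ.aestronglyMeasurable]
    refine ⟨?_, ?_⟩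
    · filter_upwards [ae_restrict_mem measurableSet_Ioc] with τ hτ using h1 τ hτ
    · refine Integrable.mono' (g := fun _ => Real.exp (s₀ * Q n a) * I)
        (integrable_const _) hΦ.aestronglyMeasurable.norm.integral_prod_right' ?_
      filter_upwards [ae_restrict_mem measurableSet_Ioc] with τ hτ
      rw [Real.norm_of_nonneg (integral_nonneg fun _ => norm_nonneg _)]
      simp only [Real.norm_of_nonneg (h0 _)]
      exact h2 τ hτ
  have h4 : ∀ p, orbitIntegral g s₀ p * wt a p = ∫ τ in Ioc (-s₀) s₀, Φ (τ, p) := by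
    intro p
    simp only [Φ]
    rw [integral_mul_const, orbitIntegral, intervalIntegral.integral_of_le (by linarith)]
  simp only [h4]
  refine ⟨h3.integral_prod_right, ?_⟩
  rw [integral_integral_swap (f := fun p τ => Φ (τ, p)) h3.swap]
  refine (setIntegral_mono_on h3.integral_prod_left
    (integrableOn_const (by simp) : IntegrableOn (fun _ => Real.exp (s₀ * Q n a) * I) _ _)
    measurableSet_Ioc h2).trans (le_of_eq ?_)
  rw [setIntegral_const, smul_eq_mul, Real.volume_real_Ioc_of_le (by linarith)]
  ring

end ThinObstacle

/-! ### Radial cutoffs and the Caccioppoli inequality for differences -/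

namespace ThinObstacle

variable {n : ℕ} {a R r : ℝ} {u v χ ψ : Pt n → ℝ}

theorem radialCutoff_of_contDiff (hr : 0 ≤ r) {g : ℝ → ℝ} (hg : ContDiff ℝ 1 g)
    (hg0 : ∀ s, 0 ≤ g s) (hz : ∀ s, r ^ 2 ≤ s → g s = 0) :
    RadialCutoff r (fun p : Pt n => g (‖p‖ ^ 2)) (fun p => -2 * deriv g (‖p‖ ^ 2)) where
  contDiff := hg.comp (contDiff_norm_sq ℝ)
  continuous_deriv := continuous_const.mul
    ((hg.continuous_deriv le_rfl).comp (by fun_prop))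
  eq_zero p hp := hz _ (pow_le_pow_left₀ hr hp 2)
  deriv_eq_zero p hp := by
    -- At radius `r` or beyond, `g` attains its minimum `0`, so its derivative vanishes even on the
    -- boundary sphere.
    have h : IsLocalMin g (‖p‖ ^ 2) := Eventually.of_forall fun s => by
      rw [hz _ (pow_le_pow_left₀ hr hp 2)]; exact hg0 s
    rw [h.deriv_eq_zero, mul_zero]
  fderiv_eq p h := by
    have h1 : HasFDerivAt (fun p : Pt n => ‖p‖ ^ 2) (2 • (innerSL ℝ p)) p :=
      (hasStrictFDerivAt_norm_sq p).hasFDerivAt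
    have h2 := ((hg.differentiable one_ne_zero (‖p‖ ^ 2)).hasDerivAt).comp_hasFDerivAt p h1
    have h3 := congrArg (fun A => A h) h2.fderiv
    refine h3.trans ?_
    simp
    ring
  nonneg p := hg0 _

theorem RadialCutoff.sq (hχ : RadialCutoff r χ ψ) :
    RadialCutoff r (fun p => χ p ^ 2) (fun p => 2 * χ p * ψ p) where
  contDiff := hχ.contDiff.pow 2
  continuous_deriv := (continuous_const.mul hχ.contDiff.continuous).mul hχ.continuous_deriv
  eq_zero p hp := by rw [hχ.eq_zero p hp]; ring
  deriv_eq_zero p hp := by rw [hχ.eq_zero p hp]; ring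
  fderiv_eq p h := by
    have h1 := (hχ.contDiff.differentiable one_ne_zero p).hasFDerivAt.pow 2
    have h2 := congrArg (fun A => A h) h1.fderiv
    refine h2.trans ?_
    simp [hχ.fderiv_eq]
    ring
  nonneg p := sq_nonneg _

theorem exists_radialCutoff {r r₁ : ℝ} (hr : 0 < r) (hr₁ : r < r₁) :
    ∃ η φ : Pt n → ℝ, RadialCutoff r₁ η φ ∧ ∀ p, ‖p‖ ≤ r → η p = 1 := by
  have h0 : 0 < r₁ ^ 2 - r ^ 2 := by nlinarith
  refine ⟨_, _, radialCutoff_of_contDiff (n := n) (r := r₁) (by linarith)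
    (g := fun s => Real.smoothTransition ((r₁ ^ 2 - s) / (r₁ ^ 2 - r ^ 2)))
    ((Real.smoothTransition.contDiff (n := 1)).comp
      ((contDiff_const.sub contDiff_id).div_const _))
    (fun s => Real.smoothTransition.nonneg _) (fun s hs => ?_), fun p hp => ?_⟩
  · exact Real.smoothTransition.zero_of_nonpos
      (div_nonpos_of_nonpos_of_nonneg (by linarith) h0.le)
  · refine Real.smoothTransition.one_of_one_le ?_
    rw [one_le_div h0]
    nlinarith [norm_nonneg p]

/-- Cauchy-Schwarz: the bracket is `|∇v - ∇u|²`, written with products that occur in the variational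
inequality. -/
theorem sq_Z_sub_le (u v : Pt n → ℝ) (p : Pt n) :
    (Z v p - Z u p) ^ 2 ≤ ‖p‖ ^ 2 * (gr v v p - 2 * gr u v p + gr u u p) := by
  have h1 : Z v p - Z u p = ∑ i, p i * (partialD i v p - partialD i u p) := by
    rw [Z_eq_sum, Z_eq_sum, ← Finset.sum_sub_distrib]
    exact Finset.sum_congr rfl fun i _ => by ring
  have h2 : gr v v p - 2 * gr u v p + gr u u p = ∑ i, (partialD i v p - partialD i u p) ^ 2 := by
    simp only [gr, Finset.mul_sum]
    rw [← Finset.sum_sub_distrib, ← Finset.sum_add_distrib]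
    exact Finset.sum_congr rfl fun i _ => by ring
  rw [h1, h2, EuclideanSpace.real_norm_sq_eq]
  exact Finset.sum_mul_sq_le_sq_mul_sq _ _ _

theorem IsSolution.aestronglyMeasurable (hu : IsSolution a R u) (hr : r ≤ R) :
    AEStronglyMeasurable u (volume.restrict (Metric.ball 0 r)) :=
  (hu.continuousOn.mono (Metric.ball_subset_ball hr)).aestronglyMeasurable measurableSet_ball

theorem IsSolution.integrable_cutoff_mul_Z (ha : -1 < a) (hu : IsSolution a R u)
    (hv : IsSolution a R v) (h0 : 0 < r) (hr : r < R) (hχ : RadialCutoff r χ ψ) :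
    Integrable fun p => ψ p * (v p * Z u p * wt a p) :=
  integrable_continuous_mul hχ.continuous_deriv hχ.deriv_eq_zero
    (integrableOn_mul_mul_wt (hv.aestronglyMeasurable hr.le) (measurable_Z u).aestronglyMeasurable
      (integrableOn_sq_wt ha hr hv.continuousOn) (integrableOn_sq_Z (hu.integrableOn_gr h0 hr)))

theorem IsSolution.integrable_cutoff_mul_gr (hu : IsSolution a R u)
    (hv : IsSolution a R v) (h0 : 0 < r) (hr : r < R) (hχ : RadialCutoff r χ ψ) :
    Integrable fun p => χ p * (gr u v p * wt a p) :=
  integrable_continuous_mul hχ.contDiff.continuous hχ.eq_zero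
    (ThinObstacle.integrableOn_gr (hu.integrableOn_gr h0 hr) (hv.integrableOn_gr h0 hr))

/-- The energy inequality for the difference of two solutions. -/
theorem IsSolution.integral_cutoff_sub_le (ha : -1 < a) (hu : IsSolution a R u)
    (hv : IsSolution a R v) (h0 : 0 < r) (hr : r < R) (hχ : RadialCutoff r χ ψ) :
    Integrable (fun p => χ p * ((gr v v p - 2 * gr u v p + gr u u p) * wt a p)) ∧
    Integrable (fun p => ψ p * ((v p - u p) * (Z v p - Z u p) * wt a p)) ∧
    ∫ p, χ p * ((gr v v p - 2 * gr u v p + gr u u p) * wt a p) ≤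
      ∫ p, ψ p * ((v p - u p) * (Z v p - Z u p) * wt a p) := by
  have e1 : (fun p => χ p * ((gr v v p - 2 * gr u v p + gr u u p) * wt a p)) =
      fun p => χ p * (gr v v p * wt a p) - χ p * (gr u v p * wt a p) -
        χ p * (gr v u p * wt a p) + χ p * (gr u u p * wt a p) := by
    funext p; rw [gr_comm v u]; ring
  have e2 : (fun p => ψ p * ((v p - u p) * (Z v p - Z u p) * wt a p)) =
      fun p => ψ p * (v p * Z v p * wt a p) - ψ p * (v p * Z u p * wt a p) -
        ψ p * (u p * Z v p * wt a p) + ψ p * (u p * Z u p * wt a p) := by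
    funext p; ring
  have g1 := hv.integrable_cutoff_mul_gr hv h0 hr hχ
  have g2 := hu.integrable_cutoff_mul_gr hv h0 hr hχ
  have g3 := hv.integrable_cutoff_mul_gr hu h0 hr hχ
  have g4 := hu.integrable_cutoff_mul_gr hu h0 hr hχ
  have z1 := hv.integrable_cutoff_mul_Z ha hv h0 hr hχ
  have z2 := hu.integrable_cutoff_mul_Z ha hv h0 hr hχ
  have z3 := hv.integrable_cutoff_mul_Z ha hu h0 hr hχ
  have z4 := hu.integrable_cutoff_mul_Z ha hu h0 hr hχ
  rw [e1, e2]
  refine ⟨((g1.sub g2).sub g3).add g4, ((z1.sub z2).sub z3).add z4, ?_⟩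
  have h4 : ∀ {f₁ f₂ f₃ f₄ : Pt n → ℝ}, Integrable f₁ → Integrable f₂ → Integrable f₃ →
      Integrable f₄ → ∫ p, (f₁ p - f₂ p - f₃ p + f₄ p) =
        (∫ p, f₁ p) - (∫ p, f₂ p) - (∫ p, f₃ p) + ∫ p, f₄ p := by
    intro f₁ f₂ f₃ f₄ h₁ h₂ h₃ h₄
    have e := integral_add' ((h₁.sub h₂).sub h₃) h₄
    rw [integral_sub' (h₁.sub h₂) h₃, integral_sub' h₁ h₂] at e
    exact e
  rw [h4 g1 g2 g3 g4, h4 z1 z2 z3 z4]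
  -- The diagonal terms are equalities. The two mixed terms enter with a minus sign, so their
  -- inequalities point the right way.
  have := hu.integral_cutoff_eq ha h0 hr hχ
  have := hv.integral_cutoff_eq ha h0 hr hχ
  have := hu.integral_cutoff_le_of_isSolution ha hv h0 hr hχ
  have := hv.integral_cutoff_le_of_isSolution ha hu h0 hr hχ
  linarith

/-- A Caccioppoli inequality for the difference of two solutions. -/
theorem IsSolution.exists_caccioppoli (n : ℕ) (ha : -1 < a) {r r₁ R : ℝ} (h0 : 0 < r)
    (h1 : r < r₁) (hR : r₁ < R) : ∃ C, 0 ≤ C ∧ ∀ u v : Pt n → ℝ, IsSolution a R u →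
      IsSolution a R v →
      IntegrableOn (fun p => (Z v p - Z u p) ^ 2 * wt a p) (Metric.ball 0 r) ∧
      ∫ p in Metric.ball (0 : Pt n) r, (Z v p - Z u p) ^ 2 * wt a p ≤
        C * ∫ p in Metric.ball (0 : Pt n) r₁, (v p - u p) ^ 2 * wt a p := by
  obtain ⟨η, φ, hη, hη1⟩ := exists_radialCutoff (n := n) h0 h1
  have hφc : HasCompactSupport φ := HasCompactSupport.intro (isCompact_closedBall (0 : Pt n) r₁)
    fun p hp => hη.deriv_eq_zero p (by simpa using (not_le.1 (by simpa using hp)).le)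
  obtain ⟨K, hK⟩ := hφc.exists_bound_of_continuous hη.continuous_deriv
  have h01 : 0 < r₁ := h0.trans h1
  refine ⟨r₁ ^ 2 * (4 * K ^ 2 * r₁ ^ 2), by positivity, fun u v hu hv => ?_⟩
  set e : Pt n → ℝ := fun p => gr v v p - 2 * gr u v p + gr u u p with he
  have hZe : ∀ p, (Z v p - Z u p) ^ 2 ≤ ‖p‖ ^ 2 * e p := sq_Z_sub_le u v
  have he0 : ∀ p, 0 ≤ e p := by
    intro p
    have : e p = ∑ i, (partialD i v p - partialD i u p) ^ 2 := by
      simp only [he, gr, Finset.mul_sum]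
      rw [← Finset.sum_sub_distrib, ← Finset.sum_add_distrib]
      exact Finset.sum_congr rfl fun i _ => by ring
    rw [this]; exact Finset.sum_nonneg fun i _ => sq_nonneg _
  obtain ⟨i1, i2, hle⟩ := hu.integral_cutoff_sub_le ha hv h01 hR hη.sq
  have i3 : IntegrableOn (fun p => (v p - u p) ^ 2 * wt a p) (Metric.ball 0 r₁) :=
    integrableOn_sq_wt ha hR (hv.continuousOn.sub hu.continuousOn)
  have i4 : Integrable (fun p => (Metric.ball (0 : Pt n) r₁).indicator
      (fun p => 2 * K ^ 2 * r₁ ^ 2 * ((v p - u p) ^ 2 * wt a p)) p) :=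
    (integrable_indicator_iff measurableSet_ball).2 (i3.const_mul _)
  have hpt : ∀ p, 2 * η p * φ p * ((v p - u p) * (Z v p - Z u p) * wt a p) ≤
      2⁻¹ * (η p ^ 2 * (e p * wt a p)) + (Metric.ball (0 : Pt n) r₁).indicator
      (fun p => 2 * K ^ 2 * r₁ ^ 2 * ((v p - u p) ^ 2 * wt a p)) p := by
    intro p
    rcases le_or_gt r₁ ‖p‖ with h | h
    · rw [indicator_of_notMem (by simpa using h), hη.eq_zero p h]; simp
    rw [indicator_of_mem (by simpa using h)]
    have hw := wt_nonneg a p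
    have k1 : φ p ^ 2 ≤ K ^ 2 := by
      rw [← sq_abs]; exact pow_le_pow_left₀ (abs_nonneg _) (hK p) 2
    have k2 : ‖p‖ ^ 2 ≤ r₁ ^ 2 := pow_le_pow_left₀ (norm_nonneg _) h.le 2
    set A := η p * (Z v p - Z u p)
    set B := φ p * (v p - u p)
    have k3 : A ^ 2 ≤ r₁ ^ 2 * (η p ^ 2 * e p) := by
      calc A ^ 2 = η p ^ 2 * (Z v p - Z u p) ^ 2 := by ring
        _ ≤ η p ^ 2 * (r₁ ^ 2 * e p) := by
          refine mul_le_mul_of_nonneg_left ((hZe p).trans ?_) (sq_nonneg _)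
          exact mul_le_mul_of_nonneg_right k2 (he0 p)
        _ = _ := by ring
    have k4 : B ^ 2 ≤ K ^ 2 * (v p - u p) ^ 2 := by
      rw [mul_pow]; exact mul_le_mul_of_nonneg_right k1 (sq_nonneg _)
    -- Young's inequality `2AB ≤ A²/(2 r₁²) + 2 r₁² B²`, weighted so that half of the energy `η² e`
    -- can be absorbed on the left. Using `η²` as the cutoff supplies the factor `η` inside `A`.
    have k5 : 2 * A * B ≤ 2⁻¹ * (η p ^ 2 * e p) + 2 * K ^ 2 * r₁ ^ 2 * (v p - u p) ^ 2 := by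
      have hr2 : 0 < r₁ ^ 2 := by positivity
      have k6 : 2 * A * B * r₁ ^ 2 ≤ 2⁻¹ * A ^ 2 + 2 * (r₁ ^ 2) ^ 2 * B ^ 2 := by
        nlinarith [sq_nonneg (A - 2 * r₁ ^ 2 * B)]
      have k7 : 2 * (r₁ ^ 2) ^ 2 * B ^ 2 ≤ 2 * (r₁ ^ 2) ^ 2 * (K ^ 2 * (v p - u p) ^ 2) :=
        mul_le_mul_of_nonneg_left k4 (by positivity)
      refine le_of_mul_le_mul_right ?_ hr2
      linarith
    calc 2 * η p * φ p * ((v p - u p) * (Z v p - Z u p) * wt a p) = 2 * A * B * wt a p := by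
          simp only [A, B]; ring
      _ ≤ (2⁻¹ * (η p ^ 2 * e p) + 2 * K ^ 2 * r₁ ^ 2 * (v p - u p) ^ 2) * wt a p :=
          mul_le_mul_of_nonneg_right k5 hw
      _ = _ := by ring
  have hint := integral_mono i2 ((i1.const_mul 2⁻¹).add i4) hpt
  simp only [Pi.add_apply] at hint
  rw [integral_add (i1.const_mul _) i4, integral_const_mul, integral_indicator measurableSet_ball,
    integral_const_mul] at hint
  have hfin : ∫ p, η p ^ 2 * (e p * wt a p) ≤
      4 * K ^ 2 * r₁ ^ 2 * ∫ p in Metric.ball (0 : Pt n) r₁, (v p - u p) ^ 2 * wt a p := by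
    linarith
  have hb : ∀ p ∈ Metric.ball (0 : Pt n) r, (Z v p - Z u p) ^ 2 * wt a p ≤
      r₁ ^ 2 * (η p ^ 2 * (e p * wt a p)) := by
    intro p hp
    rw [mem_ball_zero_iff] at hp
    rw [hη1 p hp.le, one_pow, one_mul, ← mul_assoc]
    refine mul_le_mul_of_nonneg_right ((hZe p).trans ?_) (wt_nonneg a p)
    exact mul_le_mul_of_nonneg_right (pow_le_pow_left₀ (norm_nonneg _) (by linarith) 2) (he0 p)
  have i5 : IntegrableOn (fun p => (Z v p - Z u p) ^ 2 * wt a p) (Metric.ball 0 r) := by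
    refine Integrable.mono' ((i1.const_mul (r₁ ^ 2)).integrableOn)
      ((((measurable_Z v).sub (measurable_Z u)).pow_const 2).mul
        (measurable_wt a)).aestronglyMeasurable ?_
    filter_upwards [ae_restrict_mem measurableSet_ball] with p hp
    rw [Real.norm_of_nonneg (mul_nonneg (sq_nonneg _) (wt_nonneg a p))]
    exact hb p hp
  refine ⟨i5, ?_⟩
  calc _ ≤ ∫ p in Metric.ball (0 : Pt n) r, r₁ ^ 2 * (η p ^ 2 * (e p * wt a p)) :=
        setIntegral_mono_on i5 (i1.const_mul _).integrableOn measurableSet_ball hb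
    _ ≤ ∫ p, r₁ ^ 2 * (η p ^ 2 * (e p * wt a p)) :=
        setIntegral_le_integral (i1.const_mul _) (ae_of_all _ fun p => mul_nonneg (sq_nonneg _)
          (mul_nonneg (sq_nonneg _) (mul_nonneg (he0 p) (wt_nonneg a p))))
    _ ≤ _ := by
        rw [integral_const_mul, mul_assoc]
        exact mul_le_mul_of_nonneg_left hfin (sq_nonneg _)

end ThinObstacle

/-! ### Square integrability of the second radial derivative -/

namespace ThinObstacle

variable {n : ℕ} {a R r : ℝ} {u v χ ψ : Pt n → ℝ}

theorem IsSolution.mono (hu : IsSolution a R u) {R' : ℝ} (h : R' ≤ R) : IsSolution a R' u := by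
  simpa using hu.comp_smul (t := 1) one_pos (by simpa using h)

theorem exp_mul_le_of_le_log {r₂ r₃ s : ℝ} (h₂ : 0 < r₂) (h₃ : 0 < r₃)
    (hs : s ≤ Real.log (r₃ / r₂)) : Real.exp s * r₂ ≤ r₃ := by
  have := (Real.le_log_iff_exp_le (div_pos h₃ h₂)).1 hs
  rwa [le_div_iff₀ h₂] at this

theorem IsSolution.contDiffOn_Z (hu : IsSolution a R u) : ContDiffOn ℝ 1 (Z u) (offThin n R) :=
  ThinObstacle.contDiffOn_Z (isOpen_offThin R) hu.contDiffOn (by norm_num)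

/-- The radial derivative of `Z u` is locally square integrable with weight `|y|^a`. -/
theorem IsSolution.integrableOn_sq_Z_Z (ha : -1 < a) (hu : IsSolution a R u)
    (h0 : 0 < r) (hr : r < R) :
    IntegrableOn (fun p => Z (Z u) p ^ 2 * wt a p) (Metric.ball 0 r) := by
  -- The Caccioppoli inequality passes from `r` to `r₁` for solutions in `B_{r₂}`, and dilations by
  -- `e^s` with `s ≤ log (r₃ / r₂)` carry `B_{r₂}` into `B_{r₃}`.
  obtain ⟨r₁, h1, h1R⟩ := exists_between hr
  obtain ⟨r₂, h2, h2R⟩ := exists_between h1R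
  obtain ⟨r₃, h3, h3R⟩ := exists_between h2R
  have h02 : 0 < r₂ := by linarith
  have h03 : 0 < r₃ := by linarith
  set S := Real.log (r₃ / r₂) with hS
  have hS0 : 0 < S := Real.log_pos ((one_lt_div h02).2 h3)
  obtain ⟨C, hC0, hC⟩ := IsSolution.exists_caccioppoli n ha h0 h1 h2
  set I := ∫ p in Metric.ball (0 : Pt n) r₃, Z u p ^ 2 * wt a p with hI
  have hI0 : 0 ≤ I := integral_nonneg fun p => mul_nonneg (sq_nonneg _) (wt_nonneg a p)
  have hZi := integrableOn_sq_Z (hu.integrableOn_gr h03 h3R)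
  have hQ : 0 ≤ Q n a := by unfold Q; have : (0 : ℝ) ≤ n := n.cast_nonneg; linarith
  -- Both `u` and its dilate are solutions, so the increment of `Zu` is controlled by the increment
  -- of `u`. The latter is `O(s²)` in the squared norm: one factor `s` from Cauchy-Schwarz along the
  -- orbit, one from its length.
  have hbound : ∀ s, 0 < s → s ≤ S →
      IntegrableOn (fun p => (Z u (Real.exp s • p) - Z u p) ^ 2 * wt a p) (Metric.ball 0 r) ∧
      ∫ p in Metric.ball (0 : Pt n) r, (Z u (Real.exp s • p) - Z u p) ^ 2 * wt a p ≤
        C * (2 * Real.exp (S * Q n a) * I) * s ^ 2 := by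
    intro s hs hsS
    have he : Real.exp s * r₂ ≤ r₃ := exp_mul_le_of_le_log h02 h03 hsS
    have hus : IsSolution a r₂ (fun p => u (Real.exp s • p)) :=
      hu.comp_smul (Real.exp_pos s) (he.trans h3R.le)
    obtain ⟨i1, i2⟩ := hC u _ (hu.mono h2R.le) hus
    simp only [Z_comp_smul] at i1 i2
    refine ⟨i1, i2.trans ?_⟩
    rw [mul_assoc]
    refine mul_le_mul_of_nonneg_left ?_ hC0
    obtain ⟨j1, j2⟩ := integrableOn_orbitIntegral (R' := r₁) (s₀ := s)
      ((measurable_Z u).pow_const 2) (fun p => sq_nonneg _) ha hZi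
      (le_trans (mul_le_mul_of_nonneg_left h2.le (Real.exp_pos s).le) he) hs.le (by linarith)
    have k1 : ∫ p in Metric.ball (0 : Pt n) r₁, (u (Real.exp s • p) - u p) ^ 2 * wt a p ≤
        ∫ p in Metric.ball (0 : Pt n) r₁,
          s * (orbitIntegral (fun q => Z u q ^ 2) s p * wt a p) := by
      refine integral_mono_of_nonneg
        (ae_of_all _ fun p => mul_nonneg (sq_nonneg _) (wt_nonneg a p)) (j1.const_mul s) ?_
      filter_upwards [ae_offThin] with p hp
      have := sq_sub_le_orbitIntegral (R := R) (hu.contDiffOn.of_le (by norm_num)) (s₀ := s) (s := s)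
        (R' := r₁) (le_trans (mul_le_mul_of_nonneg_left h2.le (Real.exp_pos s).le)
          (he.trans h3R.le)) (abs_of_pos hs).le hp
      rw [abs_of_pos hs] at this
      rw [← mul_assoc]
      exact mul_le_mul_of_nonneg_right this (wt_nonneg a p)
    rw [integral_const_mul] at k1
    refine k1.trans ?_
    have k2 : 2 * s * Real.exp (s * Q n a) * I ≤ 2 * s * Real.exp (S * Q n a) * I := by
      gcongr
    calc _ ≤ s * (2 * s * Real.exp (S * Q n a) * I) :=
          mul_le_mul_of_nonneg_left (j2.trans k2) hs.le
      _ = _ := by ring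
  set C' := C * (2 * Real.exp (S * Q n a) * I) with hC'
  let s : ℕ → ℝ := fun k => S / (k + 1)
  have hs0 : ∀ k, 0 < s k := fun k => by positivity
  have hsS : ∀ k, s k ≤ S := fun k => div_le_self hS0.le (by simp)
  have hslim : Tendsto s atTop (𝓝 0) := tendsto_const_div_atTop_nhds_zero_nat S |>.comp
    (tendsto_add_atTop_nat 1) |>.congr fun k => by simp [s]
  -- Squared difference quotients of `Zu` along the dilations. They converge off the thin space to
  -- `(Z(Zu))²`, and Fatou carries the uniform bound to the limit.
  let f : ℕ → Pt n → ENNReal := fun k p =>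
    ENNReal.ofReal (((Z u (Real.exp (s k) • p) - Z u p) / s k) ^ 2 * wt a p)
  have hfm : ∀ k, Measurable (f k) := fun k => by
    refine ENNReal.measurable_ofReal.comp (Measurable.mul (Measurable.pow_const
      (Measurable.div_const (Measurable.sub ?_ (measurable_Z u)) _) 2) (measurable_wt a))
    exact (measurable_Z u).comp (measurable_const_smul _)
  have hfint : ∀ k, ∫⁻ p in Metric.ball 0 r, f k p ≤ ENNReal.ofReal C' := by
    intro k
    obtain ⟨i1, i2⟩ := hbound (s k) (hs0 k) (hsS k)
    have e : ∀ p, ((Z u (Real.exp (s k) • p) - Z u p) / s k) ^ 2 * wt a p =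
        (s k ^ 2)⁻¹ * ((Z u (Real.exp (s k) • p) - Z u p) ^ 2 * wt a p) := fun p => by
      rw [div_pow]; ring
    simp only [f, e]
    rw [← ofReal_integral_eq_lintegral_ofReal (i1.const_mul _)
      (ae_of_all _ fun p => mul_nonneg (by positivity) (mul_nonneg (sq_nonneg _) (wt_nonneg a p)))]
    refine ENNReal.ofReal_le_ofReal ?_
    rw [integral_const_mul, inv_mul_le_iff₀ (pow_pos (hs0 k) 2), mul_comm]
    exact i2
  have hlim : ∀ᵐ p ∂(volume.restrict (Metric.ball (0 : Pt n) r)),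
      Tendsto (fun k => f k p) atTop (𝓝 (ENNReal.ofReal (Z (Z u) p ^ 2 * wt a p))) := by
    filter_upwards [ae_offThin] with p hp
    have hp' : Real.exp 0 • p ∈ offThin n R := by
      simpa using offThin_mono hr.le hp
    have hd := hasDerivAt_comp_exp_smul hu.contDiffOn_Z hp'
    rw [hasDerivAt_iff_tendsto_slope] at hd
    have hs' : Tendsto s atTop (𝓝[≠] 0) := tendsto_nhdsWithin_iff.2
      ⟨hslim, Eventually.of_forall fun k => (hs0 k).ne'⟩
    have h4 := hd.comp hs'
    simp only [Real.exp_zero, one_smul] at h4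
    refine (ENNReal.continuous_ofReal.tendsto _).comp ?_
    refine ((h4.pow 2).mul_const (wt a p)).congr fun k => ?_
    simp [slope_def_field]
  have hfin : ∫⁻ p in Metric.ball 0 r, ENNReal.ofReal (Z (Z u) p ^ 2 * wt a p) ≤
      ENNReal.ofReal C' := by
    calc _ = ∫⁻ p in Metric.ball 0 r, liminf (fun k => f k p) atTop := by
          refine lintegral_congr_ae ?_
          filter_upwards [hlim] with p hp using hp.liminf_eq.symm
      _ ≤ liminf (fun k => ∫⁻ p in Metric.ball 0 r, f k p) atTop := lintegral_liminf_le hfm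
      _ ≤ _ := by
          refine liminf_le_of_frequently_le' (Frequently.of_forall hfint)
  refine ⟨(((measurable_Z _).pow_const 2).mul (measurable_wt a)).aestronglyMeasurable, ?_⟩
  rw [hasFiniteIntegral_iff_ofReal (ae_of_all _ fun p => mul_nonneg (sq_nonneg _) (wt_nonneg a p))]
  exact hfin.trans_lt ENNReal.ofReal_lt_top

end ThinObstacle

/-! ### The Rellich identity by variation along dilations -/

namespace ThinObstacle

variable {n : ℕ} {a R r : ℝ} {u v χ ψ : Pt n → ℝ}

/-- With the dilation placed on the cutoff, the derivative falls on `χ` alone and `F`, later the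
energy density, needs no differentiability. -/
theorem hasDerivAt_integral_cutoff_dilate {r₂ r₃ : ℝ} {F : Pt n → ℝ} (hF : Measurable F)
    (hFi : IntegrableOn F (Metric.ball 0 r₃)) (hχ : RadialCutoff r₂ χ ψ) :
    HasDerivAt (fun s : ℝ => ∫ p in Metric.ball (0 : Pt n) r₃, χ (Real.exp (-s) • p) * F p)
      (∫ p in Metric.ball (0 : Pt n) r₃, ψ p * (‖p‖ ^ 2 * F p)) 0 := by
  have hc : Continuous fun p : Pt n => ψ p * ‖p‖ ^ 2 :=
    hχ.continuous_deriv.mul (by fun_prop)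
  have hcs : HasCompactSupport fun p : Pt n => ψ p * ‖p‖ ^ 2 :=
    HasCompactSupport.intro (isCompact_closedBall (0 : Pt n) r₂) fun p hp => by
      rw [hχ.deriv_eq_zero p (not_le.1 (by simpa using hp)).le, zero_mul]
  obtain ⟨C, hC⟩ := hcs.exists_bound_of_continuous hc
  obtain ⟨K, hK⟩ := (HasCompactSupport.intro (isCompact_closedBall (0 : Pt n) r₂) fun p hp =>
    hχ.eq_zero p (not_le.1 (by simpa using hp)).le : HasCompactSupport
      χ).exists_bound_of_continuous hχ.contDiff.continuous
  have := (hasDerivAt_integral_of_dominated_loc_of_deriv_le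
    (μ := volume.restrict (Metric.ball (0 : Pt n) r₃)) (x₀ := (0 : ℝ)) (s := univ)
    (F := fun s p => χ (Real.exp (-s) • p) * F p)
    (F' := fun s p => ψ (Real.exp (-s) • p) * ‖Real.exp (-s) • p‖ ^ 2 * F p)
    (bound := fun p => C * ‖F p‖) univ_mem ?_ ?_ ?_ ?_ ?_ ?_).2
  · refine this.congr_deriv (integral_congr_ae (ae_of_all _ fun p => ?_))
    simp [mul_assoc]
  · refine Eventually.of_forall fun s => ?_
    exact ((hχ.contDiff.continuous.measurable.comp
      (measurable_const_smul _)).mul hF).aestronglyMeasurable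
  · exact hFi.bdd_mul (hχ.contDiff.continuous.comp (by fun_prop)).aestronglyMeasurable
      (ae_of_all _ fun p => hK _)
  · exact ((hc.measurable.comp (measurable_const_smul (Real.exp (-0)))).mul hF).aestronglyMeasurable
  · refine ae_of_all _ fun p s _ => ?_
    rw [norm_mul]
    exact mul_le_mul_of_nonneg_right (hC _) (norm_nonneg _)
  · exact hFi.norm.const_mul C
  · refine ae_of_all _ fun p s _ => ?_
    refine HasDerivAt.mul_const ?_ (F p)
    have h1 := (hχ.contDiff.differentiable one_ne_zero (Real.exp (-s) • p)).hasFDerivAt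
    have h2 : HasDerivAt (fun s => Real.exp (-s) • p) (-Real.exp (-s) • p) s := by
      have := ((Real.hasDerivAt_exp (-s)).comp s (hasDerivAt_neg s)).smul_const p
      simpa using this
    refine (h1.comp_hasDerivAt s h2).congr_deriv ?_
    rw [hχ.fderiv_eq, neg_smul, inner_neg_right, real_inner_self_eq_norm_sq]
    ring

/-- Differentiation under the integral. With `X` the dilate of `Zu` and `Y = Zu`, one has `|XY| ≤ (X
- Y)² + 2Y²`, and `(X - Y)²` is dominated, uniformly in `s`, by the orbit integral of `(Z(Zu))²`. -/
theorem IsSolution.hasDerivAt_integral_dilate (ha : -1 < a) (hu : IsSolution a R u) {r₂ r₃ : ℝ}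
    (h02 : 0 < r₂) (h3 : r₂ < r₃) (h3R : r₃ < R) (hψ : Continuous ψ)
    (hz : ∀ p, r₂ ≤ ‖p‖ → ψ p = 0) :
    HasDerivAt (fun s : ℝ => ∫ p in Metric.ball (0 : Pt n) r₂,
        ψ p * (u (Real.exp s • p) * Z u p * wt a p))
      (∫ p in Metric.ball (0 : Pt n) r₂, ψ p * (Z u p ^ 2 * wt a p)) 0 := by
  have h03 : 0 < r₃ := by linarith
  set S := Real.log (r₃ / r₂) with hS
  have hS0 : 0 < S := Real.log_pos ((one_lt_div h02).2 h3)
  have hle : ∀ s ≤ S, Real.exp s * r₂ ≤ r₃ := fun s hs => exp_mul_le_of_le_log h02 h03 hs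
  obtain ⟨K, hK⟩ := (HasCompactSupport.intro (isCompact_closedBall (0 : Pt n) r₂) fun p hp =>
    hz p (not_le.1 (by simpa using hp)).le : HasCompactSupport
      ψ).exists_bound_of_continuous hψ
  have hK0 : 0 ≤ K := (norm_nonneg _).trans (hK 0)
  have hZi := integrableOn_sq_Z (hu.integrableOn_gr h02 (h3.trans h3R))
  have hM := (integrableOn_orbitIntegral (R' := r₂) (s₀ := S)
    ((measurable_Z (Z u)).pow_const 2) (fun p => sq_nonneg _) ha
    (hu.integrableOn_sq_Z_Z ha h03 h3R) (hle S le_rfl) hS0.le h02.le).1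
  have hsol : ∀ s ≤ S, IsSolution a r₂ (fun p => u (Real.exp s • p)) := fun s hs =>
    hu.comp_smul (Real.exp_pos s) ((hle s hs).trans h3R.le)
  have := (hasDerivAt_integral_of_dominated_loc_of_deriv_le
    (μ := volume.restrict (Metric.ball (0 : Pt n) r₂)) (x₀ := (0 : ℝ)) (s := Metric.ball 0 S)
    (F := fun s p => ψ p * (u (Real.exp s • p) * Z u p * wt a p))
    (F' := fun s p => ψ p * (Z u (Real.exp s • p) * Z u p * wt a p))
    (bound := fun p => K * (S * (orbitIntegral (fun q => Z (Z u) q ^ 2) S p * wt a p) +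
      2 * (Z u p ^ 2 * wt a p)))
    (Metric.ball_mem_nhds 0 hS0) ?_ ?_ ?_ ?_ ?_ ?_).2
  · refine this.congr_deriv (integral_congr_ae (ae_of_all _ fun p => ?_))
    simp [sq]
  · filter_upwards [Metric.ball_mem_nhds (0 : ℝ) hS0] with s hs
    have hsS : s ≤ S := by
      rw [mem_ball_zero_iff] at hs; exact (le_abs_self s).trans hs.le
    exact hψ.aestronglyMeasurable.mul ((((hsol s hsS).aestronglyMeasurable le_rfl).mul
      (measurable_Z u).aestronglyMeasurable).mul (measurable_wt a).aestronglyMeasurable)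
  · simp only [Real.exp_zero, one_smul]
    refine Integrable.bdd_mul ?_ hψ.aestronglyMeasurable (ae_of_all _ hK)
    exact integrableOn_mul_mul_wt (hu.aestronglyMeasurable (h3.trans h3R).le)
      (measurable_Z u).aestronglyMeasurable
      (integrableOn_sq_wt ha (h3.trans h3R) hu.continuousOn) hZi
  · refine hψ.aestronglyMeasurable.mul (Measurable.aestronglyMeasurable ?_)
    exact (((measurable_Z u).comp (measurable_const_smul _)).mul (measurable_Z u)).mul
      (measurable_wt a)
  · filter_upwards [ae_offThin] with p hp s hs
    have hs' : |s| ≤ S := (mem_ball_zero_iff.1 hs).le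
    have h1 := sq_sub_le_orbitIntegral hu.contDiffOn_Z ((hle S le_rfl).trans h3R.le) hs' hp
    have hO : 0 ≤ orbitIntegral (fun q => Z (Z u) q ^ 2) S p :=
      intervalIntegral.integral_nonneg (by linarith) fun _ _ => sq_nonneg _
    have h2 := h1.trans (mul_le_mul_of_nonneg_right hs' hO)
    rw [norm_mul, norm_mul, Real.norm_of_nonneg (wt_nonneg a p), ← mul_assoc S,
      ← mul_assoc 2 (Z u p ^ 2), ← add_mul]
    refine mul_le_mul (hK p) (mul_le_mul_of_nonneg_right ?_ (wt_nonneg a p))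
      (mul_nonneg (norm_nonneg _) (wt_nonneg a p)) hK0
    rw [Real.norm_eq_abs, abs_le]
    constructor
    · nlinarith [sq_nonneg (Z u (Real.exp s • p) + Z u p),
        sq_nonneg (Z u (Real.exp s • p) - Z u p)]
    · nlinarith [sq_nonneg (Z u (Real.exp s • p) - Z u p - Z u p),
        sq_nonneg (Z u (Real.exp s • p) - Z u p)]
  · exact ((hM.const_mul S).add (hZi.const_mul 2)).const_mul K
  · filter_upwards [ae_offThin] with p hp s hs
    have hs' : |s| ≤ S := (mem_ball_zero_iff.1 hs).le
    have h1 := hasDerivAt_comp_exp_smul (hu.contDiffOn.of_le (by norm_num))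
      (exp_smul_mem_offThin ((hle S le_rfl).trans h3R.le) ((le_abs_self s).trans hs') hp)
    exact ((h1.mul_const (Z u p)).mul_const (wt a p)).const_mul (ψ p)

/-- The identity obtained by varying a solution along the dilations. -/
theorem IsSolution.integral_cutoff_rellich (ha : -1 < a) (hu : IsSolution a R u)
    (h0 : 0 < r) (hr : r < R) (hχ : RadialCutoff r χ ψ) :
    2 * ∫ p, ψ p * (Z u p ^ 2 * wt a p) =
      (2 - Q n a) * (∫ p, χ p * (gr u u p * wt a p)) +
        ∫ p, ψ p * (‖p‖ ^ 2 * (gr u u p * wt a p)) := by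
  obtain ⟨r₂, h2, h2R⟩ := exists_between hr
  obtain ⟨r₃, h3, h3R⟩ := exists_between h2R
  have h02 : 0 < r₂ := by linarith
  have h03 : 0 < r₃ := by linarith
  set S := Real.log (r₃ / r₂) with hS
  have hS0 : 0 < S := Real.log_pos ((one_lt_div h02).2 h3)
  have hle : ∀ s ≤ S, Real.exp s * r₂ ≤ r₃ := fun s hs => exp_mul_le_of_le_log h02 h03 hs
  have whole : ∀ {r' : ℝ} {g F : Pt n → ℝ}, r ≤ r' → (∀ p, r ≤ ‖p‖ → g p = 0) →
      ∫ p in Metric.ball (0 : Pt n) r', g p * F p = ∫ p, g p * F p := by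
    intro r' g F h hg
    refine setIntegral_eq_integral_of_forall_compl_eq_zero fun p hp => ?_
    rw [hg p (h.trans (by simpa using hp)), zero_mul]
  set b := ∫ p, χ p * (gr u u p * wt a p) with hb
  have hdA := hasDerivAt_integral_cutoff_dilate
    (F := fun p => gr u u p * wt a p) ((measurable_gr u u).mul (measurable_wt a))
    (hu.integrableOn_gr h03 h3R) hχ
  have hdp := hu.hasDerivAt_integral_dilate ha h02 h3 h3R hχ.continuous_deriv
    fun p hp => hχ.deriv_eq_zero p (h2.le.trans hp)
  set A : ℝ → ℝ := fun s => ∫ p in Metric.ball (0 : Pt n) r₃,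
    χ (Real.exp (-s) • p) * (gr u u p * wt a p) with hA
  set P : ℝ → ℝ := fun s => ∫ p in Metric.ball (0 : Pt n) r₂,
    ψ p * (u (Real.exp s • p) * Z u p * wt a p) with hP
  have hA0 : A 0 = b := by
    simp only [hA, neg_zero, Real.exp_zero, one_smul]
    exact whole (h2.le.trans h3.le) hχ.eq_zero
  have hP0 : P 0 = b := by
    simp only [hP, Real.exp_zero, one_smul]
    rw [whole h2.le hχ.deriv_eq_zero]
    exact hu.integral_cutoff_eq ha h0 hr hχ
  -- Half the sum of the cutoff energies of the dilate `u_s` and of `u`, minus `∫ ψ u_s Zu |y|^a`.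
  -- At `s = 0` all three quantities equal `b`.
  let h : ℝ → ℝ := fun s => (Real.exp ((2 - Q n a) * s) * A s + b) / 2 - P s
  have hE : HasDerivAt (fun s : ℝ => Real.exp ((2 - Q n a) * s)) (2 - Q n a) 0 := by
    have := ((hasDerivAt_id (0 : ℝ)).const_mul (2 - Q n a)).exp
    simpa using this
  have hd := (((hE.mul hdA).add_const b).div_const 2).sub hdp
  -- Nonnegativity of `h`: test the inequality for `u` with `u_s`, then bound the mixed product by
  -- half the sum of the squares.
  have hmin : IsLocalMin h 0 := by
    filter_upwards [Metric.ball_mem_nhds (0 : ℝ) hS0] with s hs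
    have hs' : |s| < S := mem_ball_zero_iff.1 hs
    have hsS : s ≤ S := (le_abs_self s).trans hs'.le
    have hus : IsSolution a r₂ (fun p => u (Real.exp s • p)) :=
      hu.comp_smul (Real.exp_pos s) ((hle s hsS).trans h3R.le)
    have hu2 := hu.mono h2R.le
    have h5 := hu2.integral_cutoff_le_of_isSolution ha hus h0 h2 hχ
    have h6 : ∫ p, χ p * (gr u (fun p => u (Real.exp s • p)) p * wt a p) ≤
        ∫ p, 2⁻¹ * (χ p * (gr u u p * wt a p) + χ p * (gr (fun p => u (Real.exp s • p))
          (fun p => u (Real.exp s • p)) p * wt a p)) := by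
      refine integral_mono (hu2.integrable_cutoff_mul_gr hus h0 h2 hχ)
        (((hu2.integrable_cutoff_mul_gr hu2 h0 h2 hχ).add
          (hus.integrable_cutoff_mul_gr hus h0 h2 hχ)).const_mul _) fun p => ?_
      have h7 := (le_abs_self _).trans (abs_gr_le u (fun p => u (Real.exp s • p)) p)
      have h8 := mul_le_mul_of_nonneg_left (mul_le_mul_of_nonneg_right h7 (wt_nonneg a p))
        (hχ.nonneg p)
      simp only
      linarith
    rw [integral_const_mul, integral_add (hu2.integrable_cutoff_mul_gr hu2 h0 h2 hχ)
          (hus.integrable_cutoff_mul_gr hus h0 h2 hχ)] at h6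
    -- The change of variables moves the dilation from `u` to the cutoff. The factor is `e^(2s)`
    -- from the gradients times `e^(-Qs)` from the weighted measure.
    have h9 : ∫ p, χ p * (gr (fun p => u (Real.exp s • p))
          (fun p => u (Real.exp s • p)) p * wt a p) = Real.exp ((2 - Q n a) * s) * A s := by
      rw [← whole h2.le hχ.eq_zero]
      simp only [gr_comp_smul]
      have e1 : ∀ p, χ p * (Real.exp s ^ 2 * gr u u (Real.exp s • p) * wt a p) =
          Real.exp s ^ 2 * ((fun q => χ (Real.exp (-s) • q) * gr u u q) (Real.exp s • p) *
            wt a p) := by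
        intro p
        simp only [smul_smul, ← Real.exp_add, neg_add_cancel, Real.exp_zero, one_smul]
        ring
      rw [integral_congr_ae (ae_of_all _ e1), integral_const_mul,
        setIntegral_ball_comp_smul (Real.exp_pos s) r₂
          (fun q => χ (Real.exp (-s) • q) * gr u u q), ← mul_assoc]
      congr 1
      · rw [← Real.exp_mul, ← Real.exp_nat_mul, ← Real.exp_add]
        congr 1; push_cast; ring
      · simp only [hA, ← mul_assoc]
        refine (setIntegral_eq_of_subset_of_forall_sdiff_eq_zero measurableSet_ball
          (Metric.ball_subset_ball (hle s hsS)) fun p hp => ?_).symm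
        rw [hχ.eq_zero, zero_mul, zero_mul]
        have h10 : Real.exp s * r₂ ≤ ‖p‖ := by simpa using hp.2
        rw [norm_smul, Real.norm_of_nonneg (Real.exp_pos _).le]
        calc r ≤ r₂ := h2.le
          _ = Real.exp (-s) * (Real.exp s * r₂) := by
            rw [← mul_assoc, ← Real.exp_add]; simp
          _ ≤ _ := mul_le_mul_of_nonneg_left h10 (Real.exp_pos _).le
    have h11 : P s = ∫ p, ψ p * (u (Real.exp s • p) * Z u p * wt a p) :=
      whole h2.le hχ.deriv_eq_zero
    have h12 : h 0 = 0 := by simp [h, hA0, hP0]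
    rw [h12]
    simp only [h]
    rw [h9] at h6
    rw [h11]
    linarith
  have hz := hmin.hasDerivAt_eq_zero hd
  rw [whole h2.le hχ.deriv_eq_zero, whole (h2.le.trans h3.le) hχ.deriv_eq_zero, hA0] at hz
  simp only [mul_zero, Real.exp_zero] at hz
  linarith

end ThinObstacle

/-! ### Polar coordinates and spherical integrals -/

namespace ThinObstacle

variable {n : ℕ} {a R r : ℝ}

/-- Surface measure on the unit sphere of `ℝⁿ⁺¹`. -/
noncomputable abbrev sphereMeasure (n : ℕ) : Measure (Metric.sphere (0 : Pt n) 1) :=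
  (volume : Measure (Pt n)).toSphere

/-- This is the polar homeomorphism of the punctured space, with the radius taken in `ℝ` under
restricted measure instead of in the subtype of positive reals. The omitted origin is null. -/
theorem measurePreserving_polar (n : ℕ) :
    MeasurePreserving (fun z : Metric.sphere (0 : Pt n) 1 × ℝ => z.2 • (z.1 : Pt n))
      (((sphereMeasure n).prod (volume.restrict (Ioi 0))).withDensity
        fun z => ENNReal.ofReal (z.2 ^ n)) volume := by
  have hh : Measurable (fun z : Metric.sphere (0 : Pt n) 1 × ℝ => z.2 • (z.1 : Pt n)) :=
    (by fun_prop : Continuous _).measurable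
  refine ⟨hh, ?_⟩
  have hdens : Measurable fun ρ : ℝ => ENNReal.ofReal (ρ ^ n) := by fun_prop
  have hν : (Measure.volumeIoiPow n).map (Subtype.val : Ioi (0 : ℝ) → ℝ) =
      (volume.restrict (Ioi 0)).withDensity fun ρ => ENNReal.ofReal (ρ ^ n) := by
    ext s hs
    rw [Measure.map_apply measurable_subtype_coe hs, Measure.volumeIoiPow,
      withDensity_apply _ (measurable_subtype_coe hs), withDensity_apply _ hs,
      setLIntegral_subtype measurableSet_Ioi _ fun ρ : ℝ => ENNReal.ofReal (ρ ^ n),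
      Subtype.image_preimage_coe, Measure.restrict_restrict hs, inter_comm]
  have h1 : ((sphereMeasure n).prod (volume.restrict (Ioi (0 : ℝ)))).withDensity
        (fun z => ENNReal.ofReal (z.2 ^ n)) =
      ((sphereMeasure n).prod (Measure.volumeIoiPow n)).map
        (Prod.map id (Subtype.val : Ioi (0 : ℝ) → ℝ)) := by
    rw [← Measure.map_prod_map _ _ measurable_id measurable_subtype_coe, hν, Measure.map_id,
      prod_withDensity_right hdens]
  have h2 := (volume : Measure (Pt n)).measurePreserving_homeomorphUnitSphereProd
  have hfr : Module.finrank ℝ (Pt n) - 1 = n := by simp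
  rw [hfr] at h2
  have h3 := h2.symm (homeomorphUnitSphereProd (Pt n)).toMeasurableEquiv
  rw [h1, Measure.map_map hh (measurable_id.prodMap measurable_subtype_coe)]
  have h4 : (fun z : Metric.sphere (0 : Pt n) 1 × ℝ => z.2 • (z.1 : Pt n)) ∘
      Prod.map id (Subtype.val : Ioi (0 : ℝ) → ℝ) =
      Subtype.val ∘ (homeomorphUnitSphereProd (Pt n)).toMeasurableEquiv.symm := by
    funext z
    exact (homeomorphUnitSphereProd_symm_apply_coe (Pt n) z).symm
  rw [h4, ← Measure.map_map measurable_subtype_coe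
    (homeomorphUnitSphereProd (Pt n)).toMeasurableEquiv.symm.measurable, h3.map_eq,
    map_comap_subtype_coe (measurableSet_singleton _).compl,
    Measure.restrict_eq_self_of_ae_mem]
  simp [ae_iff]

theorem polar_aux {f : Pt n → ℝ} (hf : Integrable f) :
    Integrable (fun z : Metric.sphere (0 : Pt n) 1 × ℝ => z.2 ^ n * f (z.2 • (z.1 : Pt n)))
      ((sphereMeasure n).prod (volume.restrict (Ioi 0))) ∧
    ∫ p, f p = ∫ z : Metric.sphere (0 : Pt n) 1 × ℝ, z.2 ^ n * f (z.2 • (z.1 : Pt n))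
      ∂((sphereMeasure n).prod (volume.restrict (Ioi 0))) := by
  have hmp := measurePreserving_polar n
  have hd : Measurable fun z : Metric.sphere (0 : Pt n) 1 × ℝ => ENNReal.ofReal (z.2 ^ n) := by
    fun_prop
  have hpos : ∀ᵐ z ∂((sphereMeasure n).prod (volume.restrict (Ioi (0 : ℝ)))), 0 < z.2 :=
    Measure.quasiMeasurePreserving_snd.ae (ae_restrict_mem measurableSet_Ioi)
  have hcongr : (fun z : Metric.sphere (0 : Pt n) 1 × ℝ =>
        (ENNReal.ofReal (z.2 ^ n)).toReal • f (z.2 • (z.1 : Pt n)))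
      =ᵐ[(sphereMeasure n).prod (volume.restrict (Ioi (0 : ℝ)))]
      fun z => z.2 ^ n * f (z.2 • (z.1 : Pt n)) := by
    filter_upwards [hpos] with z hz
    rw [ENNReal.toReal_ofReal (pow_nonneg hz.le n), smul_eq_mul]
  have hlt : ∀ᵐ z : Metric.sphere (0 : Pt n) 1 × ℝ
      ∂((sphereMeasure n).prod (volume.restrict (Ioi (0 : ℝ)))),
      ENNReal.ofReal (z.2 ^ n) < ⊤ := ae_of_all _ fun _ => ENNReal.ofReal_lt_top
  refine ⟨?_, ?_⟩
  · have h1 := hmp.integrable_comp_of_integrable hf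
    rw [integrable_withDensity_iff_integrable_smul' hd hlt] at h1
    exact h1.congr hcongr
  · rw [← integral_congr_ae hcongr, ← integral_withDensity_eq_integral_toReal_smul hd hlt,
      ← integral_map hmp.measurable.aemeasurable (by rw [hmp.map_eq]; exact hf.aestronglyMeasurable),
      hmp.map_eq]

theorem integrable_polar {f : Pt n → ℝ} (hf : IntegrableOn f (Metric.ball 0 R)) :
    Integrable (fun z : Metric.sphere (0 : Pt n) 1 × ℝ => z.2 ^ n * f (z.2 • (z.1 : Pt n)))
      ((sphereMeasure n).prod (volume.restrict (Ioo 0 R))) := by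
  have h1 := (polar_aux ((integrable_indicator_iff measurableSet_ball).2 hf)).1
  have h2 := h1.mono_measure (Measure.prod_mono (le_refl (sphereMeasure n))
    (Measure.restrict_mono (Ioo_subset_Ioi_self : Ioo 0 R ⊆ Ioi 0) (le_refl volume)))
  refine h2.congr ?_
  have hmem : ∀ᵐ z ∂((sphereMeasure n).prod (volume.restrict (Ioo 0 R))), z.2 ∈ Ioo 0 R :=
    Measure.quasiMeasurePreserving_snd.ae (ae_restrict_mem measurableSet_Ioo)
  filter_upwards [hmem] with z hz
  rw [indicator_of_mem]
  rw [mem_ball_zero_iff, norm_smul, Real.norm_of_nonneg hz.1.le]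
  simpa using hz.2

theorem setIntegral_ball_eq {f : Pt n → ℝ} (hf : IntegrableOn f (Metric.ball 0 R)) :
    IntegrableOn (fun ρ => sphereIntegral ρ f) (Ioo 0 R) ∧
    ∫ p in Metric.ball (0 : Pt n) R, f p = ∫ ρ in Ioo 0 R, sphereIntegral ρ f := by
  have hi := integrable_polar hf
  have h0 := (polar_aux ((integrable_indicator_iff measurableSet_ball).2 hf))
  have h1 := h0.2
  rw [integral_indicator measurableSet_ball, integral_prod_symm _ h0.1] at h1
  refine ⟨hi.integral_prod_right.congr (ae_of_all _ fun ρ => ?_), ?_⟩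
  · simp only [integral_const_mul, sphereIntegral]
  · rw [h1]
    have h2 : ∀ ρ ∈ Ioi (0 : ℝ), (∫ ω, ρ ^ n * (Metric.ball (0 : Pt n) R).indicator f
        (ρ • (ω : Pt n)) ∂(sphereMeasure n)) =
        (Iio R).indicator (fun ρ => sphereIntegral ρ f) ρ := by
      intro ρ hρ
      have hn : ∀ ω : Metric.sphere (0 : Pt n) 1, ‖ρ • (ω : Pt n)‖ = ρ := fun ω => by
        rw [norm_smul, Real.norm_of_nonneg (le_of_lt hρ)]; simp
      rw [integral_const_mul]
      rcases lt_or_ge ρ R with h | h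
      · rw [indicator_of_mem (by exact h), sphereIntegral]
        congr 1
        refine integral_congr_ae (ae_of_all _ fun ω => ?_)
        exact indicator_of_mem (by rw [mem_ball_zero_iff, hn]; exact h) f
      · rw [indicator_of_notMem (by simpa using h)]
        have : ∀ ω : Metric.sphere (0 : Pt n) 1,
            (Metric.ball (0 : Pt n) R).indicator f (ρ • (ω : Pt n)) = 0 := fun ω =>
          indicator_of_notMem (by rw [mem_ball_zero_iff, hn]; simpa using h) f
        simp [this]
    rw [setIntegral_congr_fun measurableSet_Ioi h2, setIntegral_indicator measurableSet_Iio]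
    rfl

/-- Surface measure is a multiple of the volume of the cone over a set, and the cone over the
equator lies in the null hyperplane `y = 0`. -/
theorem ae_sphere_yc_ne_zero :
    ∀ᵐ ω : Metric.sphere (0 : Pt n) 1 ∂(sphereMeasure n), yc (ω : Pt n) ≠ 0 := by
  have hm : MeasurableSet {ω : Metric.sphere (0 : Pt n) 1 | yc (ω : Pt n) = 0} :=
    (isClosed_eq (continuous_yc.comp continuous_subtype_val) continuous_const).measurableSet
  have h0 : (volume : Measure (Pt n)) {p | yc p = 0} = 0 := by
    simpa [ae_iff] using ae_yc_ne_zero (n := n)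
  rw [ae_iff]
  simp only [not_not]
  have h1 := (volume : Measure (Pt n)).toSphere_apply' hm
  refine h1.trans ?_
  refine mul_eq_zero_of_right _ (measure_mono_null ?_ h0)
  rintro _ ⟨t, ht, _, ⟨ω, hω, rfl⟩, rfl⟩
  have : yc (ω : Pt n) = 0 := hω
  simp [yc_smul, this]

/-- The weighted integral of `ω ↦ F (ρ ω)` over the unit sphere. -/
noncomputable def sphereMean (a : ℝ) (F : Pt n → ℝ) (ρ : ℝ) : ℝ :=
  ∫ ω : Metric.sphere (0 : Pt n) 1, F (ρ • (ω : Pt n)) * wt a (ω : Pt n) ∂(sphereMeasure n)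

/-- The exponent `Q - 1 = n + a` collects surface scaling and weight, leaving a mean with fixed
weight on the unit sphere that can be differentiated in `ρ`. -/
theorem sphereIntegral_mul_wt {ρ : ℝ} (hρ : 0 < ρ) (F : Pt n → ℝ) :
    sphereIntegral ρ (fun p => F p * wt a p) = ρ ^ (Q n a - 1) * sphereMean a F ρ := by
  have h1 : ∀ ω : Metric.sphere (0 : Pt n) 1, F (ρ • (ω : Pt n)) * wt a (ρ • (ω : Pt n)) =
      ρ ^ a * (F (ρ • (ω : Pt n)) * wt a (ω : Pt n)) := fun ω => by
    rw [wt_smul a hρ]; ring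
  simp only [sphereIntegral, h1, integral_const_mul, sphereMean, sphereMeasure]
  rw [← mul_assoc, ← Real.rpow_natCast, ← Real.rpow_add hρ]
  congr 2
  unfold Q; ring

theorem smul_sphere_mem_offThin {ρ : ℝ} (hρ : ρ ∈ Ioo 0 R) {ω : Metric.sphere (0 : Pt n) 1}
    (hω : yc (ω : Pt n) ≠ 0) : ρ • (ω : Pt n) ∈ offThin n R := by
  refine ⟨?_, ?_⟩
  · rw [mem_ball_zero_iff, norm_smul, Real.norm_of_nonneg hρ.1.le]
    simpa using hρ.2
  · change yc _ ≠ 0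
    rw [yc_smul]
    exact mul_ne_zero hρ.1.ne' hω

/-- For radii in `(δ, R)` all powers of `ρ` are bounded, so the polar density `ρ^(n+a)` may be
exchanged for any `ρ^k`. -/
theorem integrable_sphere_kernel {G : Pt n → ℝ} {δ : ℝ} (hδ : 0 < δ)
    (hG : IntegrableOn (fun p => G p * wt a p) (Metric.ball 0 R)) (k : ℝ) :
    Integrable (fun z : Metric.sphere (0 : Pt n) 1 × ℝ =>
      z.2 ^ k * (G (z.2 • (z.1 : Pt n)) * wt a (z.1 : Pt n)))
      ((sphereMeasure n).prod (volume.restrict (Ioo δ R))) := by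
  have h1 := (integrable_polar hG).mono_measure (Measure.prod_mono (le_refl (sphereMeasure n))
    (Measure.restrict_mono (Ioo_subset_Ioo_left hδ.le : Ioo δ R ⊆ Ioo 0 R) (le_refl volume)))
  have hmem : ∀ᵐ z ∂((sphereMeasure n).prod (volume.restrict (Ioo δ R))), z.2 ∈ Ioo δ R :=
    Measure.quasiMeasurePreserving_snd.ae (ae_restrict_mem measurableSet_Ioo)
  have hcont : ContinuousOn (fun ρ : ℝ => ρ ^ (k - (n + a))) (Icc δ R) := by
    refine ContinuousOn.rpow_const continuousOn_id fun x hx => Or.inl ?_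
    exact (hδ.trans_le hx.1).ne'
  obtain ⟨C, hC⟩ := isCompact_Icc.exists_bound_of_continuousOn hcont
  have h2 := h1.bdd_mul (f := fun z : Metric.sphere (0 : Pt n) 1 × ℝ => z.2 ^ (k - (n + a)))
    (c := C) (measurable_snd.pow_const _).aestronglyMeasurable ?_
  · refine h2.congr ?_
    filter_upwards [hmem] with z hz
    have hz0 : 0 < z.2 := hδ.trans hz.1
    rw [wt_smul a hz0, ← Real.rpow_natCast]
    have : z.2 ^ k = z.2 ^ (k - (n + a)) * z.2 ^ (n : ℝ) * z.2 ^ a := by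
      rw [← Real.rpow_add hz0, ← Real.rpow_add hz0]; congr 1; ring
    rw [this]; ring
  · filter_upwards [hmem] with z hz
    exact hC z.2 ⟨hz.1.le, hz.2.le⟩

end ThinObstacle

/-! ### Spherical means at every radius -/

namespace ThinObstacle

variable {n : ℕ} {a R r : ℝ}

theorem hasDerivAt_comp_smul_sphere {F : Pt n → ℝ} (hF : ContDiffOn ℝ 1 F (offThin n R)) {p : Pt n}
    {ρ : ℝ} (hρ : ρ ≠ 0) (h : ρ • p ∈ offThin n R) :
    HasDerivAt (fun ρ : ℝ => F (ρ • p)) (ρ⁻¹ * Z F (ρ • p)) ρ := by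
  have h1 : HasFDerivAt F (fderiv ℝ F (ρ • p)) (ρ • p) :=
    ((hF.contDiffAt ((isOpen_offThin R).mem_nhds h)).differentiableAt one_ne_zero).hasFDerivAt
  refine (h1.comp_hasDerivAt ρ ((hasDerivAt_id ρ).smul_const p)).congr_deriv ?_
  simp [Z, hρ]

/-- `F` is of class `C¹` off the thin space, and `F`, `Z F` are locally integrable with
weight `|y|^a`. -/
structure RadiallyW11 (a R : ℝ) (F : Pt n → ℝ) : Prop where
  contDiffOn : ContDiffOn ℝ 1 F (offThin n R)
  integrableOn : ∀ r, 0 < r → r < R → IntegrableOn (fun p => F p * wt a p) (Metric.ball 0 r)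
  integrableOn_Z : ∀ r, 0 < r → r < R → IntegrableOn (fun p => Z F p * wt a p) (Metric.ball 0 r)

namespace RadiallyW11

variable {F : Pt n → ℝ}

theorem integral_kernel (hF : RadiallyW11 a R F) {ω : Metric.sphere (0 : Pt n) 1} (hω : yc (ω : Pt n) ≠ 0) {r₁ r₂ : ℝ}
    (h0 : 0 < r₁) (h1 : r₁ ≤ r₂) (h2 : r₂ < R) :
    ∫ ρ in r₁..r₂, ρ⁻¹ * (Z F (ρ • (ω : Pt n)) * wt a (ω : Pt n)) =
      F (r₂ • (ω : Pt n)) * wt a (ω : Pt n) - F (r₁ • (ω : Pt n)) * wt a (ω : Pt n) := by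
  have hmem : ∀ ρ ∈ Icc r₁ r₂, ρ • (ω : Pt n) ∈ offThin n R := fun ρ hρ =>
    smul_sphere_mem_offThin ⟨h0.trans_le hρ.1, hρ.2.trans_lt h2⟩ hω
  refine intervalIntegral.integral_eq_sub_of_hasDerivAt
    (f := fun ρ => F (ρ • (ω : Pt n)) * wt a (ω : Pt n)) (fun ρ hρ => ?_) ?_
  · rw [uIcc_of_le h1] at hρ
    refine ((hasDerivAt_comp_smul_sphere hF.contDiffOn (h0.trans_le hρ.1).ne'
      (hmem ρ hρ)).mul_const (wt a (ω : Pt n))).congr_deriv (by ring)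
  · apply ContinuousOn.intervalIntegrable
    rw [uIcc_of_le h1]
    refine ContinuousOn.mul (continuousOn_inv₀.mono fun ρ hρ => (h0.trans_le hρ.1).ne') ?_
    refine ContinuousOn.mul ?_ continuousOn_const
    refine ContinuousOn.comp (t := offThin n R)
      (contDiffOn_Z (m := 0) (isOpen_offThin R) hF.contDiffOn (by norm_num)).continuousOn ?_ hmem
    fun_prop

theorem integrable_kernel (hF : RadiallyW11 a R F) {r₁ r₂ : ℝ} (h0 : 0 < r₁) (h2 : r₂ < R) :
    Integrable (fun z : Metric.sphere (0 : Pt n) 1 × ℝ =>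
      z.2⁻¹ * (Z F (z.2 • (z.1 : Pt n)) * wt a (z.1 : Pt n)))
      ((sphereMeasure n).prod (volume.restrict (Ioc r₁ r₂))) := by
  rcases le_or_gt r₂ r₁ with h | h
  · rw [Ioc_eq_empty (not_lt.2 h), Measure.restrict_empty, Measure.prod_zero]
    exact integrable_zero_measure
  have := integrable_sphere_kernel h0 (hF.integrableOn_Z r₂ (h0.trans h) h2) (-1)
  rw [restrict_Ioo_eq_restrict_Ioc] at this
  simpa only [Real.rpow_neg_one] using this

/-- Fubini provides some smaller radius `s` with an integrable trace. The fundamental theorem of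
calculus along rays, with integrable `ZF`, carries integrability from `s` to the given `r`. -/
theorem integrable_sphere (hF : RadiallyW11 a R F) (hr : r ∈ Ioo 0 R) :
    Integrable (fun ω : Metric.sphere (0 : Pt n) 1 => F (r • (ω : Pt n)) * wt a (ω : Pt n))
      (sphereMeasure n) := by
  obtain ⟨r₀, h1, h2⟩ := exists_between hr.1
  have hk := (integrable_sphere_kernel h1 (hF.integrableOn r hr.1 hr.2) 0).swap.prod_right_ae
  have hne : (volume.restrict (Ioo r₀ r) : Measure ℝ) ≠ 0 := by
    rw [Ne, Measure.restrict_eq_zero, Real.volume_Ioo]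
    simpa using h2
  have : (ae (volume.restrict (Ioo r₀ r))).NeBot := ae_neBot.2 hne
  obtain ⟨s, hs, hsI⟩ := (hk.and (ae_restrict_mem measurableSet_Ioo)).exists
  simp only [Function.comp, Prod.swap, Real.rpow_zero, one_mul] at hs
  have hs0 : 0 < s := h1.trans hsI.1
  refine (hs.add (hF.integrable_kernel hs0 hr.2).integral_prod_left).congr ?_
  filter_upwards [ae_sphere_yc_ne_zero] with ω hω
  have := hF.integral_kernel hω hs0 hsI.2.le hr.2
  rw [intervalIntegral.integral_of_le hsI.2.le] at this
  simp only [Pi.add_apply]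
  rw [this]; ring

theorem intervalIntegrable_sphereMean (hF : RadiallyW11 a R F) {r₁ r₂ : ℝ} (h0 : 0 < r₁) (h1 : r₁ ≤ r₂) (h2 : r₂ < R) :
    IntervalIntegrable (fun ρ => ρ⁻¹ * sphereMean a (Z F) ρ) volume r₁ r₂ := by
  rw [intervalIntegrable_iff_integrableOn_Ioc_of_le h1]
  refine (hF.integrable_kernel h0 h2).integral_prod_right.congr (ae_of_all _ fun ρ => ?_)
  simp only [integral_const_mul, sphereMean]

theorem sphereMean_sub (hF : RadiallyW11 a R F) {r₁ r₂ : ℝ} (h0 : 0 < r₁) (h1 : r₁ ≤ r₂) (h2 : r₂ < R) :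
    sphereMean a F r₂ - sphereMean a F r₁ = ∫ ρ in r₁..r₂, ρ⁻¹ * sphereMean a (Z F) ρ := by
  have i2 := hF.integrable_sphere ⟨h0.trans_le h1, h2⟩
  have i1 := hF.integrable_sphere ⟨h0, h1.trans_lt h2⟩
  rw [sphereMean, sphereMean, ← integral_sub i2 i1, intervalIntegral.integral_of_le h1]
  have hk := hF.integrable_kernel h0 h2
  have h3 : ∀ ρ, ρ⁻¹ * sphereMean a (Z F) ρ = ∫ ω : Metric.sphere (0 : Pt n) 1,
      ρ⁻¹ * (Z F (ρ • (ω : Pt n)) * wt a (ω : Pt n)) ∂(sphereMeasure n) := fun ρ => by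
    rw [integral_const_mul, sphereMean]
  simp only [h3]
  rw [← integral_integral_swap (f := fun (ω : Metric.sphere (0 : Pt n) 1) (ρ : ℝ) =>
    ρ⁻¹ * (Z F (ρ • (ω : Pt n)) * wt a (ω : Pt n))) hk]
  refine integral_congr_ae ?_
  filter_upwards [ae_sphere_yc_ne_zero] with ω hω
  rw [← intervalIntegral.integral_of_le h1, hF.integral_kernel hω h0 h1 h2]

theorem continuousOn_sphereMean (hF : RadiallyW11 a R F) : ContinuousOn (sphereMean a F) (Ioo 0 R) := by
  intro r hr
  obtain ⟨r₁, h1, h1r⟩ := exists_between hr.1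
  obtain ⟨r₂, h2r, h2⟩ := exists_between hr.2
  have hle : r₁ ≤ r₂ := (h1r.trans h2r).le
  have hc := intervalIntegral.continuousOn_primitive_interval
    ((intervalIntegrable_iff_integrableOn_Icc_of_le hle).1
      (hF.intervalIntegrable_sphereMean h1 hle h2) |>.mono_set (uIcc_of_le hle).le)
  rw [uIcc_of_le hle] at hc
  have hca : ContinuousAt (fun s => ∫ ρ in r₁..s, ρ⁻¹ * sphereMean a (Z F) ρ) r :=
    hc.continuousAt (Icc_mem_nhds h1r h2r)
  have := (hca.add_const (sphereMean a F r₁))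
  refine (this.congr ?_).continuousWithinAt
  filter_upwards [Icc_mem_nhds h1r h2r] with s hs
  rw [← hF.sphereMean_sub h1 hs.1 (hs.2.trans_lt h2)]
  ring

/-- The mean of `F` is a primitive of `ρ⁻¹` times the mean of `ZF`. Continuity of the latter
upgrades differentiability to every radius. -/
theorem hasDerivAt_sphereMean (hF : RadiallyW11 a R F) (hc : ContinuousOn (sphereMean a (Z F)) (Ioo 0 R))
    (hr : r ∈ Ioo 0 R) : HasDerivAt (sphereMean a F) (r⁻¹ * sphereMean a (Z F) r) r := by
  obtain ⟨r₁, h1, h1r⟩ := exists_between hr.1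
  have hcont : ContinuousOn (fun ρ => ρ⁻¹ * sphereMean a (Z F) ρ) (Ioo 0 R) :=
    (continuousOn_inv₀.mono fun ρ hρ => hρ.1.ne').mul hc
  have hnh : Ioo 0 R ∈ 𝓝 r := Ioo_mem_nhds hr.1 hr.2
  have hd := intervalIntegral.integral_hasDerivAt_right
    (hF.intervalIntegrable_sphereMean h1 h1r.le hr.2)
    (hcont.stronglyMeasurableAtFilter isOpen_Ioo r hr) (hcont.continuousAt hnh)
  refine (hd.add_const (sphereMean a F r₁)).congr_of_eventuallyEq ?_
  filter_upwards [Ioo_mem_nhds h1r hr.2] with s hs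
  rw [← hF.sphereMean_sub h1 hs.1.le hs.2]
  ring

end RadiallyW11

end ThinObstacle

/-! ### Products of radially `H¹` functions, and arbitrary radial test densities -/

namespace ThinObstacle

variable {n : ℕ} {a R r : ℝ} {u : Pt n → ℝ}

/-- `f` is of class `C¹` off the thin space, and `f`, `Z f` are locally square integrable with
weight `|y|^a`. -/
structure RadiallyH1 (a R : ℝ) (f : Pt n → ℝ) : Prop where
  contDiffOn : ContDiffOn ℝ 1 f (offThin n R)
  integrableOn_sq : ∀ r, 0 < r → r < R →
    IntegrableOn (fun p => f p ^ 2 * wt a p) (Metric.ball 0 r)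
  integrableOn_sq_Z : ∀ r, 0 < r → r < R →
    IntegrableOn (fun p => Z f p ^ 2 * wt a p) (Metric.ball 0 r)

theorem Z_mul {f g : Pt n → ℝ} {p : Pt n} (hf : DifferentiableAt ℝ f p)
    (hg : DifferentiableAt ℝ g p) :
    Z (fun q => f q * g q) p = f p * Z g p + g p * Z f p := by
  unfold Z
  rw [fderiv_fun_mul hf hg]; simp

theorem RadiallyH1.differentiableAt {f : Pt n → ℝ} (hf : RadiallyH1 a R f) {p : Pt n}
    (hp : p ∈ offThin n R) : DifferentiableAt ℝ f p :=
  (hf.contDiffOn.contDiffAt ((isOpen_offThin R).mem_nhds hp)).differentiableAt one_ne_zero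

/-- Product rule for `Z`, each product being integrable as its factors are square integrable. With
`f, g` among `u, Zu` this gives continuous spherical means of `u²`, `u Zu` and `(Zu)²`. -/
theorem RadiallyH1.mul {f g : Pt n → ℝ} (hf : RadiallyH1 a R f) (hg : RadiallyH1 a R g) :
    RadiallyW11 a R (fun p => f p * g p) := by
  have hm : ∀ {f : Pt n → ℝ}, RadiallyH1 a R f → ∀ {r}, r < R →
      AEStronglyMeasurable f (volume.restrict (Metric.ball 0 r)) := fun hf r hr =>
    contDiffOn_offThin_aestronglyMeasurable
      (hf.contDiffOn.continuousOn.mono (offThin_mono hr.le))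
  refine ⟨hf.contDiffOn.mul hg.contDiffOn, fun r h0 hr => ?_, fun r h0 hr => ?_⟩
  · exact integrableOn_mul_mul_wt (hm hf hr) (hm hg hr) (hf.integrableOn_sq r h0 hr)
      (hg.integrableOn_sq r h0 hr)
  · have h1 := integrableOn_mul_mul_wt (hm hf hr) (measurable_Z g).aestronglyMeasurable
      (hf.integrableOn_sq r h0 hr) (hg.integrableOn_sq_Z r h0 hr)
    have h2 := integrableOn_mul_mul_wt (hm hg hr) (measurable_Z f).aestronglyMeasurable
      (hg.integrableOn_sq r h0 hr) (hf.integrableOn_sq_Z r h0 hr)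
    refine (h1.add h2).congr ?_
    filter_upwards [ae_offThin] with p hp
    have hp' := offThin_mono hr.le hp
    rw [Pi.add_apply, Z_mul (hf.differentiableAt hp') (hg.differentiableAt hp')]
    ring

theorem IsSolution.radiallyH1 (ha : -1 < a) (hu : IsSolution a R u) : RadiallyH1 a R u :=
  ⟨hu.contDiffOn.of_le (by norm_num), fun _ _ hr => integrableOn_sq_wt ha hr hu.continuousOn,
    fun _ h0 hr => integrableOn_sq_Z (hu.integrableOn_gr h0 hr)⟩

theorem IsSolution.radiallyH1_Z (ha : -1 < a) (hu : IsSolution a R u) : RadiallyH1 a R (Z u) :=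
  ⟨hu.contDiffOn_Z, fun _ h0 hr => integrableOn_sq_Z (hu.integrableOn_gr h0 hr),
    fun _ h0 hr => hu.integrableOn_sq_Z_Z ha h0 hr⟩

/-- Take `χ(p) = ∫_{|p|}^r 2ρ ζ(ρ) dρ` and exchange integrals as in the layer-cake formula.
Identities with a cutoff thereby become integrals over radii against an arbitrary density `ζ`. -/
theorem exists_radialCutoff_of_continuous (n : ℕ) (h0 : 0 < r) {ζ : ℝ → ℝ} (hζ : Continuous ζ)
    (hζ0 : ∀ ρ, 0 ≤ ζ ρ) (hz : ∀ ρ, r ≤ ρ → ζ ρ = 0) :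
    ∃ χ : Pt n → ℝ, RadialCutoff r χ (fun p => 2 * ζ ‖p‖) ∧
      ∀ F : Pt n → ℝ, IntegrableOn F (Metric.ball 0 r) →
        ∫ p, χ p * F p = ∫ ρ in Ioo 0 r, 2 * ρ * ζ ρ * ∫ p in Metric.ball (0 : Pt n) ρ, F p := by
  have hc : Continuous fun s => ζ (Real.sqrt s) := hζ.comp Real.continuous_sqrt
  -- The profile is written in the variable `|p|²`, so that the cutoff is `C¹` at the origin too.
  let g : ℝ → ℝ := fun s => ∫ σ in s..(r ^ 2), ζ (Real.sqrt σ)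
  have hg : ∀ s, HasDerivAt g (-ζ (Real.sqrt s)) s := fun s =>
    intervalIntegral.integral_hasDerivAt_left (hc.intervalIntegrable _ _)
      hc.stronglyMeasurable.stronglyMeasurableAtFilter hc.continuousAt
  have hg' : deriv g = fun s => -ζ (Real.sqrt s) := funext fun s => (hg s).deriv
  have hgc : ContDiff ℝ 1 g := contDiff_one_iff_deriv.2
    ⟨fun s => (hg s).differentiableAt, by rw [hg']; exact hc.neg⟩
  have hgz : ∀ s, r ^ 2 ≤ s → g s = 0 := by
    intro s hs
    have : EqOn (fun σ => ζ (Real.sqrt σ)) (fun _ => 0) (uIcc s (r ^ 2)) := by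
      intro σ hσ
      rw [uIcc_of_ge hs] at hσ
      exact hz _ (Real.le_sqrt_of_sq_le hσ.1)
    simp only [g]
    rw [intervalIntegral.integral_congr this]; simp
  have hg0 : ∀ s, 0 ≤ g s := by
    intro s
    rcases le_total s (r ^ 2) with h | h
    · exact intervalIntegral.integral_nonneg h fun σ _ => hζ0 _
    · rw [hgz s h]
  have hcut := radialCutoff_of_contDiff (n := n) h0.le hgc hg0 hgz
  refine ⟨fun p => g (‖p‖ ^ 2), ?_, fun F hF => ?_⟩
  · convert hcut using 2 with p
    simp only [hg', Real.sqrt_sq (norm_nonneg p)]; ring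
  have hgρ : ∀ ρ, 0 ≤ ρ → g (ρ ^ 2) = ∫ σ in ρ..r, 2 * σ * ζ σ := by
    intro ρ hρ
    have h1 := intervalIntegral.integral_comp_mul_deriv (a := ρ) (b := r)
      (f := fun x => x ^ 2) (f' := fun x => 2 * x) (g := fun s => ζ (Real.sqrt s))
      (fun x _ => by simpa using hasDerivAt_pow 2 x) (by fun_prop) hc
    simp only [g]
    rw [← h1]
    refine intervalIntegral.integral_congr_ae (ae_of_all _ fun σ hσ => ?_)
    have : 0 ≤ σ := (le_min hρ h0.le).trans hσ.1.le
    simp only [Function.comp, Real.sqrt_sq this]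
    ring
  let w : Pt n × ℝ → ℝ := fun z => if ‖z.1‖ < z.2 then 2 * z.2 * ζ z.2 else 0
  have hwm : Measurable w := by
    refine Measurable.ite (measurableSet_lt (by fun_prop) measurable_snd) ?_ measurable_const
    exact (measurable_snd.const_mul 2).mul (hζ.measurable.comp measurable_snd)
  obtain ⟨C, hC⟩ := (isCompact_Icc (a := 0) (b := r)).exists_bound_of_continuousOn
    (f := fun ρ => 2 * ρ * ζ ρ) (by fun_prop)
  have hC0 : 0 ≤ C := (norm_nonneg _).trans (hC 0 ⟨le_rfl, h0.le⟩)
  have hΦ : Integrable (fun z : Pt n × ℝ => w z * F z.1)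
      ((volume.restrict (Metric.ball 0 r)).prod (volume.restrict (Ioo 0 r))) := by
    have h1 : Integrable (fun z : Pt n × ℝ => F z.1)
        ((volume.restrict (Metric.ball 0 r)).prod (volume.restrict (Ioo 0 r))) :=
      Integrable.comp_fst hF _
    refine h1.bdd_mul (c := C) hwm.aestronglyMeasurable ?_
    have hmem : ∀ᵐ z ∂((volume.restrict (Metric.ball (0 : Pt n) r)).prod
        (volume.restrict (Ioo 0 r))), z.2 ∈ Ioo 0 r :=
      Measure.quasiMeasurePreserving_snd.ae (ae_restrict_mem measurableSet_Ioo)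
    filter_upwards [hmem] with z hz
    by_cases h : ‖z.1‖ < z.2
    · simp only [w, h, if_true]; exact hC z.2 ⟨hz.1.le, hz.2.le⟩
    · simpa [w, h] using hC0
  have e1 : ∫ p, g (‖p‖ ^ 2) * F p = ∫ p in Metric.ball (0 : Pt n) r, g (‖p‖ ^ 2) * F p := by
    refine (setIntegral_eq_integral_of_forall_compl_eq_zero fun p hp => ?_).symm
    rw [hcut.eq_zero p (by simpa using hp), zero_mul]
  have e2 : ∀ p ∈ Metric.ball (0 : Pt n) r, g (‖p‖ ^ 2) * F p =
      ∫ ρ in Ioo 0 r, w (p, ρ) * F p := by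
    intro p hp
    rw [mem_ball_zero_iff] at hp
    rw [integral_mul_const, hgρ _ (norm_nonneg p), intervalIntegral.integral_of_le hp.le,
      integral_Ioc_eq_integral_Ioo]
    congr 1
    have : ∀ ρ, w (p, ρ) = (Ioi ‖p‖).indicator (fun ρ => 2 * ρ * ζ ρ) ρ := fun ρ => by
      simp [w, indicator_apply]
    simp only [this]
    rw [setIntegral_indicator measurableSet_Ioi]
    congr 2
    ext ρ
    simp only [mem_Ioo, mem_inter_iff, mem_Ioi]
    constructor
    · exact fun h => ⟨⟨(norm_nonneg p).trans_lt h.1, h.2⟩, h.1⟩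
    · exact fun h => ⟨h.2, h.1.2⟩
  rw [e1, setIntegral_congr_fun measurableSet_ball e2,
    integral_integral_swap (f := fun p ρ => w (p, ρ) * F p) hΦ]
  refine setIntegral_congr_fun measurableSet_Ioo fun ρ hρ => ?_
  have : ∀ p, w (p, ρ) * F p = 2 * ρ * ζ ρ * (Metric.ball (0 : Pt n) ρ).indicator F p := by
    intro p
    by_cases h : ‖p‖ < ρ
    · rw [indicator_of_mem (by simpa using h)]; simp [w, h]
    · rw [indicator_of_notMem (by simpa using h)]; simp [w, h]
  simp only [this]
  rw [integral_const_mul, setIntegral_indicator measurableSet_ball,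
    inter_eq_self_of_subset_right (Metric.ball_subset_ball hρ.2.le)]

theorem integral_radial_mul {ζ : ℝ → ℝ} (hζ : Continuous ζ)
    (hz : ∀ ρ, r ≤ ρ → ζ ρ = 0) {F : Pt n → ℝ} (hF : IntegrableOn F (Metric.ball 0 r)) :
    ∫ p, 2 * ζ ‖p‖ * F p = ∫ ρ in Ioo 0 r, 2 * ζ ρ * sphereIntegral ρ F := by
  have h1 : Integrable fun p : Pt n => 2 * ζ ‖p‖ * F p :=
    integrable_continuous_mul (by fun_prop) (fun p hp => by rw [hz _ hp, mul_zero]) hF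
  have e1 : ∫ p, 2 * ζ ‖p‖ * F p = ∫ p in Metric.ball (0 : Pt n) r, 2 * ζ ‖p‖ * F p := by
    refine (setIntegral_eq_integral_of_forall_compl_eq_zero fun p hp => ?_).symm
    rw [hz _ (by simpa using hp), mul_zero, zero_mul]
  rw [e1, (setIntegral_ball_eq h1.integrableOn).2]
  refine setIntegral_congr_fun measurableSet_Ioo fun ρ hρ => ?_
  simp only [sphereIntegral]
  have : ∀ ω : Metric.sphere (0 : Pt n) 1, ‖ρ • (ω : Pt n)‖ = ρ := fun ω => by
    rw [norm_smul, Real.norm_of_nonneg hρ.1.le]; simp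
  simp only [this, integral_const_mul]
  ring

/-- Fundamental lemma of the calculus of variations. Cutoffs are available only for nonnegative
densities, so a smooth test function is split into its positive and negative parts, which are merely
continuous. -/
theorem ae_eq_zero_of_integral_nonneg_mul {k : ℝ → ℝ}
    (hk : ∀ r, 0 < r → r < R → IntegrableOn k (Ioo 0 r))
    (h : ∀ r, 0 < r → r < R → ∀ ζ : ℝ → ℝ, Continuous ζ → (∀ ρ, 0 ≤ ζ ρ) →
      (∀ ρ, r ≤ ρ → ζ ρ = 0) → ∫ ρ in Ioo 0 r, ζ ρ * k ρ = 0) :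
    ∀ᵐ ρ, ρ ∈ Ioo 0 R → k ρ = 0 := by
  refine isOpen_Ioo.ae_eq_zero_of_integral_contDiff_smul_eq_zero ?_ fun g hg hgc hgs => ?_
  · intro x hx
    obtain ⟨r, h1, h2⟩ := exists_between hx.2
    exact ⟨Ioo 0 r, mem_nhdsWithin_of_mem_nhds (Ioo_mem_nhds hx.1 h1), hk r (hx.1.trans h1) h2⟩
  rcases (tsupport g).eq_empty_or_nonempty with he | hne
  · have : g = 0 := tsupport_eq_empty_iff.1 he
    simp [this]
  obtain ⟨m, hm, hmax⟩ := hgc.isCompact.exists_isMaxOn hne continuousOn_id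
  obtain ⟨r, h1, h2⟩ := exists_between (hgs hm).2
  have h0 : 0 < r := (hgs hm).1.trans h1
  have hsub : tsupport g ⊆ Ioo 0 r := fun x hx => ⟨(hgs hx).1, (hmax hx).trans_lt h1⟩
  have hg0 : ∀ x, x ∉ Ioo 0 r → g x = 0 := fun x hx =>
    image_eq_zero_of_notMem_tsupport fun h' => hx (hsub h')
  have hz : ∀ x, r ≤ x → g x = 0 := fun x hx => hg0 x fun h' => absurd h'.2 (not_lt.2 hx)
  have hcont := hg.continuous
  have hint : ∀ ζ : ℝ → ℝ, Continuous ζ → IntegrableOn (fun ρ => ζ ρ * k ρ) (Ioo 0 r) := by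
    intro ζ hζ
    obtain ⟨C, hC⟩ := (isCompact_Icc (a := 0) (b := r)).exists_bound_of_continuousOn
      hζ.continuousOn
    refine (hk r h0 h2).bdd_mul (c := C) hζ.aestronglyMeasurable ?_
    filter_upwards [ae_restrict_mem measurableSet_Ioo] with x hx using hC x ⟨hx.1.le, hx.2.le⟩
  have c1 : Continuous fun x => max (g x) 0 := by fun_prop
  have c2 : Continuous fun x => max (-g x) 0 := by fun_prop
  have p1 := h r h0 h2 _ c1 (fun x => le_max_right _ _) fun x hx => by simp [hz x hx]
  have p2 := h r h0 h2 _ c2 (fun x => le_max_right _ _) fun x hx => by simp [hz x hx]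
  have e1 : ∫ x, g x • k x = ∫ x in Ioo 0 r, g x * k x :=
    (setIntegral_eq_integral_of_forall_compl_eq_zero fun x hx => by
      rw [hg0 x hx, zero_smul]).symm
  have e2 : ∀ x, g x * k x = max (g x) 0 * k x - max (-g x) 0 * k x := by
    intro x
    rw [← sub_mul]
    congr 1
    rcases le_total 0 (g x) with h' | h'
    · rw [max_eq_left h', max_eq_right (by linarith)]; ring
    · rw [max_eq_right h', max_eq_left (by linarith)]; ring
  rw [e1]
  simp only [e2]
  rw [integral_sub (hint _ c1) (hint _ c2), p1, p2, sub_zero]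

end ThinObstacle

/-! ### The Dirichlet integral and its derivative -/

namespace ThinObstacle

variable {n : ℕ} {a R r κ : ℝ} {u : Pt n → ℝ}

theorem dirichlet_eq (a : ℝ) (u : Pt n → ℝ) (r : ℝ) :
    dirichlet a u r = ∫ p in Metric.ball (0 : Pt n) r, gr u u p * wt a p := by
  simp only [dirichlet, norm_gradient_sq, wt]

namespace IsSolution

theorem intervalIntegrable_sphereIntegral_gr (hu : IsSolution a R u) (h0 : 0 < r) (hr : r < R) :
    IntervalIntegrable (fun ρ => sphereIntegral ρ (fun p => gr u u p * wt a p)) volume 0 r := by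
  rw [intervalIntegrable_iff_integrableOn_Ioo_of_le h0.le]
  exact (setIntegral_ball_eq (hu.integrableOn_gr h0 hr)).1

theorem dirichlet_eq_integral (hu : IsSolution a R u) (h0 : 0 < r) (hr : r < R) :
    dirichlet a u r = ∫ ρ in 0..r, sphereIntegral ρ (fun p => gr u u p * wt a p) := by
  rw [dirichlet_eq, (setIntegral_ball_eq (hu.integrableOn_gr h0 hr)).2,
    intervalIntegral.integral_of_le h0.le, integral_Ioc_eq_integral_Ioo]

theorem continuousOn_primitive (hu : IsSolution a R u) (h0 : 0 < r) (hr : r < R) :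
    ContinuousOn (fun s => ∫ ρ in 0..s, sphereIntegral ρ (fun p => gr u u p * wt a p))
      (Icc 0 r) := by
  have := intervalIntegral.continuousOn_primitive_interval
    ((intervalIntegrable_iff_integrableOn_Icc_of_le h0.le).1
      (hu.intervalIntegrable_sphereIntegral_gr h0 hr) |>.mono_set (uIcc_of_le h0.le).le)
  rwa [uIcc_of_le h0.le] at this

theorem continuousOn_dirichlet (hu : IsSolution a R u) :
    ContinuousOn (dirichlet a u) (Ioo 0 R) := by
  intro r hr
  obtain ⟨r₂, h1, h2⟩ := exists_between hr.2
  have h02 := hr.1.trans h1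
  have hc := (hu.continuousOn_primitive h02 h2).continuousAt (Icc_mem_nhds hr.1 h1)
  refine (hc.congr ?_).continuousWithinAt
  filter_upwards [Ioo_mem_nhds hr.1 h1] with s hs
  exact (hu.dirichlet_eq_integral hs.1 (hs.2.trans h2)).symm

theorem integrableOn_mul_dirichlet (hu : IsSolution a R u) (h0 : 0 < r) (hr : r < R) :
    IntegrableOn (fun ρ => ρ * dirichlet a u ρ) (Ioo 0 r) := by
  have h1 : IntegrableOn (fun s => s *
      ∫ ρ in 0..s, sphereIntegral ρ (fun p => gr u u p * wt a p)) (Icc 0 r) :=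
    (continuousOn_id.mul (hu.continuousOn_primitive h0 hr)).integrableOn_compact isCompact_Icc
  refine (h1.mono_set Ioo_subset_Icc_self).congr_fun (fun ρ hρ => ?_) measurableSet_Ioo
  simp only
  rw [hu.dirichlet_eq_integral hρ.1 (hρ.2.trans hr)]

/-- The energy identity for the cutoff built from `ζ` compares two integrals over radii against the
same arbitrary density. -/
theorem ae_dirichlet_eq (ha : -1 < a) (hu : IsSolution a R u) :
    ∀ᵐ ρ, ρ ∈ Ioo 0 R →
      ρ * dirichlet a u ρ - sphereIntegral ρ (fun p => u p * Z u p * wt a p) = 0 := by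
  have hF : ∀ r, 0 < r → r < R →
      IntegrableOn (fun p => u p * Z u p * wt a p) (Metric.ball 0 r) :=
    ((hu.radiallyH1 ha).mul (hu.radiallyH1_Z ha)).integrableOn
  refine ae_eq_zero_of_integral_nonneg_mul (fun r h0 hr => ?_) fun r h0 hr ζ hζ hζ0 hz => ?_
  · exact (hu.integrableOn_mul_dirichlet h0 hr).sub (setIntegral_ball_eq (hF r h0 hr)).1
  obtain ⟨χ, hχ, hχF⟩ := exists_radialCutoff_of_continuous n h0 hζ hζ0 hz
  have h1 := hu.integral_cutoff_eq ha h0 hr hχ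
  rw [hχF _ (hu.integrableOn_gr h0 hr), integral_radial_mul hζ hz (hF r h0 hr)] at h1
  obtain ⟨C, hC⟩ := (isCompact_Icc (a := 0) (b := r)).exists_bound_of_continuousOn
    hζ.continuousOn
  have hb : ∀ᵐ x ∂(volume.restrict (Ioo 0 r)), ‖ζ x‖ ≤ C := by
    filter_upwards [ae_restrict_mem measurableSet_Ioo] with x hx using hC x ⟨hx.1.le, hx.2.le⟩
  have i1 := (hu.integrableOn_mul_dirichlet h0 hr).bdd_mul hζ.aestronglyMeasurable hb
  have i2 := Integrable.bdd_mul (setIntegral_ball_eq (hF r h0 hr)).1 hζ.aestronglyMeasurable hb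
  simp only [mul_sub]
  rw [integral_sub i1 i2]
  have e1 : ∫ ρ in Ioo 0 r, 2 * ζ ρ * sphereIntegral ρ (fun p => u p * Z u p * wt a p) =
      2 * ∫ ρ in Ioo 0 r, ζ ρ * sphereIntegral ρ (fun p => u p * Z u p * wt a p) := by
    rw [← integral_const_mul]; congr 1; funext ρ; ring
  have e2 : ∫ ρ in Ioo 0 r, 2 * ρ * ζ ρ *
        ∫ p in Metric.ball (0 : Pt n) ρ, gr u u p * wt a p =
      2 * ∫ ρ in Ioo 0 r, ζ ρ * (ρ * dirichlet a u ρ) := by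
    rw [← integral_const_mul]; congr 1; funext ρ; rw [dirichlet_eq]; ring
  rw [e1, e2] at h1
  linarith

theorem ae_rellich (ha : -1 < a) (hu : IsSolution a R u) :
    ∀ᵐ ρ, ρ ∈ Ioo 0 R →
      2 * sphereIntegral ρ (fun p => Z u p * Z u p * wt a p) -
        (2 - Q n a) * (ρ * dirichlet a u ρ) -
        sphereIntegral ρ (fun p => ‖p‖ ^ 2 * (gr u u p * wt a p)) = 0 := by
  have hF : ∀ r, 0 < r → r < R →
      IntegrableOn (fun p => Z u p * Z u p * wt a p) (Metric.ball 0 r) :=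
    ((hu.radiallyH1_Z ha).mul (hu.radiallyH1_Z ha)).integrableOn
  have hG : ∀ r, 0 < r → r < R →
      IntegrableOn (fun p => ‖p‖ ^ 2 * (gr u u p * wt a p)) (Metric.ball 0 r) := by
    intro r h0 hr
    refine Integrable.bdd_mul (c := r ^ 2) (hu.integrableOn_gr h0 hr)
      (by fun_prop : Continuous fun p : Pt n => ‖p‖ ^ 2).aestronglyMeasurable ?_
    filter_upwards [ae_restrict_mem measurableSet_ball] with p hp
    rw [norm_pow, norm_norm]
    exact pow_le_pow_left₀ (norm_nonneg p) (mem_ball_zero_iff.1 hp).le 2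
  refine ae_eq_zero_of_integral_nonneg_mul (fun r h0 hr => ?_) fun r h0 hr ζ hζ hζ0 hz => ?_
  · exact (((setIntegral_ball_eq (hF r h0 hr)).1.const_mul 2).sub
      ((hu.integrableOn_mul_dirichlet h0 hr).const_mul _)).sub (setIntegral_ball_eq (hG r h0 hr)).1
  obtain ⟨χ, hχ, hχF⟩ := exists_radialCutoff_of_continuous n h0 hζ hζ0 hz
  have h1 := hu.integral_cutoff_rellich ha h0 hr hχ
  simp only [sq (Z u _)] at h1
  rw [hχF _ (hu.integrableOn_gr h0 hr), integral_radial_mul hζ hz (hF r h0 hr),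
    integral_radial_mul hζ hz (hG r h0 hr)] at h1
  obtain ⟨C, hC⟩ := (isCompact_Icc (a := 0) (b := r)).exists_bound_of_continuousOn
    hζ.continuousOn
  have hb : ∀ᵐ x ∂(volume.restrict (Ioo 0 r)), ‖ζ x‖ ≤ C := by
    filter_upwards [ae_restrict_mem measurableSet_Ioo] with x hx using hC x ⟨hx.1.le, hx.2.le⟩
  have i1 := (hu.integrableOn_mul_dirichlet h0 hr).bdd_mul hζ.aestronglyMeasurable hb
  have i2 := Integrable.bdd_mul (setIntegral_ball_eq (hF r h0 hr)).1 hζ.aestronglyMeasurable hb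
  have i3 := Integrable.bdd_mul (setIntegral_ball_eq (hG r h0 hr)).1 hζ.aestronglyMeasurable hb
  have e0 : ∀ ρ, ζ ρ * (2 * sphereIntegral ρ (fun p => Z u p * Z u p * wt a p) -
        (2 - Q n a) * (ρ * dirichlet a u ρ) -
        sphereIntegral ρ (fun p => ‖p‖ ^ 2 * (gr u u p * wt a p))) =
      2 * (ζ ρ * sphereIntegral ρ (fun p => Z u p * Z u p * wt a p)) -
      (2 - Q n a) * (ζ ρ * (ρ * dirichlet a u ρ)) -
      ζ ρ * sphereIntegral ρ (fun p => ‖p‖ ^ 2 * (gr u u p * wt a p)) := fun ρ => by ring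
  simp only [e0]
  have i4 := integral_sub ((i2.const_mul 2).sub (i1.const_mul (2 - Q n a))) i3
  simp only [Pi.sub_apply] at i4
  rw [i4, integral_sub (i2.const_mul 2) (i1.const_mul (2 - Q n a)),
    integral_const_mul, integral_const_mul]
  have e1 : ∀ G : Pt n → ℝ, ∫ ρ in Ioo 0 r, 2 * ζ ρ * sphereIntegral ρ G =
      2 * ∫ ρ in Ioo 0 r, ζ ρ * sphereIntegral ρ G := by
    intro G
    rw [← integral_const_mul]; congr 1; funext ρ; ring
  have e2 : ∫ ρ in Ioo 0 r, 2 * ρ * ζ ρ *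
        ∫ p in Metric.ball (0 : Pt n) ρ, gr u u p * wt a p =
      2 * ∫ ρ in Ioo 0 r, ζ ρ * (ρ * dirichlet a u ρ) := by
    rw [← integral_const_mul]; congr 1; funext ρ; rw [dirichlet_eq]; ring
  rw [e1, e1, e2] at h1
  linarith

/-- Both sides are continuous in the radius, so almost everywhere equality is equality. -/
theorem dirichlet_eq_sphereMean (ha : -1 < a) (hu : IsSolution a R u) (hr : r ∈ Ioo 0 R) :
    dirichlet a u r = r⁻¹ * (r ^ (Q n a - 1) * sphereMean a (fun p => u p * Z u p) r) := by
  have hc : ContinuousOn (fun r => r⁻¹ * (r ^ (Q n a - 1) *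
      sphereMean a (fun p => u p * Z u p) r)) (Ioo 0 R) := by
    refine (continuousOn_inv₀.mono fun ρ hρ => hρ.1.ne').mul (ContinuousOn.mul ?_
      ((hu.radiallyH1 ha).mul (hu.radiallyH1_Z ha)).continuousOn_sphereMean)
    exact ContinuousOn.rpow_const continuousOn_id fun x hx => Or.inl hx.1.ne'
  refine Measure.eqOn_open_of_ae_eq (μ := volume) (U := Ioo 0 R) ?_ isOpen_Ioo
    hu.continuousOn_dirichlet hc hr
  rw [EventuallyEq, ae_restrict_iff' measurableSet_Ioo]
  filter_upwards [hu.ae_dirichlet_eq ha] with ρ h hρ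
  have := h hρ
  rw [← sphereIntegral_mul_wt hρ.1, ← sub_eq_zero.1 this, inv_mul_cancel_left₀ hρ.1.ne']

/-- The spherical integral of `|∇u|²` is controlled only for almost every radius, but there the
Rellich identity equates it with a continuous function. The Dirichlet integral is a primitive of
that function, hence differentiable everywhere. -/
theorem hasDerivAt_dirichlet (ha : -1 < a) (hu : IsSolution a R u) (hr : r ∈ Ioo 0 R) :
    HasDerivAt (dirichlet a u) ((r ^ 2)⁻¹ *
      (2 * (r ^ (Q n a - 1) * sphereMean a (fun p => Z u p * Z u p) r) -
        (2 - Q n a) * (r * dirichlet a u r))) r := by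
  set k : ℝ → ℝ := fun r => (r ^ 2)⁻¹ *
      (2 * (r ^ (Q n a - 1) * sphereMean a (fun p => Z u p * Z u p) r) -
        (2 - Q n a) * (r * dirichlet a u r)) with hk
  have hc : ContinuousOn k (Ioo 0 R) := by
    refine ContinuousOn.mul (ContinuousOn.inv₀ (by fun_prop) fun ρ hρ => pow_ne_zero 2 hρ.1.ne') ?_
    refine ContinuousOn.sub (continuousOn_const.mul (ContinuousOn.mul ?_
      ((hu.radiallyH1_Z ha).mul (hu.radiallyH1_Z ha)).continuousOn_sphereMean))
      (continuousOn_const.mul (continuousOn_id.mul hu.continuousOn_dirichlet))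
    exact ContinuousOn.rpow_const continuousOn_id fun x hx => Or.inl hx.1.ne'
  have hae : ∀ᵐ ρ, ρ ∈ Ioo 0 R → sphereIntegral ρ (fun p => gr u u p * wt a p) = k ρ := by
    filter_upwards [hu.ae_rellich ha] with ρ h hρ
    have h1 := h hρ
    have h2 : sphereIntegral ρ (fun p : Pt n => ‖p‖ ^ 2 * (gr u u p * wt a p)) =
        ρ ^ 2 * sphereIntegral ρ (fun p => gr u u p * wt a p) := by
      have : ∀ ω : Metric.sphere (0 : Pt n) 1, ‖ρ • (ω : Pt n)‖ = ρ := fun ω => by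
        rw [norm_smul, Real.norm_of_nonneg hρ.1.le]; simp
      simp only [sphereIntegral, this, integral_const_mul]
      ring
    rw [h2, sphereIntegral_mul_wt hρ.1 (fun p => Z u p * Z u p)] at h1
    have h3 : ρ ^ 2 ≠ 0 := pow_ne_zero 2 hρ.1.ne'
    simp only [hk]
    rw [eq_inv_mul_iff_mul_eq₀ h3]
    linarith
  obtain ⟨r₁, h1, h1r⟩ := exists_between hr.1
  have hsub : ∀ s, r₁ ≤ s → s < R → dirichlet a u s - dirichlet a u r₁ = ∫ ρ in r₁..s, k ρ := by
    intro s hs hsR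
    have h1R := hs.trans_lt hsR
    rw [hu.dirichlet_eq_integral h1 h1R, hu.dirichlet_eq_integral (h1.trans_le hs) hsR,
      intervalIntegral.integral_interval_sub_left
        (hu.intervalIntegrable_sphereIntegral_gr (h1.trans_le hs) hsR)
        (hu.intervalIntegrable_sphereIntegral_gr h1 h1R)]
    refine intervalIntegral.integral_congr_ae ?_
    filter_upwards [hae] with ρ h hρ
    rw [uIoc_of_le hs] at hρ
    exact h ⟨h1.trans hρ.1, hρ.2.trans_lt hsR⟩
  have hint : IntervalIntegrable k volume r₁ r := by
    apply ContinuousOn.intervalIntegrable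
    rw [uIcc_of_le h1r.le]
    exact hc.mono fun x hx => ⟨h1.trans_le hx.1, hx.2.trans_lt hr.2⟩
  have hd := intervalIntegral.integral_hasDerivAt_right hint
    (hc.stronglyMeasurableAtFilter isOpen_Ioo r hr) (hc.continuousAt (Ioo_mem_nhds hr.1 hr.2))
  refine (hd.add_const (dirichlet a u r₁)).congr_of_eventuallyEq ?_
  filter_upwards [Ioo_mem_nhds h1r hr.2] with s hs
  rw [← hsub s hs.1.le hs.2]
  ring

end IsSolution

end ThinObstacle

/-! ### The Weiss functional: derivative, monotonicity and rigidity -/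

namespace ThinObstacle

variable {n : ℕ} {a R r κ : ℝ} {u : Pt n → ℝ}

theorem height_eq (hr : 0 < r) (a : ℝ) (u : Pt n → ℝ) :
    height a u r = r ^ (Q n a - 1) * sphereMean a (fun p => u p * u p) r := by
  rw [← sphereIntegral_mul_wt hr, height]
  simp only [sq, wt]

theorem sphereIntegrable_mul_wt (hr : 0 < r) {F : Pt n → ℝ}
    (h : Integrable (fun ω : Metric.sphere (0 : Pt n) 1 => F (r • (ω : Pt n)) * wt a (ω : Pt n))
      (sphereMeasure n)) : SphereIntegrable r (fun p => F p * |yc p| ^ a) := by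
  refine (h.const_mul (r ^ a)).congr (ae_of_all _ fun ω => ?_)
  have := wt_smul a hr (ω : Pt n)
  unfold wt at this
  simp only [this, wt]
  ring

theorem hasDerivAt_rpow_mul {c : ℝ} (hr : 0 < r) :
    HasDerivAt (fun s : ℝ => s ^ c) (c * r ^ (c - 1)) r :=
  Real.hasDerivAt_rpow_const (Or.inl hr.ne')

namespace IsSolution

theorem integrable_sphere_sq_sub (ha : -1 < a) (hu : IsSolution a R u) (hr : r ∈ Ioo 0 R) :
    Integrable (fun ω : Metric.sphere (0 : Pt n) 1 =>
      (Z u (r • (ω : Pt n)) - κ * u (r • (ω : Pt n))) ^ 2 * wt a (ω : Pt n)) (sphereMeasure n) ∧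
    sphereMean a (fun p => (Z u p - κ * u p) ^ 2) r =
      sphereMean a (fun p => Z u p * Z u p) r - 2 * κ * sphereMean a (fun p => u p * Z u p) r
        + κ ^ 2 * sphereMean a (fun p => u p * u p) r := by
  have h1 := ((hu.radiallyH1_Z ha).mul (hu.radiallyH1_Z ha)).integrable_sphere hr
  have h2 := (((hu.radiallyH1 ha).mul (hu.radiallyH1_Z ha)).integrable_sphere hr).const_mul (2 * κ)
  have h3 := (((hu.radiallyH1 ha).mul (hu.radiallyH1 ha)).integrable_sphere hr).const_mul (κ ^ 2)
  have e : ∀ ω : Metric.sphere (0 : Pt n) 1,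
      (Z u (r • (ω : Pt n)) - κ * u (r • (ω : Pt n))) ^ 2 * wt a (ω : Pt n) =
      Z u (r • (ω : Pt n)) * Z u (r • (ω : Pt n)) * wt a (ω : Pt n) -
      2 * κ * (u (r • (ω : Pt n)) * Z u (r • (ω : Pt n)) * wt a (ω : Pt n)) +
      κ ^ 2 * (u (r • (ω : Pt n)) * u (r • (ω : Pt n)) * wt a (ω : Pt n)) := fun ω => by ring
  refine ⟨((h1.sub h2).add h3).congr (ae_of_all _ fun ω => (e ω).symm), ?_⟩
  have e2 := integral_add' (h1.sub h2) h3
  rw [integral_sub' h1 h2, integral_const_mul, integral_const_mul] at e2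
  simp only [sphereMean]
  rw [← e2]
  exact integral_congr_ae (ae_of_all _ e)

theorem hasDerivAt_sphereMean_sq (ha : -1 < a) (hu : IsSolution a R u) (hr : r ∈ Ioo 0 R) :
    HasDerivAt (sphereMean a (fun p => u p * u p))
      (r⁻¹ * (2 * sphereMean a (fun p => u p * Z u p) r)) r := by
  have hu1 := hu.radiallyH1 ha
  have he : ∀ ρ ∈ Ioo 0 R, sphereMean a (Z (fun p => u p * u p)) ρ =
      2 * sphereMean a (fun p => u p * Z u p) ρ := by
    intro ρ hρ
    rw [sphereMean, sphereMean, ← integral_const_mul]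
    refine integral_congr_ae ?_
    filter_upwards [ae_sphere_yc_ne_zero] with ω hω
    have hd := hu1.differentiableAt (smul_sphere_mem_offThin hρ hω)
    rw [Z_mul hd hd]
    ring
  rw [← he r hr]
  refine (hu1.mul hu1).hasDerivAt_sphereMean ?_ hr
  exact (continuousOn_const.mul
    (hu1.mul (hu.radiallyH1_Z ha)).continuousOn_sphereMean).congr he

/-- The `(Q - 2) D` term of the Rellich identity cancels against the derivative of the power of `r`.
Rewriting the remaining multiple of `D` as a mean of `u Zu` completes the square `(Zu - κu)²`. -/
theorem hasDerivAt_weiss (ha : -1 < a) (hu : IsSolution a R u) (hr : r ∈ Ioo 0 R) :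
    HasDerivAt (weiss a κ u) (2 / r ^ (Q n a + 2 * κ) *
      sphereIntegral r (fun p => (Z u p - κ * u p) ^ 2 * |yc p| ^ a)) r := by
  have h0 := hr.1
  have hD := hu.hasDerivAt_dirichlet ha hr
  have hM := hu.hasDerivAt_sphereMean_sq ha hr
  have hp1 := hasDerivAt_rpow_mul (c := -(Q n a - 2 + 2 * κ)) h0
  have hp2 := hasDerivAt_rpow_mul (c := -(2 * κ)) h0
  have hW := (hp1.mul hD).sub ((hp2.const_mul κ).mul hM)
  have heq : weiss a κ u =ᶠ[𝓝 r] fun s => s ^ (-(Q n a - 2 + 2 * κ)) * dirichlet a u s -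
      κ * s ^ (-(2 * κ)) * sphereMean a (fun p => u p * u p) s := by
    filter_upwards [Ioi_mem_nhds h0] with s (hs : 0 < s)
    rw [weiss, height_eq hs, Real.rpow_neg hs.le, one_div, div_mul_eq_mul_div, ← mul_assoc]
    congr 1
    rw [mul_div_right_comm, mul_div_assoc]
    congr 2
    rw [show Q n a - 1 + 2 * κ = (Q n a - 1) + 2 * κ by ring, Real.rpow_add hs, Real.rpow_neg hs.le]
    have h1 := (Real.rpow_pos_of_pos hs (Q n a - 1)).ne'
    have h2 := (Real.rpow_pos_of_pos hs (2 * κ)).ne'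
    field_simp
  refine (hW.congr_of_eventuallyEq heq).congr_deriv ?_
  have hs : sphereIntegral r (fun p => (Z u p - κ * u p) ^ 2 * |yc p| ^ a) =
      r ^ (Q n a - 1) * sphereMean a (fun p => (Z u p - κ * u p) ^ 2) r :=
    sphereIntegral_mul_wt h0 (fun p => (Z u p - κ * u p) ^ 2)
  rw [hs, (hu.integrable_sphere_sq_sub ha hr).2, hu.dirichlet_eq_sphereMean ha hr]
  -- Every power is expressed through `r`, `r^Q` and `r^(2κ)`, which then serve as independent
  -- variables in a rational identity.
  have e1 : r ^ (-(Q n a - 2 + 2 * κ) - 1) = r * (r ^ Q n a)⁻¹ * (r ^ (2 * κ))⁻¹ := by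
    rw [← Real.rpow_neg h0.le, ← Real.rpow_neg h0.le]
    nth_rewrite 2 [← Real.rpow_one r]
    rw [← Real.rpow_add h0, ← Real.rpow_add h0]
    congr 1; ring
  have e2 : r ^ (-(Q n a - 2 + 2 * κ)) = r ^ 2 * (r ^ Q n a)⁻¹ * (r ^ (2 * κ))⁻¹ := by
    rw [← Real.rpow_neg h0.le, ← Real.rpow_neg h0.le, ← Real.rpow_natCast, ← Real.rpow_add h0,
      ← Real.rpow_add h0]
    congr 1; push_cast; ring
  have e3 : r ^ (-(2 * κ)) = (r ^ (2 * κ))⁻¹ := Real.rpow_neg h0.le _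
  have e4 : r ^ (-(2 * κ) - 1) = (r ^ (2 * κ))⁻¹ * r⁻¹ := by
    rw [Real.rpow_sub_one h0.ne', e3, div_eq_mul_inv]
  have e5 : r ^ (Q n a - 1) = r ^ Q n a * r⁻¹ := by
    rw [Real.rpow_sub_one h0.ne', div_eq_mul_inv]
  have e6 : r ^ (Q n a + 2 * κ) = r ^ Q n a * r ^ (2 * κ) := Real.rpow_add h0 _ _
  rw [e1, e2, e3, e4, e5, e6]
  have h1 := (Real.rpow_pos_of_pos h0 (Q n a)).ne'
  have h2 := (Real.rpow_pos_of_pos h0 (2 * κ)).ne'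
  have h3 := h0.ne'
  generalize r ^ Q n a = P at *
  generalize r ^ (2 * κ) = A at *
  field_simp
  ring

theorem sphereIntegral_nonneg (hr : 0 < r) :
    0 ≤ sphereIntegral r (fun p : Pt n => (Z u p - κ * u p) ^ 2 * |yc p| ^ a) :=
  mul_nonneg (pow_nonneg hr.le _) (integral_nonneg fun _ =>
    mul_nonneg (sq_nonneg _) (Real.rpow_nonneg (abs_nonneg _) _))

theorem monotoneOn_weiss (ha : -1 < a) (hu : IsSolution a R u) :
    MonotoneOn (weiss a κ u) (Ioo 0 R) := by
  refine monotoneOn_of_deriv_nonneg (convex_Ioo 0 R)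
    (fun r hr => (hu.hasDerivAt_weiss ha hr).continuousAt.continuousWithinAt)
    (fun r hr => ?_) fun r hr => ?_
  · rw [interior_Ioo] at hr
    exact (hu.hasDerivAt_weiss ha hr).differentiableAt.differentiableWithinAt
  · rw [interior_Ioo] at hr
    rw [(hu.hasDerivAt_weiss ha hr).deriv]
    exact mul_nonneg (div_nonneg zero_le_two (Real.rpow_nonneg hr.1.le _))
      (sphereIntegral_nonneg hr.1)

/-- A vanishing derivative kills the square on every sphere, hence its integral over balls. The
square is then zero almost everywhere, and everywhere off the thin space by continuity of `u` and
`Zu` there. -/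
theorem Z_eq_of_weiss_const (ha : -1 < a) (hu : IsSolution a R u) {c : ℝ}
    (hc : ∀ r ∈ Ioo 0 R, weiss a κ u r = c) : ∀ p ∈ offThin n R, Z u p = κ * u p := by
  have h1 : ∀ r ∈ Ioo 0 R,
      sphereIntegral r (fun p => (Z u p - κ * u p) ^ 2 * |yc p| ^ a) = 0 := by
    intro r hr
    have hd : HasDerivAt (weiss a κ u) 0 r := by
      refine (hasDerivAt_const r c).congr_of_eventuallyEq ?_
      filter_upwards [Ioo_mem_nhds hr.1 hr.2] with s hs using hc s hs
    have := (hu.hasDerivAt_weiss ha hr (κ := κ)).unique hd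
    exact (mul_eq_zero.1 this).resolve_left
      (div_pos two_pos (Real.rpow_pos_of_pos hr.1 _)).ne'
  intro p hp
  obtain ⟨r, hpr, hrR⟩ := exists_between (mem_ball_zero_iff.1 hp.1)
  have h0 : 0 < r := (norm_nonneg p).trans_lt hpr
  have hu1 := hu.radiallyH1 ha
  have hZ1 := hu.radiallyH1_Z ha
  have i1 := (hZ1.mul hZ1).integrableOn r h0 hrR
  have i2 := (hu1.mul hZ1).integrableOn r h0 hrR
  have i3 := (hu1.mul hu1).integrableOn r h0 hrR
  have hi : IntegrableOn (fun p => (Z u p - κ * u p) ^ 2 * |yc p| ^ a) (Metric.ball 0 r) := by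
    refine ((i1.sub (i2.const_mul (2 * κ))).add (i3.const_mul (κ ^ 2))).congr
      (ae_of_all _ fun p => ?_)
    simp only [Pi.add_apply, Pi.sub_apply, wt]
    ring
  have h2 := (setIntegral_ball_eq hi).2
  rw [setIntegral_congr_fun measurableSet_Ioo
    (g := fun _ => 0) (fun ρ hρ => h1 ρ ⟨hρ.1, hρ.2.trans hrR⟩)] at h2
  simp only [integral_zero] at h2
  rw [integral_eq_zero_iff_of_nonneg (fun p => mul_nonneg (sq_nonneg _)
    (Real.rpow_nonneg (abs_nonneg _) _)) hi] at h2
  have hsub : offThin n r ⊆ offThin n R := offThin_mono hrR.le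
  refine Measure.eqOn_open_of_ae_eq (μ := volume) (U := offThin n r) ?_ (isOpen_offThin r)
    (hZ1.contDiffOn.continuousOn.mono hsub)
    (continuousOn_const.mul (hu1.contDiffOn.continuousOn.mono hsub))
    ⟨mem_ball_zero_iff.2 hpr, hp.2⟩
  rw [restrict_offThin]
  filter_upwards [h2, ae_offThin] with q hq hq2
  have hw : |yc q| ^ a ≠ 0 := (Real.rpow_pos_of_pos (abs_pos.2 hq2.2) a).ne'
  have := (mul_eq_zero.1 hq).resolve_right hw
  exact sub_eq_zero.1 (pow_eq_zero_iff two_ne_zero |>.1 this)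

/-- Along the ray the function `s^(-κ) u(sp)` has zero derivative on `(0, R/|p|)`, an interval
containing both `1` and `t`. -/
theorem smul_eq_of_Z_eq (hu : IsSolution a R u) (hZ : ∀ p ∈ offThin n R, Z u p = κ * u p)
    {p : Pt n} (hp : p ∈ offThin n R) {t : ℝ} (ht : 0 < t) (htp : t • p ∈ Metric.ball (0 : Pt n) R) :
    u (t • p) = t ^ κ * u p := by
  have hp0 : 0 < ‖p‖ := (abs_pos.2 hp.2).trans_le (abs_yc_le p)
  set I := Ioo (0 : ℝ) (R / ‖p‖) with hI
  have hmem : ∀ s ∈ I, s • p ∈ offThin n R := by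
    intro s hs
    refine ⟨?_, ?_⟩
    · rw [mem_ball_zero_iff, norm_smul, Real.norm_of_nonneg hs.1.le]
      exact (lt_div_iff₀ hp0).1 hs.2
    · change yc _ ≠ 0
      rw [yc_smul]; exact mul_ne_zero hs.1.ne' hp.2
  have hd : ∀ s ∈ I, HasDerivAt (fun s : ℝ => s ^ (-κ) * u (s • p)) 0 s := by
    intro s hs
    have h1 := hasDerivAt_comp_smul_sphere (hu.contDiffOn.of_le (by norm_num)) hs.1.ne'
      (hmem s hs)
    refine ((hasDerivAt_rpow_mul (c := -κ) hs.1).mul h1).congr_deriv ?_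
    rw [hZ _ (hmem s hs), Real.rpow_sub_one hs.1.ne', div_eq_mul_inv]
    ring
  have h1I : (1 : ℝ) ∈ I := ⟨one_pos, (one_lt_div hp0).2 (mem_ball_zero_iff.1 hp.1)⟩
  have htI : t ∈ I := by
    refine ⟨ht, (lt_div_iff₀ hp0).2 ?_⟩
    rwa [mem_ball_zero_iff, norm_smul, Real.norm_of_nonneg ht.le] at htp
  have := isOpen_Ioo.is_const_of_deriv_eq_zero (s := I) isPreconnected_Ioo
    (fun s hs => (hd s hs).differentiableAt.differentiableWithinAt)
    (fun s hs => (hd s hs).deriv) htI h1I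
  simp only [Real.one_rpow, one_smul, one_mul] at this
  rw [← this, ← mul_assoc, ← Real.rpow_add ht]
  simp

/-- For fixed `t` the points `p` with `p` and `tp` in the ball form an open set. The relation holds
there off a null set, and both sides are continuous, which includes the thin space. -/
theorem isHomogeneousInBall_of_Z_eq (hu : IsSolution a R u)
    (hZ : ∀ p ∈ offThin n R, Z u p = κ * u p) : IsHomogeneousInBall κ R u := by
  intro p hp t ht htp
  let V : Set (Pt n) := Metric.ball 0 R ∩ (fun q => t • q) ⁻¹' Metric.ball 0 R
  have hV : IsOpen V := Metric.isOpen_ball.inter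
    (Metric.isOpen_ball.preimage (continuous_const_smul t))
  refine Measure.eqOn_open_of_ae_eq (μ := volume) (U := V) (f := fun q => u (t • q))
    (g := fun q => t ^ κ * u q) ?_ hV ?_ ?_ ⟨hp, htp⟩
  · rw [EventuallyEq, ae_restrict_iff' hV.measurableSet]
    filter_upwards [ae_yc_ne_zero] with q hq hqV
    exact hu.smul_eq_of_Z_eq hZ ⟨hqV.1, hq⟩ ht hqV.2
  · exact hu.continuousOn.comp (continuous_const_smul t).continuousOn fun q hq => hq.2
  · exact continuousOn_const.mul (hu.continuousOn.mono fun q hq => hq.1)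

/-- Euler's relation: differentiate the homogeneity in the dilation factor at `1`. -/
theorem Z_eq_of_isHomogeneousInBall (hu : IsSolution a R u) (h : IsHomogeneousInBall κ R u)
    {p : Pt n} (hp : p ∈ offThin n R) : Z u p = κ * u p := by
  have h1 := hasDerivAt_comp_smul_sphere (F := u) (p := p) (ρ := 1)
    (hu.contDiffOn.of_le (by norm_num)) one_ne_zero (by simpa using hp)
  have h2 : HasDerivAt (fun ρ : ℝ => ρ ^ κ * u p) (κ * 1 ^ (κ - 1) * u p) 1 :=
    (hasDerivAt_rpow_mul (c := κ) one_pos).mul_const (u p)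
  have h3 : (fun ρ : ℝ => u (ρ • p)) =ᶠ[𝓝 1] fun ρ => ρ ^ κ * u p := by
    have hc : Continuous fun ρ : ℝ => ρ • p := by fun_prop
    have hb : ∀ᶠ ρ in 𝓝 (1 : ℝ), ρ • p ∈ Metric.ball (0 : Pt n) R :=
      (hc.tendsto 1).eventually_mem (Metric.isOpen_ball.mem_nhds (by simpa using hp.1))
    filter_upwards [hb, Ioi_mem_nhds one_pos] with ρ hρ hρ0
    exact h p hp.1 ρ hρ0 hρ
  have := h1.unique (h2.congr_of_eventuallyEq h3)
  simpa using this

theorem weiss_const_of_isHomogeneousInBall (ha : -1 < a) (hu : IsSolution a R u)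
    (h : IsHomogeneousInBall κ R u) : ∃ c : ℝ, ∀ r ∈ Ioo 0 R, weiss a κ u r = c := by
  have hd : ∀ r ∈ Ioo 0 R, HasDerivAt (weiss a κ u) 0 r := by
    intro r hr
    refine (hu.hasDerivAt_weiss ha hr).congr_deriv ?_
    have hz : sphereIntegral r (fun p => (Z u p - κ * u p) ^ 2 * |yc p| ^ a) = 0 := by
      refine mul_eq_zero_of_right _ ?_
      refine integral_eq_zero_of_ae ?_
      filter_upwards [ae_sphere_yc_ne_zero] with ω hω
      simp [hu.Z_eq_of_isHomogeneousInBall h (smul_sphere_mem_offThin hr hω)]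
    rw [hz, mul_zero]
  refine ⟨weiss a κ u (R / 2), fun r hr => ?_⟩
  have hR : 0 < R := hr.1.trans hr.2
  exact isOpen_Ioo.is_const_of_deriv_eq_zero isPreconnected_Ioo
    (fun s hs => (hd s hs).differentiableAt.differentiableWithinAt) (fun s hs => (hd s hs).deriv)
    hr ⟨by linarith, by linarith⟩

end IsSolution

end ThinObstacle

theorem mainTheorem5 (n : ℕ) (hn : 1 ≤ n) (a : ℝ) (ha : a ∈ Set.Ioo (-1 : ℝ) 1)
    (R₀ : ℝ) (hR₀ : 0 < R₀) (u : ThinObstacle.Pt n → ℝ)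
    (hu : ThinObstacle.IsSolution a R₀ u) (κ : ℝ) (hκ : 0 < κ) :
    (∀ r ∈ Set.Ioo 0 R₀,
      ThinObstacle.SphereIntegrable r (fun p => u p ^ 2 * |ThinObstacle.yc p| ^ a) ∧
      ThinObstacle.SphereIntegrable r
        (fun p => (ThinObstacle.Z u p - κ * u p) ^ 2 * |ThinObstacle.yc p| ^ a) ∧
      HasDerivAt (ThinObstacle.weiss a κ u)
        (2 / r ^ (ThinObstacle.Q n a + 2 * κ) *
          ThinObstacle.sphereIntegral r
            (fun p => (ThinObstacle.Z u p - κ * u p) ^ 2 * |ThinObstacle.yc p| ^ a)) r) ∧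
    MonotoneOn (ThinObstacle.weiss a κ u) (Set.Ioo 0 R₀) ∧
    ((∃ c : ℝ, ∀ r ∈ Set.Ioo 0 R₀, ThinObstacle.weiss a κ u r = c) ↔
      ThinObstacle.IsHomogeneousInBall κ R₀ u) := by
  have ha' : -1 < a := ha.1
  refine ⟨fun r hr => ⟨?_, ?_, hu.hasDerivAt_weiss ha' hr⟩, hu.monotoneOn_weiss ha', ?_, ?_⟩
  · refine ThinObstacle.sphereIntegrable_mul_wt hr.1 (F := fun p => u p ^ 2) ?_
    simp only [sq]
    exact ((hu.radiallyH1 ha').mul (hu.radiallyH1 ha')).integrable_sphere hr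
  · exact ThinObstacle.sphereIntegrable_mul_wt hr.1 (F := fun p => (ThinObstacle.Z u p - κ * u p) ^ 2)
      (hu.integrable_sphere_sq_sub ha' hr).1
  · rintro ⟨c, hc⟩
    exact hu.isHomogeneousInBall_of_Z_eq (hu.Z_eq_of_weiss_const ha' hc)
  · exact hu.weiss_const_of_isHomogeneousInBall ha'
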